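/- Let $\mathcal P$ be a probability distribution on $\mathbb R$ that is symmetric, has variance $1$, and is sub-Gaussian; here a random variable $Z$ is called sub-Gaussian with parameter $\tau>0$ if $\mathbb P(|Z|\ge t)\le 2\exp(-t^2/(2\tau^2))$ for all $t>0$, and $\mathcal P$ is sub-Gaussian if this holds for $Z\sim\mathcal P$ with some parameter. Assume that $\operatorname{Var}(w^2)>0$ for $w\sim\mathcal P$. Then there exist constants $C, C_{\mathcal P}, W_1, W_2, \delta>0$, depending only on $\mathcal P$, such that the following holds for all integers $n,p,r\ge 1$ with $n\ge Crp$ and all $\tau>0$. Let $\beta^{(1)},\dots,\beta^{(n)}$ be random vectors in $\mathbb R^p$ whose entries have law $\mathcal P$, let $z_1,\dots,z_n$ be real random variables that are sub-Gaussian with parameter $\tau$, and let all the entries of the $\beta^{(i)}$ and all the $z_i$ be jointly independent. For a symmetric $M\in\mathbb R^{p\times p}$ put $$[\mathcal X(M)]_i=(\beta^{(i)})^{\mathsf T}M\beta^{(i)}\ (1\le i\le n),\qquad [\tilde{\mathcal X}(M)]_i=[\mathcal X(M)]_{2i-1}-[\mathcal X(M)]_{2i}\ (1\le i\le\lfloor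 n/2\rfloor),$$ and $\tilde{\mathcal X}^*(v)=\sum_{i=1}^{\lfloor n/2\rfloor}v_i\big(\beta^{(2i-1)}\beta^{(2i-1)\mathsf T}-\beta^{(2i)}\beta^{(2i)\mathsf T}\big)$. For a symmetric $A$ let $y=\mathcal X(A)+z$, $\tilde y_i=y_{2i-1}-y_{2i}$, and let $\hat A$ be any minimizer $$\hat A\in\operatorname*{arg\,min}_{M\in\mathbb R^{p\times p},\,M=M^{\mathsf T}}\Big\{\|M\|_*:\ \tfrac1n\|y-\mathcal X(M)\|_1\le 6\tau,\ \ \|\tilde{\mathcal X}^*(\tilde y-\tilde{\mathcal X}(M))\|\le\eta\Big\},\qquad \eta=C_{\mathcal P}\,\tau\big(\sqrt{np}+\sqrt{\log n}\,p\big),$$ where $\|\cdot\|_*$ is the nuclear norm (the sum of the singular values), $\|\cdot\|$ the spectral norm, and $\|\cdot\|_F$ the Frobenius norm. Then, with probability at least $1-2/n-5e^{-\delta p}$, for every symmetric $A\in\mathbb R^{p\times p}$ a minimizer $\hat A$ exists and every minimizer satisfies $$\|\hat A-A\|_F^2\ \le\ W_1\tau^2\min\Big(\frac{rp^2\log n}{n^2}+\frac{rp}{n},\,1\Big)+W_2\,\frac{\|A_{-\max(r)}\|_*^2}{r}.$$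 Here $A_{-\max(r)}=A-\sum_{i\le r}a_iu_iv_i^{\mathsf T}$ for a singular value decomposition $A=\sum_i a_iu_iv_i^{\mathsf T}$ with $a_1\ge a_2\ge\dots\ge0$. -/

import Mathlib

open MeasureTheory ProbabilityTheory Matrix

noncomputable section

/-- The random variable `Z` is sub-Gaussian with parameter `τ` (meaningful for `τ > 0`):
`P(|Z| ≥ t) ≤ 2 exp(-t² / (2 τ²))` for all `t > 0`. -/
def IsSubGaussianWith {Ω : Type*} [MeasurableSpace Ω] (Z : Ω → ℝ) (τ : ℝ) (μ : Measure Ω) : Prop :=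
  ∀ t : ℝ, 0 < t → μ.real {ω | t ≤ |Z ω|} ≤ 2 * Real.exp (-t ^ 2 / (2 * τ ^ 2))

/-- The squared Frobenius norm. -/
def frobeniusSq {p : ℕ} (M : Matrix (Fin p) (Fin p) ℝ) : ℝ :=
  ∑ i, ∑ j, M i j ^ 2

/-- The spectral norm: the operator norm of `M` for the Euclidean norm. -/
def matSpectralNorm {p : ℕ} (M : Matrix (Fin p) (Fin p) ℝ) : ℝ :=
  ‖Matrix.toEuclideanCLM (n := Fin p) (𝕜 := ℝ) M‖

/-- The nuclear norm: the sum of the singular values. -/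
def nuclearNorm {p : ℕ} (M : Matrix (Fin p) (Fin p) ℝ) : ℝ :=
  ∑ i ∈ Finset.range p, (Matrix.toEuclideanLin M).singularValues i

/-- `A = ∑ i, a i • u i (v i)ᵀ` is a singular value decomposition of `A`. -/
structure IsSVD {p : ℕ} (A : Matrix (Fin p) (Fin p) ℝ) (a : Fin p → ℝ)
    (u v : Fin p → EuclideanSpace ℝ (Fin p)) : Prop where
  antitone : Antitone a
  nonneg : ∀ i, 0 ≤ a i
  orthonormal_left : Orthonormal ℝ u
  orthonormal_right : Orthonormal ℝ v
  eq_sum : A = ∑ i, a i • Matrix.vecMulVec (u i).ofLp (v i).ofLp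

/-- `T` is a matrix `A_{max(r)}`: the sum of the terms of a singular value decomposition of `A`
that belong to the `r` largest singular values. It is unique up to the choice of the singular
vectors of a repeated singular value. -/
def IsMaxPart {p : ℕ} (r : ℕ) (A T : Matrix (Fin p) (Fin p) ℝ) : Prop :=
  ∃ (a : Fin p → ℝ) (u v : Fin p → EuclideanSpace ℝ (Fin p)), IsSVD A a u v ∧
    T = ∑ i with i.val < r, a i • Matrix.vecMulVec (u i).ofLp (v i).ofLp

/-- Symmetric rank-one projections: `[𝒳(M)]_i = (β⁽ⁱ⁾)ᵀ M β⁽ⁱ⁾`. -/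
def srop {n p : ℕ} (β : Fin n → Fin p → ℝ) (M : Matrix (Fin p) (Fin p) ℝ) : Fin n → ℝ :=
  fun i => β i ⬝ᵥ (M *ᵥ β i)

/-- The first index of the `i`-th pair of `1, …, n`: the index `2 i - 1`, counted from one. -/
def pairFst {n : ℕ} (i : Fin (n / 2)) : Fin n := ⟨2 * i.val, by omega⟩

/-- The second index of the `i`-th pair of `1, …, n`: the index `2 i`, counted from one. -/
def pairSnd {n : ℕ} (i : Fin (n / 2)) : Fin n := ⟨2 * i.val + 1, by omega⟩

/-- Pairwise differences `ỹ_i = y_{2i-1} - y_{2i}`, `i = 1, …, ⌊n/2⌋`. -/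
def pairDiff {n : ℕ} (y : Fin n → ℝ) : Fin (n / 2) → ℝ :=
  fun i => y (pairFst i) - y (pairSnd i)

/-- The map `𝒳̃`, `[𝒳̃(M)]_i = [𝒳(M)]_{2i-1} - [𝒳(M)]_{2i}`. -/
def sropDiff {n p : ℕ} (β : Fin n → Fin p → ℝ) (M : Matrix (Fin p) (Fin p) ℝ) : Fin (n / 2) → ℝ :=
  pairDiff (srop β M)

/-- The dual map `𝒳̃*(z) = ∑ i, z_i (β⁽²ⁱ⁻¹⁾ β⁽²ⁱ⁻¹⁾ᵀ - β⁽²ⁱ⁾ β⁽²ⁱ⁾ᵀ)`. -/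
def sropDiffDual {n p : ℕ} (β : Fin n → Fin p → ℝ) (z : Fin (n / 2) → ℝ) :
    Matrix (Fin p) (Fin p) ℝ :=
  ∑ i, z i • (Matrix.vecMulVec (β (pairFst i)) (β (pairFst i)) -
    Matrix.vecMulVec (β (pairSnd i)) (β (pairSnd i)))

/-- The feasible set of the estimator: the symmetric `M` with `‖y - 𝒳(M)‖₁ / n ≤ 6 τ` and
`‖𝒳̃*(ỹ - 𝒳̃(M))‖ ≤ η`. -/
def sropFeasible {n p : ℕ} (β : Fin n → Fin p → ℝ) (y : Fin n → ℝ) (τ η : ℝ) :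
    Set (Matrix (Fin p) (Fin p) ℝ) :=
  {M | M.IsSymm ∧ (∑ i, |y i - srop β M i|) / n ≤ 6 * τ ∧
    matSpectralNorm (sropDiffDual β (pairDiff y - sropDiff β M)) ≤ η}

/-- `Ahat` is a value of the estimator: it minimizes the nuclear norm over the feasible set. -/
def IsSropEstimator {n p : ℕ} (β : Fin n → Fin p → ℝ) (y : Fin n → ℝ) (τ η : ℝ)
    (Ahat : Matrix (Fin p) (Fin p) ℝ) : Prop :=
  Ahat ∈ sropFeasible β y τ η ∧ ∀ M ∈ sropFeasible β y τ η, nuclearNorm Ahat ≤ nuclearNorm M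

end

/-! ### Trace duality between the nuclear and the spectral norm -/

section LinearAlgebra

open scoped InnerProductSpace

variable {p : ℕ}

/-! Let H be the error, the estimator minus A. Since A is feasible, minimality of the nuclear norm
forces ‖H‖_* ≤ 3√r ‖H‖_F + 2‖A - T‖_*, with T the leading part of A
(`nuclearNorm_le_of_nuclearNorm_add_le`). If √r ‖H‖_F ≤ ‖A - T‖_*, the claim is immediate. Otherwise
‖H‖_* ≤ 5√r ‖H‖_F, so that H, once normalized, lies in `nuclearSphere p r`. On that set the ℓ¹ norm
of the paired measurements is at least a multiple of n, with high probability. Against this lower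
bound, the ℓ¹ constraint yields ‖H‖_F ≲ τ, and the spectral constraint, through Cauchy-Schwarz and
nuclear/spectral duality, yields ‖H‖_F ≲ √r η / n (`frobeniusSq_sub_le_of_isSropEstimator`).

The lower bound has two layers. For one H, pairing turns the quadratic form into a bilinear form in
β - β' and β + β'. By symmetry of the law, the coordinates of either factor can change sign
independently while the other factor stays fixed, so Khintchine's inequality applied twice bounds
the mean absolute value below by c₁‖H‖_F (`exists_le_integral_abs_pairForm`); Var(w²) > 0 keeps the
diagonal terms from vanishing. For all H at once, symmetrization and contraction inside an
exponential moment (`lintegral_pi_iSup_eexp_sub_abs_le`) replace the absolute values by a process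
linear in H. Duality bounds it by 5√r times the spectral norm of a sum of independent matrices ββᵀ -
β'β'ᵀ, whose exponential moments follow from a net on the sphere
(`lintegral_eexp_matSpectralNorm_le`). The result is nontrivial as soon as the number of pairs
exceeds a multiple of rp.

Feasibility of A concerns only the noise and the vectors. The same spectral estimate, with the
paired noise as weights, applies on each slice of fixed noise where max |z_i| ≤ 2τ√(log n) and ∑
z_i² ≤ 36nτ². No event mentions A, so a single event serves every symmetric A. -/

/-- The Frobenius inner product of two matrices. -/
def frobInner (M N : Matrix (Fin p) (Fin p) ℝ) : ℝ := (Mᵀ * N).trace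

theorem frobInner_eq_sum (M N : Matrix (Fin p) (Fin p) ℝ) :
    frobInner M N = ∑ i, ∑ j, M i j * N i j := by
  simp only [frobInner, Matrix.trace, Matrix.diag, Matrix.mul_apply, Matrix.transpose_apply]
  exact Finset.sum_comm

theorem frobInner_self (M : Matrix (Fin p) (Fin p) ℝ) : frobInner M M = frobeniusSq M := by
  simp [frobInner_eq_sum, frobeniusSq, sq]

theorem frobInner_comm (M N : Matrix (Fin p) (Fin p) ℝ) : frobInner M N = frobInner N M := by
  simp [frobInner_eq_sum, mul_comm]

theorem frobInner_add_left (M M' N : Matrix (Fin p) (Fin p) ℝ) :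
    frobInner (M + M') N = frobInner M N + frobInner M' N := by
  simp [frobInner, Matrix.add_mul]

theorem frobInner_sub_left (M M' N : Matrix (Fin p) (Fin p) ℝ) :
    frobInner (M - M') N = frobInner M N - frobInner M' N := by
  simp [frobInner, Matrix.sub_mul]

theorem frobInner_smul_left (c : ℝ) (M N : Matrix (Fin p) (Fin p) ℝ) :
    frobInner (c • M) N = c * frobInner M N := by
  simp [frobInner]

theorem frobInner_neg_right (M N : Matrix (Fin p) (Fin p) ℝ) :
    frobInner M (-N) = -frobInner M N := by
  simp [frobInner]

theorem frobInner_add_right (M N N' : Matrix (Fin p) (Fin p) ℝ) :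
    frobInner M (N + N') = frobInner M N + frobInner M N' := by
  simp [frobInner, Matrix.mul_add]

theorem frobInner_smul_right (c : ℝ) (M N : Matrix (Fin p) (Fin p) ℝ) :
    frobInner M (c • N) = c * frobInner M N := by
  simp [frobInner]

theorem frobInner_sum_right {ι : Type*} (s : Finset ι) (M : Matrix (Fin p) (Fin p) ℝ)
    (N : ι → Matrix (Fin p) (Fin p) ℝ) :
    frobInner M (∑ i ∈ s, N i) = ∑ i ∈ s, frobInner M (N i) := by
  simp [frobInner, Matrix.mul_sum, Matrix.trace_sum]

theorem frobInner_mul_left (Q M N : Matrix (Fin p) (Fin p) ℝ) :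
    frobInner (Q * M) N = frobInner M (Qᵀ * N) := by
  simp [frobInner, Matrix.mul_assoc]

theorem frobInner_mul_right (Q M N : Matrix (Fin p) (Fin p) ℝ) :
    frobInner (M * Q) N = frobInner M (N * Qᵀ) := by
  simp only [frobInner, Matrix.transpose_mul, ← Matrix.mul_assoc]
  rw [Matrix.mul_assoc, Matrix.trace_mul_comm]

theorem frobInner_vecMulVec (M : Matrix (Fin p) (Fin p) ℝ) (u v : Fin p → ℝ) :
    frobInner M (vecMulVec u v) = u ⬝ᵥ (M *ᵥ v) := by
  simp only [frobInner_eq_sum, vecMulVec_apply, dotProduct, mulVec, Finset.mul_sum]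
  exact Finset.sum_congr rfl fun i _ => Finset.sum_congr rfl fun j _ => by ring

theorem frobeniusSq_nonneg (M : Matrix (Fin p) (Fin p) ℝ) : 0 ≤ frobeniusSq M :=
  Finset.sum_nonneg fun _ _ => Finset.sum_nonneg fun _ _ => sq_nonneg _

theorem abs_frobInner_le (M N : Matrix (Fin p) (Fin p) ℝ) :
    |frobInner M N| ≤ √(frobeniusSq M) * √(frobeniusSq N) := by
  have h : frobInner M N ^ 2 ≤ frobeniusSq M * frobeniusSq N := by
    have := Finset.sum_mul_sq_le_sq_mul_sq (Finset.univ : Finset (Fin p × Fin p))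
      (fun x => M x.1 x.2) (fun x => N x.1 x.2)
    simpa [Fintype.sum_prod_type, frobInner_eq_sum, frobeniusSq] using this
  rw [← Real.sqrt_mul (frobeniusSq_nonneg M)]
  exact Real.abs_le_sqrt h

/-- A trace may be computed in any orthonormal basis; the singular basis of M is the one that will
be used. -/
theorem frobInner_eq_sum_inner (M N : Matrix (Fin p) (Fin p) ℝ)
    (b : OrthonormalBasis (Fin p) ℝ (EuclideanSpace ℝ (Fin p))) :
    frobInner M N = ∑ k, ⟪toEuclideanCLM (𝕜 := ℝ) M (b k), toEuclideanCLM (𝕜 := ℝ) N (b k)⟫_ℝ := by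
  have h1 : ∀ k, ⟪toEuclideanCLM (𝕜 := ℝ) M (b k), toEuclideanCLM (𝕜 := ℝ) N (b k)⟫_ℝ =
      ⟪b k, toEuclideanCLM (𝕜 := ℝ) (Mᵀ * N) (b k)⟫_ℝ := by
    intro k
    rw [inner_toEuclideanCLM, inner_toEuclideanCLM, ofLp_toEuclideanCLM, ← Matrix.mulVec_mulVec,
      Matrix.dotProduct_mulVec (b k).ofLp, Matrix.vecMul_transpose]
  simp_rw [h1]
  have h2 := LinearMap.trace_eq_sum_inner (toEuclideanLin (Mᵀ * N)) b
  have h3 : LinearMap.trace ℝ _ (toEuclideanLin (Mᵀ * N)) = (Mᵀ * N).trace := by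
    rw [Matrix.toEuclideanLin_eq_toLin_orthonormal]
    exact Matrix.trace_toLin_eq _ _
  rw [frobInner, ← h3, h2]
  rfl

theorem norm_toEuclideanCLM_le (N : Matrix (Fin p) (Fin p) ℝ) (x : EuclideanSpace ℝ (Fin p)) :
    ‖toEuclideanCLM (𝕜 := ℝ) N x‖ ≤ matSpectralNorm N * ‖x‖ :=
  ContinuousLinearMap.le_opNorm _ _

theorem matSpectralNorm_nonneg (N : Matrix (Fin p) (Fin p) ℝ) : 0 ≤ matSpectralNorm N :=
  norm_nonneg _

/-- The eigenvectors of `Mᵀ M` diagonalize it with the squares of the singular values. -/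
theorem exists_singular_basis (M : Matrix (Fin p) (Fin p) ℝ) :
    ∃ (b : OrthonormalBasis (Fin p) ℝ (EuclideanSpace ℝ (Fin p))) (s : Fin p → ℝ),
      (∀ i, 0 ≤ s i) ∧ nuclearNorm M = ∑ i, s i ∧
      ∀ i j, ⟪toEuclideanCLM (𝕜 := ℝ) M (b i), toEuclideanCLM (𝕜 := ℝ) M (b j)⟫_ℝ =
        if i = j then s i ^ 2 else 0 := by
  set L := toEuclideanLin M
  have hn : Module.finrank ℝ (EuclideanSpace ℝ (Fin p)) = p := finrank_euclideanSpace_fin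
  refine ⟨L.isSymmetric_adjoint_comp_self.eigenvectorBasis hn, fun i => L.singularValues i,
    fun i => L.singularValues_nonneg i, ?_, fun i j => ?_⟩
  · rw [nuclearNorm, Finset.sum_range]
  · set b := L.isSymmetric_adjoint_comp_self.eigenvectorBasis hn
    have h1 := L.isSymmetric_adjoint_comp_self.apply_eigenvectorBasis hn j
    have h2 : ⟪L (b i), L (b j)⟫_ℝ = ⟪b i, (LinearMap.adjoint L ∘ₗ L) (b j)⟫_ℝ := by
      rw [LinearMap.comp_apply, LinearMap.adjoint_inner_right]
    change ⟪L (b i), L (b j)⟫_ℝ = _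
    rw [h2, h1, inner_smul_right, orthonormal_iff_ite.1 b.orthonormal i j,
      L.sq_singularValues_fin hn]
    by_cases h : i = j
    · subst h; simp
    · simp [h]

theorem nuclearNorm_nonneg (M : Matrix (Fin p) (Fin p) ℝ) : 0 ≤ nuclearNorm M :=
  Finset.sum_nonneg fun i _ => LinearMap.singularValues_nonneg _ i

/-- In the right singular basis of M, the k-th term is at most ‖M b_k‖ ‖N b_k‖, and ‖M b_k‖ is the
k-th singular value. -/
theorem frobInner_le_nuclearNorm_mul (M N : Matrix (Fin p) (Fin p) ℝ) :
    frobInner M N ≤ nuclearNorm M * matSpectralNorm N := by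
  obtain ⟨b, s, hs, hM, hb⟩ := exists_singular_basis M
  rw [frobInner_eq_sum_inner M N b, hM, Finset.sum_mul]
  refine Finset.sum_le_sum fun k _ => (real_inner_le_norm _ _).trans ?_
  have h1 : ‖toEuclideanCLM (𝕜 := ℝ) M (b k)‖ = s k := by
    have := hb k k
    rw [real_inner_self_eq_norm_sq, if_pos rfl] at this
    exact (pow_left_inj₀ (norm_nonneg _) (hs k) two_ne_zero).1 this
  rw [h1]
  refine mul_le_mul_of_nonneg_left ?_ (hs k)
  simpa using norm_toEuclideanCLM_le N (b k)

/-- Equality in the duality is attained at the polar factor of M. With the previous inequality this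
gives the variational formula from which all properties of the nuclear norm are deduced. -/
theorem exists_frobInner_eq_nuclearNorm (M : Matrix (Fin p) (Fin p) ℝ) :
    ∃ N, matSpectralNorm N ≤ 1 ∧ frobInner M N = nuclearNorm M := by
  obtain ⟨b, s, hs, hM, hb⟩ := exists_singular_basis M
  set L := toEuclideanCLM (𝕜 := ℝ) M
  -- The polar factor sends b_i to M b_i / s_i; the convention 0⁻¹ = 0 makes it vanish on the kernel
  -- of M.
  set D : EuclideanSpace ℝ (Fin p) →L[ℝ] EuclideanSpace ℝ (Fin p) :=
    ∑ i, (s i)⁻¹ • (innerSL ℝ (b i)).smulRight (L (b i)) with hD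
  have hDx : ∀ x, D x = ∑ i, ((s i)⁻¹ * ⟪b i, x⟫_ℝ) • L (b i) := by
    intro x
    simp [hD, smul_smul]
  refine ⟨(toEuclideanCLM (𝕜 := ℝ)).symm D, ?_, ?_⟩
  · rw [matSpectralNorm]
    simp only [StarAlgEquiv.apply_symm_apply]
    refine ContinuousLinearMap.opNorm_le_bound _ zero_le_one fun x => ?_
    rw [one_mul]
    refine (pow_le_pow_iff_left₀ (norm_nonneg _) (norm_nonneg _) two_ne_zero).1 ?_
    rw [← real_inner_self_eq_norm_sq, hDx, sum_inner, ← b.sum_sq_norm_inner_right x]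
    refine Finset.sum_le_sum fun i _ => ?_
    rw [inner_sum]
    simp only [inner_smul_left, inner_smul_right, hb]
    simp only [mul_ite, mul_zero, Finset.sum_ite_eq, Finset.mem_univ, if_true, conj_trivial,
      Real.norm_eq_abs, sq_abs]
    rcases eq_or_ne (s i) 0 with h | h
    · simp [h]; positivity
    · apply le_of_eq; field_simp
  · rw [frobInner_eq_sum_inner M _ b, hM]
    refine Finset.sum_congr rfl fun k _ => ?_
    simp only [StarAlgEquiv.apply_symm_apply]
    rw [hDx, inner_sum]
    simp only [inner_smul_right, orthonormal_iff_ite.1 b.orthonormal]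
    change ∑ x, ((s x)⁻¹ * if x = k then 1 else 0) * ⟪L (b k), L (b x)⟫_ℝ = s k
    simp only [hb]
    rw [Finset.sum_eq_single k (fun x _ hx => by simp [hx]) (by simp)]
    simp only [if_true, mul_one]
    rcases eq_or_ne (s k) 0 with h | h
    · simp [h]
    · field_simp

end LinearAlgebra

/-! ### The nuclear norm as a dual norm, and the cone condition on the error -/

section NuclearNorm

open scoped InnerProductSpace

variable {p : ℕ}

theorem nuclearNorm_le_of_forall {M : Matrix (Fin p) (Fin p) ℝ} {c : ℝ}
    (h : ∀ N, matSpectralNorm N ≤ 1 → frobInner M N ≤ c) : nuclearNorm M ≤ c := by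
  obtain ⟨N, hN, hMN⟩ := exists_frobInner_eq_nuclearNorm M
  exact hMN ▸ h N hN

theorem frobInner_le_nuclearNorm {M N : Matrix (Fin p) (Fin p) ℝ} (hN : matSpectralNorm N ≤ 1) :
    frobInner M N ≤ nuclearNorm M :=
  (frobInner_le_nuclearNorm_mul M N).trans (mul_le_of_le_one_right (nuclearNorm_nonneg M) hN)

theorem matSpectralNorm_neg (N : Matrix (Fin p) (Fin p) ℝ) :
    matSpectralNorm (-N) = matSpectralNorm N := by
  simp [matSpectralNorm]

theorem matSpectralNorm_sub_le (M N : Matrix (Fin p) (Fin p) ℝ) :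
    matSpectralNorm (M - N) ≤ matSpectralNorm M + matSpectralNorm N := by
  rw [matSpectralNorm, map_sub]
  exact norm_sub_le _ _

theorem matSpectralNorm_transpose (N : Matrix (Fin p) (Fin p) ℝ) :
    matSpectralNorm Nᵀ = matSpectralNorm N := by
  have : Nᵀ = star N := by rw [Matrix.star_eq_conjTranspose, Matrix.conjTranspose_eq_transpose_of_trivial]
  rw [matSpectralNorm, this, map_star]
  exact LinearIsometryEquiv.norm_map ContinuousLinearMap.adjoint _

theorem frobeniusSq_transpose (N : Matrix (Fin p) (Fin p) ℝ) :
    frobeniusSq Nᵀ = frobeniusSq N :=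
  Finset.sum_comm

theorem nuclearNorm_add_le (M M' : Matrix (Fin p) (Fin p) ℝ) :
    nuclearNorm (M + M') ≤ nuclearNorm M + nuclearNorm M' :=
  nuclearNorm_le_of_forall fun N hN => by
    rw [frobInner_add_left]
    exact add_le_add (frobInner_le_nuclearNorm hN) (frobInner_le_nuclearNorm hN)

theorem nuclearNorm_smul_le {c : ℝ} (hc : 0 ≤ c) (M : Matrix (Fin p) (Fin p) ℝ) :
    nuclearNorm (c • M) ≤ c * nuclearNorm M :=
  nuclearNorm_le_of_forall fun N hN => by
    rw [frobInner_smul_left]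
    exact mul_le_mul_of_nonneg_left (frobInner_le_nuclearNorm hN) hc

theorem matSpectralNorm_le_sqrt_frobeniusSq (N : Matrix (Fin p) (Fin p) ℝ) :
    matSpectralNorm N ≤ √(frobeniusSq N) := by
  refine ContinuousLinearMap.opNorm_le_bound _ (Real.sqrt_nonneg _) fun x => ?_
  rw [EuclideanSpace.norm_eq, EuclideanSpace.norm_eq, ← Real.sqrt_mul (frobeniusSq_nonneg N)]
  refine Real.sqrt_le_sqrt ?_
  rw [frobeniusSq, Finset.sum_mul]
  refine Finset.sum_le_sum fun i _ => ?_
  rw [ofLp_toEuclideanCLM]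
  simp only [Real.norm_eq_abs, sq_abs]
  exact Finset.sum_mul_sq_le_sq_mul_sq Finset.univ (fun j => N i j) (fun j => x.ofLp j)

/-- Duality of M with itself gives ‖M‖_F² ≤ ‖M‖_* ‖M‖ ≤ ‖M‖_* ‖M‖_F. -/
theorem sqrt_frobeniusSq_le_nuclearNorm (M : Matrix (Fin p) (Fin p) ℝ) :
    √(frobeniusSq M) ≤ nuclearNorm M := by
  have h1 := frobInner_le_nuclearNorm_mul M M
  rw [frobInner_self] at h1
  have h2 := mul_le_mul_of_nonneg_left (matSpectralNorm_le_sqrt_frobeniusSq M)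
    (nuclearNorm_nonneg M)
  rcases (Real.sqrt_nonneg (frobeniusSq M)).eq_or_lt with h | h
  · rw [← h]; exact nuclearNorm_nonneg M
  · refine le_of_mul_le_mul_right ?_ h
    rw [Real.mul_self_sqrt (frobeniusSq_nonneg M)]
    exact h1.trans h2

theorem abs_apply_le_matSpectralNorm (N : Matrix (Fin p) (Fin p) ℝ) (i j : Fin p) :
    |N i j| ≤ matSpectralNorm N := by
  have h1 := norm_toEuclideanCLM_le N (EuclideanSpace.single j 1)
  have h2 := PiLp.norm_apply_le (toEuclideanCLM (𝕜 := ℝ) N (EuclideanSpace.single j 1)) i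
  rw [ofLp_toEuclideanCLM] at h2
  simp at h1 h2
  exact h2.trans h1

theorem nuclearNorm_le_sum_abs (M : Matrix (Fin p) (Fin p) ℝ) :
    nuclearNorm M ≤ ∑ i, ∑ j, |M i j| :=
  nuclearNorm_le_of_forall fun N hN => by
    rw [frobInner_eq_sum]
    refine Finset.sum_le_sum fun i _ => Finset.sum_le_sum fun j _ => ?_
    refine (le_abs_self _).trans ?_
    rw [abs_mul]
    exact mul_le_of_le_one_right (abs_nonneg _) ((abs_apply_le_matSpectralNorm N i j).trans hN)

theorem abs_nuclearNorm_sub_le (M M' : Matrix (Fin p) (Fin p) ℝ) :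
    |nuclearNorm M - nuclearNorm M'| ≤ ∑ i, ∑ j, |M i j - M' i j| := by
  rw [abs_le]
  have h1 := nuclearNorm_add_le (M - M') M'
  have h2 := nuclearNorm_add_le (M' - M) M
  have h3 := nuclearNorm_le_sum_abs (M - M')
  have h4 := nuclearNorm_le_sum_abs (M' - M)
  simp only [sub_add_cancel, Matrix.sub_apply] at h1 h2 h3 h4
  simp only [abs_sub_comm (M' _ _)] at h4
  constructor <;> linarith

theorem continuous_nuclearNorm :
    Continuous (nuclearNorm : Matrix (Fin p) (Fin p) ℝ → ℝ) := by
  refine continuous_iff_continuousAt.2 fun M => ?_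
  rw [ContinuousAt, tendsto_iff_dist_tendsto_zero]
  refine squeeze_zero (fun _ => dist_nonneg) (fun N => abs_nuclearNorm_sub_le N M) ?_
  have h : Continuous fun N : Matrix (Fin p) (Fin p) ℝ => ∑ i, ∑ j, |N i j - M i j| := by
    fun_prop
  simpa using h.tendsto M

theorem toEuclideanCLM_mul_apply (M N : Matrix (Fin p) (Fin p) ℝ) (x : EuclideanSpace ℝ (Fin p)) :
    toEuclideanCLM (𝕜 := ℝ) (M * N) x =
      toEuclideanCLM (𝕜 := ℝ) M (toEuclideanCLM (𝕜 := ℝ) N x) := by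
  rw [map_mul]; rfl

theorem toEuclideanCLM_one_sub_apply (M : Matrix (Fin p) (Fin p) ℝ)
    (x : EuclideanSpace ℝ (Fin p)) :
    toEuclideanCLM (𝕜 := ℝ) (1 - M) x = x - toEuclideanCLM (𝕜 := ℝ) M x := by
  rw [map_sub, map_one]; rfl

theorem toEuclideanCLM_vecMulVec (u v x : EuclideanSpace ℝ (Fin p)) :
    toEuclideanCLM (𝕜 := ℝ) (vecMulVec u.ofLp v.ofLp) x = ⟪v, x⟫_ℝ • u := by
  ext i
  rw [ofLp_toEuclideanCLM, vecMulVec_mulVec]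
  simp [EuclideanSpace.inner_eq_star_dotProduct, dotProduct_comm, mul_comm]

variable {w v : Fin p → EuclideanSpace ℝ (Fin p)}

theorem norm_sq_sum_smul_orthonormal (hw : Orthonormal ℝ w) (s : Finset (Fin p)) (c : Fin p → ℝ) :
    ‖∑ i ∈ s, c i • w i‖ ^ 2 = ∑ i ∈ s, c i ^ 2 := by
  rw [← real_inner_self_eq_norm_sq, hw.inner_sum]
  simp [sq]

theorem norm_sq_sub_sum_inner_smul (hw : Orthonormal ℝ w) (s : Finset (Fin p))
    (x : EuclideanSpace ℝ (Fin p)) :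
    ‖x - ∑ i ∈ s, ⟪w i, x⟫_ℝ • w i‖ ^ 2 = ‖x‖ ^ 2 - ∑ i ∈ s, ⟪w i, x⟫_ℝ ^ 2 := by
  rw [norm_sub_sq_real, norm_sq_sum_smul_orthonormal hw, inner_sum]
  have : ∀ i, ⟪x, ⟪w i, x⟫_ℝ • w i⟫_ℝ = ⟪w i, x⟫_ℝ ^ 2 := fun i => by
    rw [inner_smul_right, real_inner_comm, sq]
  simp only [this]
  ring

theorem inner_sum_smul_sub_sum_inner_smul (hw : Orthonormal ℝ w) (s : Finset (Fin p))
    (c : Fin p → ℝ) (x : EuclideanSpace ℝ (Fin p)) :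
    ⟪∑ i ∈ s, c i • w i, x - ∑ i ∈ s, ⟪w i, x⟫_ℝ • w i⟫_ℝ = 0 := by
  rw [inner_sub_right, hw.inner_sum, sum_inner]
  simp [inner_smul_left]

/-- The matrix `∑ i ∈ s, w i (v i)ᵀ`. -/
def outerSum (s : Finset (Fin p)) (w v : Fin p → EuclideanSpace ℝ (Fin p)) :
    Matrix (Fin p) (Fin p) ℝ :=
  ∑ i ∈ s, vecMulVec (w i).ofLp (v i).ofLp

theorem toEuclideanCLM_outerSum (s : Finset (Fin p)) (w v : Fin p → EuclideanSpace ℝ (Fin p))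
    (x : EuclideanSpace ℝ (Fin p)) :
    toEuclideanCLM (𝕜 := ℝ) (outerSum s w v) x = ∑ i ∈ s, ⟪v i, x⟫_ℝ • w i := by
  simp [outerSum, map_sum, toEuclideanCLM_vecMulVec]

theorem outerSum_transpose (s : Finset (Fin p)) (w v : Fin p → EuclideanSpace ℝ (Fin p)) :
    (outerSum s w v)ᵀ = outerSum s v w := by
  simp [outerSum, Matrix.transpose_sum, Matrix.transpose_vecMulVec]

theorem frobInner_outerSum (M : Matrix (Fin p) (Fin p) ℝ) (s : Finset (Fin p))
    (w v : Fin p → EuclideanSpace ℝ (Fin p)) :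
    frobInner M (outerSum s w v) = ∑ i ∈ s, ⟪w i, toEuclideanCLM (𝕜 := ℝ) M (v i)⟫_ℝ := by
  simp [outerSum, frobInner_sum_right, frobInner_vecMulVec, inner_toEuclideanCLM]

theorem mul_outerSum (M : Matrix (Fin p) (Fin p) ℝ) (s : Finset (Fin p))
    (w v : Fin p → EuclideanSpace ℝ (Fin p)) :
    M * outerSum s w v = outerSum s (fun i => toEuclideanCLM (𝕜 := ℝ) M (w i)) v := by
  simp [outerSum, Matrix.mul_sum, mul_vecMulVec]

theorem frobeniusSq_outerSum (hv : Orthonormal ℝ v) (s : Finset (Fin p))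
    (w : Fin p → EuclideanSpace ℝ (Fin p)) :
    frobeniusSq (outerSum s w v) = ∑ i ∈ s, ‖w i‖ ^ 2 := by
  rw [← frobInner_self, frobInner_outerSum]
  refine Finset.sum_congr rfl fun i hi => ?_
  rw [toEuclideanCLM_outerSum]
  simp [orthonormal_iff_ite.1 hv, hi]

theorem frobeniusSq_mul_outerSum_le (hv : Orthonormal ℝ v) (s : Finset (Fin p))
    {N : Matrix (Fin p) (Fin p) ℝ} (hN : matSpectralNorm N ≤ 1) :
    frobeniusSq (N * outerSum s v v) ≤ s.card := by
  rw [mul_outerSum, frobeniusSq_outerSum hv, Finset.card_eq_sum_ones, Nat.cast_sum]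
  refine Finset.sum_le_sum fun i _ => ?_
  have h1 := norm_toEuclideanCLM_le N (v i)
  rw [hv.1 i, mul_one] at h1
  simpa using pow_le_one₀ (norm_nonneg _) (h1.trans hN) (n := 2)

theorem matSpectralNorm_mul_le (M N : Matrix (Fin p) (Fin p) ℝ) :
    matSpectralNorm (M * N) ≤ matSpectralNorm M * matSpectralNorm N := by
  rw [matSpectralNorm, map_mul]
  exact norm_mul_le _ _

theorem matSpectralNorm_one_sub_outerSum_le (hv : Orthonormal ℝ v) (s : Finset (Fin p)) :
    matSpectralNorm (1 - outerSum s v v) ≤ 1 := by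
  refine ContinuousLinearMap.opNorm_le_bound _ zero_le_one fun x => ?_
  rw [toEuclideanCLM_one_sub_apply, toEuclideanCLM_outerSum, one_mul]
  refine (pow_le_pow_iff_left₀ (norm_nonneg _) (norm_nonneg _) two_ne_zero).1 ?_
  rw [norm_sq_sub_sum_inner_smul hv]
  have : 0 ≤ ∑ i ∈ s, ⟪v i, x⟫_ℝ ^ 2 := Finset.sum_nonneg fun _ _ => sq_nonneg _
  linarith

/-- A partial isometry plus a contraction between the orthogonal complements is a contraction. -/
theorem matSpectralNorm_outerSum_add_le (hw : Orthonormal ℝ w) (hv : Orthonormal ℝ v)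
    (s : Finset (Fin p)) {W : Matrix (Fin p) (Fin p) ℝ} (hW : matSpectralNorm W ≤ 1) :
    matSpectralNorm (outerSum s w v + (1 - outerSum s w w) * W * (1 - outerSum s v v)) ≤ 1 := by
  refine ContinuousLinearMap.opNorm_le_bound _ zero_le_one fun x => ?_
  rw [one_mul]
  refine (pow_le_pow_iff_left₀ (norm_nonneg _) (norm_nonneg _) two_ne_zero).1 ?_
  set y := toEuclideanCLM (𝕜 := ℝ) W (x - ∑ i ∈ s, ⟪v i, x⟫_ℝ • v i) with hy
  have h1 : toEuclideanCLM (𝕜 := ℝ)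
      (outerSum s w v + (1 - outerSum s w w) * W * (1 - outerSum s v v)) x =
      ∑ i ∈ s, ⟪v i, x⟫_ℝ • w i + (y - ∑ i ∈ s, ⟪w i, y⟫_ℝ • w i) := by
    rw [map_add, _root_.add_apply, toEuclideanCLM_mul_apply, toEuclideanCLM_mul_apply,
      toEuclideanCLM_one_sub_apply, toEuclideanCLM_one_sub_apply, toEuclideanCLM_outerSum,
      toEuclideanCLM_outerSum, toEuclideanCLM_outerSum, ← hy]
  rw [h1, norm_add_sq_real, inner_sum_smul_sub_sum_inner_smul hw, norm_sq_sum_smul_orthonormal hw,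
    norm_sq_sub_sum_inner_smul hw]
  have h2 : 0 ≤ ∑ i ∈ s, ⟪w i, y⟫_ℝ ^ 2 := Finset.sum_nonneg fun _ _ => sq_nonneg _
  have h3 : ‖y‖ ≤ ‖x - ∑ i ∈ s, ⟪v i, x⟫_ℝ • v i‖ :=
    (norm_toEuclideanCLM_le W _).trans (mul_le_of_le_one_left (norm_nonneg _) hW)
  have h4 := pow_le_pow_left₀ (norm_nonneg _) h3 2
  rw [norm_sq_sub_sum_inner_smul hv] at h4
  linarith

/-- If adding `H` does not increase the nuclear norm of `A`, then `H` is concentrated near the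
row and column spaces of the leading part of `A`. -/
theorem nuclearNorm_le_of_nuclearNorm_add_le {r : ℕ} {A T H : Matrix (Fin p) (Fin p) ℝ}
    (hT : IsMaxPart r A T) (hH : nuclearNorm (A + H) ≤ nuclearNorm A) :
    nuclearNorm H ≤ 3 * √r * √(frobeniusSq H) + 2 * nuclearNorm (A - T) := by
  obtain ⟨a, u, v, ⟨_, ha, hu, hv, hA⟩, hT⟩ := hT
  set s : Finset (Fin p) := Finset.univ.filter fun i => i.val < r
  have hs : (s.card : ℝ) ≤ r := by
    have h : s.card ≤ (Finset.range r).card := by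
      refine Finset.card_le_card_of_injOn (fun i => i.val) (fun i hi => ?_) ?_
      · simpa [s] using hi
      · exact fun i _ j _ h => Fin.ext h
    rw [Finset.card_range] at h
    exact_mod_cast h
  set F := √(frobeniusSq H)
  have hF : 0 ≤ F := Real.sqrt_nonneg _
  have hfrob : ∀ N : Matrix (Fin p) (Fin p) ℝ, frobeniusSq N ≤ s.card →
      |frobInner H N| ≤ √r * F := fun N hN => by
    rw [mul_comm]
    exact (abs_frobInner_le H N).trans
      (mul_le_mul_of_nonneg_left (Real.sqrt_le_sqrt (hN.trans hs)) hF)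
  set U := outerSum s u u with hU
  set V := outerSum s v v with hV
  have hUt : Uᵀ = U := outerSum_transpose _ _ _
  have hVt : Vᵀ = V := outerSum_transpose _ _ _
  set H₂ := (1 - U) * H * (1 - V) with hH₂
  -- The dual certificate is ∑_{i<r} u_i v_iᵀ + W'. Its first part detects T, while W' detects the
  -- block H₂ of H off the leading singular spaces and is blind to T.
  obtain ⟨W, hW, hWH⟩ := exists_frobInner_eq_nuclearNorm H₂
  set W' := (1 - U) * W * (1 - V) with hW'
  have hadj : ∀ M N : Matrix (Fin p) (Fin p) ℝ,
      frobInner M ((1 - U) * N * (1 - V)) = frobInner ((1 - U) * M * (1 - V)) N := fun M N => by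
    rw [frobInner_mul_right, frobInner_mul_left]
    simp [Matrix.transpose_sub, hUt, hVt, Matrix.mul_assoc]
  have hspec : matSpectralNorm W' ≤ 1 := by
    refine (matSpectralNorm_mul_le _ _).trans (mul_le_one₀ ((matSpectralNorm_mul_le _ _).trans
      (mul_le_one₀ ?_ (matSpectralNorm_nonneg _) hW)) (matSpectralNorm_nonneg _) ?_)
    · exact matSpectralNorm_one_sub_outerSum_le hu s
    · exact matSpectralNorm_one_sub_outerSum_le hv s
  have hAv : ∀ i, toEuclideanCLM (𝕜 := ℝ) A (v i) = a i • u i := fun i => by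
    rw [hA]
    simp [map_sum, toEuclideanCLM_vecMulVec, orthonormal_iff_ite.1 hv]
  have hTn : nuclearNorm T ≤ ∑ i ∈ s, a i := nuclearNorm_le_of_forall fun N hN => by
    rw [hT, frobInner_comm, frobInner_sum_right]
    refine Finset.sum_le_sum fun i _ => ?_
    rw [frobInner_smul_right, frobInner_vecMulVec, ← inner_toEuclideanCLM]
    refine mul_le_of_le_one_right (ha i) ((real_inner_le_norm _ _).trans ?_)
    rw [hu.1 i, one_mul]
    have := norm_toEuclideanCLM_le N (v i)
    rw [hv.1 i, mul_one] at this
    exact this.trans hN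
  have hE : frobInner A (outerSum s u v) = ∑ i ∈ s, a i := by
    rw [frobInner_outerSum]
    refine Finset.sum_congr rfl fun i _ => ?_
    rw [hAv, inner_smul_right, real_inner_self_eq_norm_sq, hu.1 i]
    simp
  have hTW : frobInner T W' = 0 := by
    rw [hT, frobInner_comm, frobInner_sum_right]
    refine Finset.sum_eq_zero fun i hi => ?_
    rw [frobInner_smul_right, frobInner_vecMulVec, ← inner_toEuclideanCLM, hW',
      toEuclideanCLM_mul_apply, toEuclideanCLM_one_sub_apply, hV, toEuclideanCLM_outerSum]
    have : ∑ j ∈ s, ⟪v j, v i⟫_ℝ • v j = v i := by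
      have hi' : i ∈ s := hi
      simp [orthonormal_iff_ite.1 hv, hi']
    rw [this]
    simp
  have hRW : -nuclearNorm (A - T) ≤ frobInner (A - T) W' := by
    have := frobInner_le_nuclearNorm (M := A - T) (N := -W') (by rwa [matSpectralNorm_neg])
    rw [frobInner_neg_right] at this
    linarith
  have hHE := abs_le.1 (hfrob (outerSum s u v) (by
    rw [frobeniusSq_outerSum hv]; simp [hu.1]))
  have hcert := frobInner_le_nuclearNorm (M := A + H)
    (matSpectralNorm_outerSum_add_le hu hv s hW)
  rw [frobInner_add_right, frobInner_add_left, frobInner_add_left, hE, ← hU, ← hV, ← hW'] at hcert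
  have hHW : frobInner H W' = nuclearNorm H₂ := by rw [hW', hadj, hWH]
  have hAW : frobInner A W' = frobInner (A - T) W' := by rw [frobInner_sub_left, hTW, sub_zero]
  have hAT : nuclearNorm A ≤ nuclearNorm T + nuclearNorm (A - T) := by
    simpa using nuclearNorm_add_le T (A - T)
  -- The certificate bounds ‖A + H‖_* below by ∑_{i<r} a_i - √r F - ‖A - T‖_* + ‖H₂‖_*, while ‖A +
  -- H‖_* ≤ ‖A‖_* ≤ ∑_{i<r} a_i + ‖A - T‖_*.
  have hH₂n : nuclearNorm H₂ ≤ √r * F + 2 * nuclearNorm (A - T) := by linarith [hHE.1]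
  have h1 : nuclearNorm (U * H) ≤ √r * F := nuclearNorm_le_of_forall fun N hN => by
    rw [frobInner_mul_left, hUt]
    refine (le_abs_self _).trans (hfrob _ ?_)
    rw [← frobeniusSq_transpose, Matrix.transpose_mul, hUt]
    exact frobeniusSq_mul_outerSum_le hu s (by rwa [matSpectralNorm_transpose])
  have h2 : nuclearNorm ((1 - U) * H * V) ≤ √r * F := nuclearNorm_le_of_forall fun N hN => by
    rw [frobInner_mul_right, hVt, frobInner_mul_left, ← Matrix.mul_assoc]
    refine (le_abs_self _).trans (hfrob _ (frobeniusSq_mul_outerSum_le hv s ?_))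
    refine (matSpectralNorm_mul_le _ _).trans (mul_le_one₀ ?_ (matSpectralNorm_nonneg _) hN)
    rw [matSpectralNorm_transpose]
    exact matSpectralNorm_one_sub_outerSum_le hu s
  -- The first two blocks have rank at most r, hence nuclear norm at most √r F each; H₂ contributes
  -- the third √r F.
  have h3 : H = U * H + (1 - U) * H * V + H₂ := by
    rw [hH₂]; noncomm_ring
  calc nuclearNorm H ≤ nuclearNorm (U * H) + nuclearNorm ((1 - U) * H * V) + nuclearNorm H₂ := by
        nth_rewrite 1 [h3]
        exact (nuclearNorm_add_le _ _).trans (by gcongr; exact nuclearNorm_add_le _ _)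
    _ ≤ 3 * √r * F + 2 * nuclearNorm (A - T) := by linarith

end NuclearNorm

/-! ### Exponential moments of sub-Gaussian linear forms and their squares -/

section SubGaussian

open scoped ENNReal NNReal

/-- The exponential function with values in `ℝ≥0∞`. -/
noncomputable def eexp (x : ℝ) : ℝ≥0∞ := ENNReal.ofReal (Real.exp x)

theorem eexp_add (x y : ℝ) : eexp (x + y) = eexp x * eexp y := by
  rw [eexp, Real.exp_add, ENNReal.ofReal_mul (Real.exp_nonneg _), eexp, eexp]

theorem eexp_sum {ι : Type*} (s : Finset ι) (f : ι → ℝ) :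
    eexp (∑ i ∈ s, f i) = ∏ i ∈ s, eexp (f i) := by
  classical
  induction s using Finset.induction_on with
  | empty => simp [eexp]
  | insert i s hi ih => rw [Finset.sum_insert hi, Finset.prod_insert hi, eexp_add, ih]

theorem eexp_nsmul (n : ℕ) (x : ℝ) : eexp (n * x) = eexp x ^ n := by
  rw [eexp, Real.exp_nat_mul, ENNReal.ofReal_pow (Real.exp_nonneg _), eexp]

theorem eexp_mono : Monotone eexp := fun _ _ h =>
  ENNReal.ofReal_le_ofReal (Real.exp_le_exp.2 h)

theorem eexp_ne_top (x : ℝ) : eexp x ≠ ∞ := ENNReal.ofReal_ne_top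

theorem eexp_ne_zero (x : ℝ) : eexp x ≠ 0 := by
  simp [eexp, Real.exp_pos]

theorem one_add_le_eexp {x : ℝ} (hx : 0 ≤ x) : 1 + ENNReal.ofReal x ≤ eexp x := by
  rw [eexp, ← ENNReal.ofReal_one, ← ENNReal.ofReal_add zero_le_one hx]
  exact ENNReal.ofReal_le_ofReal (by linarith [Real.add_one_le_exp x])

@[fun_prop]
theorem measurable_eexp : Measurable eexp :=
  ENNReal.measurable_ofReal.comp Real.measurable_exp

variable {Ω : Type*} [MeasurableSpace Ω] {μ : Measure Ω}

theorem setLIntegral_Ioi_one_two_mul_inv_sq :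
    ∫⁻ t in Set.Ioi (1 : ℝ), ENNReal.ofReal (2 * t ^ (-2 : ℝ)) = 2 := by
  rw [← ofReal_integral_eq_lintegral_ofReal
    ((integrableOn_Ioi_rpow_of_lt (by norm_num) zero_lt_one).const_mul 2)]
  · rw [integral_const_mul, integral_Ioi_rpow_of_lt (by norm_num) zero_lt_one]
    norm_num
  · filter_upwards [ae_restrict_mem measurableSet_Ioi] with t ht
    have : (0 : ℝ) < t := zero_lt_one.trans ht
    positivity

/-- A sub-Gaussian random variable has an exponential square moment. -/
theorem IsSubGaussianWith.lintegral_eexp_sq_le [IsProbabilityMeasure μ] {Z : Ω → ℝ} {τ : ℝ}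
    (hτ : 0 < τ) (hZm : AEMeasurable Z μ) (hZ : IsSubGaussianWith Z τ μ) :
    ∫⁻ ω, eexp (Z ω ^ 2 / (4 * τ ^ 2)) ∂μ ≤ 3 := by
  have hm : AEMeasurable (fun ω => Real.exp (Z ω ^ 2 / (4 * τ ^ 2))) μ := by fun_prop
  have h0 : ∫⁻ ω, eexp (Z ω ^ 2 / (4 * τ ^ 2)) ∂μ =
      ∫⁻ t in Set.Ioi 0, μ {ω | t ≤ Real.exp (Z ω ^ 2 / (4 * τ ^ 2))} :=
    lintegral_eq_lintegral_meas_le μ (Filter.Eventually.of_forall fun _ => Real.exp_nonneg _) hm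
  rw [h0, ← Set.Ioc_union_Ioi_eq_Ioi zero_le_one,
    lintegral_union measurableSet_Ioi (Set.Ioc_disjoint_Ioi le_rfl)]
  -- The layer-cake integral is split at 1. Beyond 1, the tail of Z at 2τ√(log t) is at most 2t⁻²,
  -- which integrates to 2.
  have h1 : ∫⁻ t in Set.Ioc (0 : ℝ) 1, μ {ω | t ≤ Real.exp (Z ω ^ 2 / (4 * τ ^ 2))} ≤ 1 := by
    refine (lintegral_mono (g := fun _ => 1) fun t => prob_le_one).trans ?_
    simp
  have h2 : ∫⁻ t in Set.Ioi (1 : ℝ), μ {ω | t ≤ Real.exp (Z ω ^ 2 / (4 * τ ^ 2))} ≤ 2 := by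
    rw [← setLIntegral_Ioi_one_two_mul_inv_sq]
    refine setLIntegral_mono' measurableSet_Ioi fun t ht => ?_
    have ht1 : (1 : ℝ) < t := ht
    have ht0 : (0 : ℝ) < t := by linarith
    have hlog : 0 < Real.log t := Real.log_pos ht1
    have hr : 0 < 2 * τ * √(Real.log t) := by positivity
    have hsub : {ω | t ≤ Real.exp (Z ω ^ 2 / (4 * τ ^ 2))} ⊆
        {ω | 2 * τ * √(Real.log t) ≤ |Z ω|} := by
      intro ω hω
      have h3 := (Real.log_le_iff_le_exp ht0).2 hω
      rw [le_div_iff₀ (by positivity)] at h3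
      refine (pow_le_pow_iff_left₀ hr.le (abs_nonneg _) two_ne_zero).1 ?_
      rw [mul_pow, Real.sq_sqrt hlog.le, sq_abs]
      linarith
    refine (measure_mono hsub).trans ?_
    rw [← ENNReal.ofReal_toReal (measure_ne_top μ _)]
    refine ENNReal.ofReal_le_ofReal ((hZ _ hr).trans (le_of_eq ?_))
    rw [mul_pow, Real.sq_sqrt hlog.le, Real.rpow_def_of_pos ht0]
    congr 2
    field_simp
  calc _ ≤ (1 : ℝ≥0∞) + 2 := add_le_add h1 h2
    _ = 3 := by norm_num

theorem lintegral_comp_neg_of_map_neg {P : Measure ℝ} (hsymm : P.map (fun x => -x) = P)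
    {f : ℝ → ℝ≥0∞} (hf : Measurable f) : ∫⁻ x, f (-x) ∂P = ∫⁻ x, f x ∂P := by
  conv_rhs => rw [← hsymm]
  rw [lintegral_map hf measurable_neg]

/-- Adding the two signs cancels the odd terms: cosh(tw) ≤ exp(t²w²/2), and t²w²/2 is the convex
combination of 0 and w²/(4τ²) with weight 2τ²t² on the latter. -/
theorem exp_add_exp_neg_le_of_sq (τ t w : ℝ) (hτ : 0 < τ) (h : 2 * τ ^ 2 * t ^ 2 ≤ 1) :
    Real.exp (t * w) + Real.exp (t * -w) ≤
      2 + 4 * τ ^ 2 * t ^ 2 * Real.exp (w ^ 2 / (4 * τ ^ 2)) := by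
  have h1 := Real.cosh_le_exp_half_sq (t * w)
  have h2 : Real.exp (t * w) + Real.exp (t * -w) = 2 * Real.cosh (t * w) := by
    rw [Real.cosh_eq]; ring_nf
  have h3 : (t * w) ^ 2 / 2 = (1 - 2 * τ ^ 2 * t ^ 2) * 0 +
      2 * τ ^ 2 * t ^ 2 * (w ^ 2 / (4 * τ ^ 2)) := by
    field_simp
    ring
  have h4 := convexOn_exp.right (Set.mem_univ 0) (Set.mem_univ (w ^ 2 / (4 * τ ^ 2)))
    (show 0 ≤ 1 - 2 * τ ^ 2 * t ^ 2 by linarith) (show 0 ≤ 2 * τ ^ 2 * t ^ 2 by positivity)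
    (by ring)
  simp only [smul_eq_mul, Real.exp_zero] at h4
  rw [h3] at h1
  have h5 : 0 ≤ 2 * τ ^ 2 * t ^ 2 := by positivity
  linarith

/-- A symmetric sub-Gaussian law has a sub-Gaussian moment generating function. -/
theorem hasSubgaussianMGF_of_symmetric {P : Measure ℝ} [IsProbabilityMeasure P]
    (hsymm : P.map (fun x => -x) = P) {τ : ℝ} (hτ : 0 < τ)
    (hsub : IsSubGaussianWith (fun w => w) τ P) :
    HasSubgaussianMGF id (Real.toNNReal (12 * τ ^ 2)) P := by
  have h3 : ∫⁻ w, eexp (w ^ 2 / (4 * τ ^ 2)) ∂P ≤ 3 :=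
    hsub.lintegral_eexp_sq_le hτ measurable_id.aemeasurable
  have hkey : ∀ t : ℝ, ∫⁻ w, eexp (t * w) ∂P ≤ eexp (6 * τ ^ 2 * t ^ 2) := by
    intro t
    -- For small t, symmetry of the law removes the linear term. For large t, tw ≤ τ²t² + w²/(4τ²),
    -- and the resulting factor 3 ≤ e² is absorbed because 2 < 4τ²t².
    by_cases ht : 2 * τ ^ 2 * t ^ 2 ≤ 1
    · have h4 : 2 * ∫⁻ w, eexp (t * w) ∂P ≤
          2 + ENNReal.ofReal (4 * τ ^ 2 * t ^ 2) * 3 := by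
        calc 2 * ∫⁻ w, eexp (t * w) ∂P
            = ∫⁻ w, eexp (t * w) + eexp (t * -w) ∂P := by
              rw [lintegral_add_left (by fun_prop),
                lintegral_comp_neg_of_map_neg hsymm (f := fun w => eexp (t * w)) (by fun_prop),
                two_mul]
          _ ≤ ∫⁻ w, 2 + ENNReal.ofReal (4 * τ ^ 2 * t ^ 2) * eexp (w ^ 2 / (4 * τ ^ 2)) ∂P := by
              refine lintegral_mono fun w => ?_
              simp only [eexp]
              rw [← ENNReal.ofReal_add (Real.exp_nonneg _) (Real.exp_nonneg _),
                ← ENNReal.ofReal_mul (by positivity), ← ENNReal.ofReal_ofNat 2,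
                ← ENNReal.ofReal_add (by norm_num) (by positivity)]
              exact ENNReal.ofReal_le_ofReal (exp_add_exp_neg_le_of_sq τ t w hτ ht)
          _ ≤ 2 + ENNReal.ofReal (4 * τ ^ 2 * t ^ 2) * 3 := by
              rw [lintegral_add_left (by fun_prop), lintegral_const_mul _ (by fun_prop)]
              simp only [lintegral_const, measure_univ, mul_one]
              gcongr
      have h5 : (2 : ℝ≥0∞) * ∫⁻ w, eexp (t * w) ∂P ≤ 2 * eexp (6 * τ ^ 2 * t ^ 2) := by
        refine h4.trans ?_
        have h6 := one_add_le_eexp (x := 6 * τ ^ 2 * t ^ 2) (by positivity)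
        have h7 : ENNReal.ofReal (4 * τ ^ 2 * t ^ 2) * 3 =
            2 * ENNReal.ofReal (6 * τ ^ 2 * t ^ 2) := by
          rw [← ENNReal.ofReal_ofNat 3, ← ENNReal.ofReal_ofNat 2,
            ← ENNReal.ofReal_mul (by positivity), ← ENNReal.ofReal_mul (by positivity)]
          ring_nf
        rw [h7]
        calc (2 : ℝ≥0∞) + 2 * ENNReal.ofReal (6 * τ ^ 2 * t ^ 2)
            = 2 * (1 + ENNReal.ofReal (6 * τ ^ 2 * t ^ 2)) := by ring
          _ ≤ _ := by gcongr
      exact (ENNReal.mul_le_mul_iff_right (by norm_num) (by norm_num)).1 h5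
    · push Not at ht
      calc ∫⁻ w, eexp (t * w) ∂P
          ≤ ∫⁻ w, eexp (τ ^ 2 * t ^ 2) * eexp (w ^ 2 / (4 * τ ^ 2)) ∂P := by
            refine lintegral_mono fun w => ?_
            rw [← eexp_add]
            refine eexp_mono ?_
            have h4 : τ ^ 2 * t ^ 2 + w ^ 2 / (4 * τ ^ 2) - t * w =
                (τ * t - w / (2 * τ)) ^ 2 := by
              field_simp
              ring
            linarith [sq_nonneg (τ * t - w / (2 * τ))]
        _ ≤ eexp (τ ^ 2 * t ^ 2) * eexp 2 := by
            rw [lintegral_const_mul _ (by fun_prop)]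
            gcongr
            refine h3.trans ?_
            rw [eexp, ← ENNReal.ofReal_ofNat 3]
            exact ENNReal.ofReal_le_ofReal (by linarith [Real.add_one_le_exp 2])
        _ ≤ eexp (6 * τ ^ 2 * t ^ 2) := by
            rw [← eexp_add]
            exact eexp_mono (by linarith)
  have hint : ∀ t : ℝ, Integrable (fun w => Real.exp (t * id w)) P := fun t => by
    refine (lintegral_ofReal_ne_top_iff_integrable (by fun_prop)
      (Filter.Eventually.of_forall fun _ => Real.exp_nonneg _)).1 ?_
    exact ((hkey t).trans_lt (eexp_ne_top _).lt_top).ne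
  refine ⟨hint, fun t => ?_⟩
  rw [mgf, integral_eq_lintegral_of_nonneg_ae
    (Filter.Eventually.of_forall fun _ => Real.exp_nonneg _) (hint t).1]
  refine ENNReal.toReal_le_of_le_ofReal (Real.exp_nonneg _) ((hkey t).trans (eexp_mono ?_))
  rw [Real.coe_toNNReal _ (by positivity)]
  linarith

variable {E : Type*} [MeasurableSpace E] {ρ : Measure E} [IsProbabilityMeasure ρ] {p : ℕ}

/-- A unit combination of independent sub-Gaussian variables keeps the variance proxy c. The map φ
allows either member of a pair to be selected. -/
theorem lintegral_eexp_sq_sum_le {P : Measure ℝ} [IsProbabilityMeasure P] {c : ℝ≥0} (hc : 0 < c)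
    (hP : HasSubgaussianMGF id c P) {φ : E → ℝ} (hφ : MeasurePreserving φ ρ P) (u : Fin p → ℝ)
    (hu : ∑ i, u i ^ 2 = 1) :
    ∫⁻ x, eexp ((∑ i, u i * φ (x i)) ^ 2 / (4 * c)) ∂(Measure.pi fun _ : Fin p => ρ) ≤ 3 := by
  set ν := Measure.pi fun _ : Fin p => ρ
  have hind : iIndepFun (fun (i : Fin p) (x : Fin p → E) => u i * φ (x i)) ν :=
    iIndepFun_pi (μ := fun _ : Fin p => ρ) (X := fun i y => u i * φ y)
      fun i => (hφ.measurable.const_mul _).aemeasurable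
  have hsub : ∀ i : Fin p, HasSubgaussianMGF (fun x : Fin p → E => u i * φ (x i))
      (Real.toNNReal (u i ^ 2) * c) ν := fun i => by
    rw [Real.toNNReal_of_nonneg (sq_nonneg _)]
    refine HasSubgaussianMGF.const_mul ?_ (u i)
    have hmp : MeasurePreserving (fun x : Fin p → E => φ (x i)) ν P :=
      hφ.comp (measurePreserving_eval (fun _ : Fin p => ρ) i)
    have h := HasSubgaussianMGF.of_map (X := id) (c := c) hmp.measurable.aemeasurable
      (by rw [hmp.map_eq]; exact hP)
    exact h
  have hsum := HasSubgaussianMGF.sum_of_iIndepFun hind (s := Finset.univ) fun i _ => hsub i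
  have hvar : ∑ i : Fin p, Real.toNNReal (u i ^ 2) * c = c := by
    rw [← Finset.sum_mul, ← Real.toNNReal_sum_of_nonneg fun i _ => sq_nonneg _, hu,
      Real.toNNReal_one, one_mul]
  rw [hvar] at hsum
  set Z : (Fin p → E) → ℝ := fun x => ∑ i, u i * φ (x i)
  have htail : IsSubGaussianWith Z (√(c : ℝ)) ν := fun t ht => by
    have h1 := hsum.measure_ge_le ht.le
    have h2 := hsum.neg.measure_ge_le ht.le
    rw [Real.sq_sqrt c.coe_nonneg]
    have h3 : {ω | t ≤ |Z ω|} ⊆ {ω | t ≤ Z ω} ∪ {ω | t ≤ (-Z) ω} := fun ω hω => by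
      rcases le_abs.1 (show t ≤ |Z ω| from hω) with h | h
      · exact Or.inl h
      · exact Or.inr h
    have h4 := (measureReal_mono (μ := ν) h3).trans (measureReal_union_le _ _)
    have h5 : ν.real {ω | t ≤ (-Z) ω} ≤ Real.exp (-t ^ 2 / (2 * c)) := h2
    linarith
  have h := htail.lintegral_eexp_sq_le (Real.sqrt_pos.2 (by exact_mod_cast hc)) hsum.aemeasurable
  simpa only [Real.sq_sqrt c.coe_nonneg] using h

/-- A second-order bound in s whose remainder is an exponential moment at the fixed scale a: the
factor d² is absorbed by doubling the exponent. -/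
theorem exp_add_exp_neg_le {s a d : ℝ} (ha : 0 < a) (hs : |s| ≤ a) :
    Real.exp (s * d) + Real.exp (-(s * d)) ≤
      2 + 4 * (s / a) ^ 2 * Real.exp (2 * a * |d|) := by
  have hexp : ∀ y : ℝ, Real.exp y + Real.exp (-y) ≤ 2 + 2 * y ^ 2 * Real.exp |y| := fun y => by
    have h0 := Real.one_le_exp (abs_nonneg y)
    rcases le_total |y| 1 with h | h
    · have h1 := (abs_le.1 (Real.abs_exp_sub_one_sub_id_le h)).2
      have h2 := (abs_le.1 (Real.abs_exp_sub_one_sub_id_le (x := -y) (by rwa [abs_neg]))).2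
      nlinarith [sq_nonneg y]
    · have h1 := Real.exp_le_exp.2 (le_abs_self y)
      have h2 := Real.exp_le_exp.2 (neg_le_abs y)
      have h3 : 1 ≤ y ^ 2 := by rw [← sq_abs]; nlinarith
      nlinarith
  have h1 := hexp (s * d)
  have h2 : |s * d| ≤ a * |d| := by
    rw [abs_mul]; exact mul_le_mul_of_nonneg_right hs (abs_nonneg _)
  have h3 : (a * |d|) ^ 2 ≤ 2 * Real.exp (a * |d|) := by
    have h0 : 0 ≤ a * |d| := by positivity
    linarith [Real.quadratic_le_exp_of_nonneg h0]
  have h4 : (s * d) ^ 2 = (s / a) ^ 2 * (a * |d|) ^ 2 := by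
    rw [mul_pow a, sq_abs]; field_simp
  have h5 : Real.exp |s * d| ≤ Real.exp (a * |d|) := Real.exp_le_exp.2 h2
  have h6 : Real.exp (2 * a * |d|) = Real.exp (a * |d|) * Real.exp (a * |d|) := by
    rw [← Real.exp_add]; ring_nf
  have h7 : (s * d) ^ 2 * Real.exp |s * d| ≤ (s / a) ^ 2 * (2 * Real.exp (a * |d|)) *
      Real.exp (a * |d|) := by
    rw [h4]; gcongr
  rw [h6]
  linarith

/-- The difference of the squares of two sub-Gaussian linear forms that can be exchanged is
sub-exponential. -/
theorem lintegral_eexp_sq_sub_sq_le {P : Measure ℝ} [IsProbabilityMeasure P] {c : ℝ≥0}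
    (hc : 0 < c) (hP : HasSubgaussianMGF id c P) (u : Fin p → ℝ) (hu : ∑ i, u i ^ 2 = 1) {s : ℝ}
    (hs : |s| ≤ 1 / (16 * c)) :
    ∫⁻ x, eexp (s * ((∑ i, u i * (x i).1) ^ 2 - (∑ i, u i * (x i).2) ^ 2))
      ∂(Measure.pi fun _ : Fin p => P.prod P) ≤ eexp (1536 * c ^ 2 * s ^ 2) := by
  set ν := Measure.pi fun _ : Fin p => P.prod P
  set Y : (Fin p → ℝ × ℝ) → ℝ := fun x => ∑ i, u i * (x i).1
  set Y' : (Fin p → ℝ × ℝ) → ℝ := fun x => ∑ i, u i * (x i).2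
  have hY : Measurable Y := by fun_prop
  have hY' : Measurable Y' := by fun_prop
  have hc' : (0 : ℝ) < c := by exact_mod_cast hc
  have h1 : ∫⁻ x, eexp (Y x ^ 2 / (4 * c)) ∂ν ≤ 3 :=
    lintegral_eexp_sq_sum_le hc hP measurePreserving_fst u hu
  have h2 : ∫⁻ x, eexp (Y' x ^ 2 / (4 * c)) ∂ν ≤ 3 :=
    lintegral_eexp_sq_sum_le hc hP measurePreserving_snd u hu
  have hswap : MeasurePreserving (fun (x : Fin p → ℝ × ℝ) i => (x i).swap) ν ν :=
    measurePreserving_pi _ _ fun _ => Measure.measurePreserving_swap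
  have hD : ∫⁻ x, eexp (-(s * (Y x ^ 2 - Y' x ^ 2))) ∂ν =
      ∫⁻ x, eexp (s * (Y x ^ 2 - Y' x ^ 2)) ∂ν := by
    rw [← hswap.lintegral_comp (f := fun x => eexp (s * (Y x ^ 2 - Y' x ^ 2))) (by fun_prop)]
    refine lintegral_congr fun x => ?_
    simp only [Y, Y', Prod.fst_swap, Prod.snd_swap]
    ring_nf
  -- With this scale, 2a|Y² - Y'²| is at most the average of Y²/(4c) and Y'²/(4c), whose
  -- exponentials have mean at most 3. The constant 1536 is 6 · 16².
  set a : ℝ := 1 / (16 * c) with ha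
  have ha0 : 0 < a := by positivity
  have habs : ∀ x, eexp (2 * a * |Y x ^ 2 - Y' x ^ 2|) ≤
      2⁻¹ * (eexp (Y x ^ 2 / (4 * c)) + eexp (Y' x ^ 2 / (4 * c))) := fun x => by
    have h3 : 2 * a * |Y x ^ 2 - Y' x ^ 2| ≤
        2⁻¹ * (Y x ^ 2 / (4 * c)) + 2⁻¹ * (Y' x ^ 2 / (4 * c)) := by
      have h4 : |Y x ^ 2 - Y' x ^ 2| ≤ Y x ^ 2 + Y' x ^ 2 :=
        abs_le.2 ⟨by linarith [sq_nonneg (Y x)], by linarith [sq_nonneg (Y' x)]⟩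
      calc 2 * a * |Y x ^ 2 - Y' x ^ 2| ≤ 2 * a * (Y x ^ 2 + Y' x ^ 2) := by gcongr
        _ = _ := by rw [ha]; field_simp; ring
    have h4 := convexOn_exp.right (Set.mem_univ (Y x ^ 2 / (4 * c)))
      (Set.mem_univ (Y' x ^ 2 / (4 * c))) (show (0 : ℝ) ≤ 2⁻¹ by norm_num)
      (show (0 : ℝ) ≤ 2⁻¹ by norm_num) (by norm_num)
    simp only [smul_eq_mul] at h4
    refine (eexp_mono h3).trans ?_
    simp only [eexp]
    rw [← ENNReal.ofReal_add (Real.exp_nonneg _) (Real.exp_nonneg _),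
      ← ENNReal.ofReal_ofNat 2, ← ENNReal.ofReal_inv_of_pos (by norm_num),
      ← ENNReal.ofReal_mul (by positivity)]
    refine ENNReal.ofReal_le_ofReal (h4.trans (le_of_eq (by ring)))
  have h3 : ∫⁻ x, eexp (2 * a * |Y x ^ 2 - Y' x ^ 2|) ∂ν ≤ 3 := by
    refine (lintegral_mono habs).trans ?_
    rw [lintegral_const_mul _ (by fun_prop), lintegral_add_left (by fun_prop)]
    calc (2⁻¹ : ℝ≥0∞) * _ ≤ 2⁻¹ * (3 + 3) := by gcongr
      _ = 3 := by
        rw [← two_mul, ← mul_assoc, ENNReal.inv_mul_cancel (by norm_num) (by norm_num), one_mul]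
  have h4 : 2 * ∫⁻ x, eexp (s * (Y x ^ 2 - Y' x ^ 2)) ∂ν ≤ 2 * eexp (6 * (s / a) ^ 2) := by
    calc 2 * ∫⁻ x, eexp (s * (Y x ^ 2 - Y' x ^ 2)) ∂ν
        = ∫⁻ x, eexp (s * (Y x ^ 2 - Y' x ^ 2)) + eexp (-(s * (Y x ^ 2 - Y' x ^ 2))) ∂ν := by
          rw [lintegral_add_left (by fun_prop), hD, two_mul]
      _ ≤ ∫⁻ x, 2 + ENNReal.ofReal (4 * (s / a) ^ 2) *
            eexp (2 * a * |Y x ^ 2 - Y' x ^ 2|) ∂ν := by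
          refine lintegral_mono fun x => ?_
          simp only [eexp]
          rw [← ENNReal.ofReal_add (Real.exp_nonneg _) (Real.exp_nonneg _),
            ← ENNReal.ofReal_mul (by positivity), ← ENNReal.ofReal_ofNat 2,
            ← ENNReal.ofReal_add (by norm_num) (by positivity)]
          exact ENNReal.ofReal_le_ofReal (exp_add_exp_neg_le ha0 hs)
      _ ≤ 2 + ENNReal.ofReal (4 * (s / a) ^ 2) * 3 := by
          rw [lintegral_add_left (by fun_prop), lintegral_const_mul _ (by fun_prop)]
          simp only [lintegral_const, measure_univ, mul_one]
          gcongr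
      _ = 2 * (1 + ENNReal.ofReal (6 * (s / a) ^ 2)) := by
          have h7 : ENNReal.ofReal (4 * (s / a) ^ 2) * 3 =
              2 * ENNReal.ofReal (6 * (s / a) ^ 2) := by
            rw [← ENNReal.ofReal_ofNat 3, ← ENNReal.ofReal_ofNat 2,
              ← ENNReal.ofReal_mul (by positivity), ← ENNReal.ofReal_mul (by positivity)]
            ring_nf
          rw [h7]; ring
      _ ≤ 2 * eexp (6 * (s / a) ^ 2) := by
          gcongr
          exact one_add_le_eexp (by positivity)
  refine ((ENNReal.mul_le_mul_iff_right (by norm_num) (by norm_num)).1 h4).trans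
    (eexp_mono (le_of_eq ?_))
  rw [ha]
  field_simp
  ring

end SubGaussian

/-! ### Lower bound for the mean absolute value of one paired quadratic form -/

section SmallBall

open scoped ENNReal NNReal

/-- The sign encoded by a Boolean. -/
def boolSign (b : Bool) : ℝ := if b then 1 else -1

theorem sum_cons_boolSign {n : ℕ} (F : ℝ → ℝ) (c : Fin (n + 1) → ℝ) (t : ℝ) :
    ∑ ε : Fin (n + 1) → Bool, F (t + ∑ i, boolSign (ε i) * c i) =
      ∑ ε : Fin n → Bool, (F (t + c 0 + ∑ i, boolSign (ε i) * c i.succ) +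
        F (t - c 0 + ∑ i, boolSign (ε i) * c i.succ)) := by
  rw [← (Fin.consEquiv fun _ => Bool).sum_comp, Fintype.sum_prod_type, Fintype.sum_bool,
    ← Finset.sum_add_distrib]
  refine Finset.sum_congr rfl fun ε _ => ?_
  simp [Fin.consEquiv, Fin.sum_univ_succ, boolSign, add_assoc, sub_eq_add_neg]

theorem sum_sq_boolSign {n : ℕ} (c : Fin n → ℝ) (t : ℝ) :
    ∑ ε : Fin n → Bool, (t + ∑ i, boolSign (ε i) * c i) ^ 2 =
      2 ^ n * (t ^ 2 + ∑ i, c i ^ 2) := by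
  induction n generalizing t with
  | zero => simp
  | succ n ih =>
    rw [sum_cons_boolSign (fun x => x ^ 2), Finset.sum_add_distrib, ih, ih, Fin.sum_univ_succ]
    ring

/-- The shift t makes the induction close: the first sign is absorbed into it as t ± c₀. Only t = 0
is needed later. -/
theorem sum_pow_four_boolSign_le {n : ℕ} (c : Fin n → ℝ) (t : ℝ) :
    ∑ ε : Fin n → Bool, (t + ∑ i, boolSign (ε i) * c i) ^ 4 ≤
      2 ^ n * (t ^ 4 + 6 * t ^ 2 * ∑ i, c i ^ 2 + 3 * (∑ i, c i ^ 2) ^ 2) := by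
  induction n generalizing t with
  | zero => simp
  | succ n ih =>
    rw [sum_cons_boolSign (fun x => x ^ 4), Finset.sum_add_distrib, Fin.sum_univ_succ]
    refine (add_le_add (ih _ _) (ih _ _)).trans ?_
    set S := ∑ i : Fin n, c i.succ ^ 2
    have h : ((t + c 0) ^ 4 + 6 * (t + c 0) ^ 2 * S + 3 * S ^ 2) +
        ((t - c 0) ^ 4 + 6 * (t - c 0) ^ 2 * S + 3 * S ^ 2) ≤
        2 * (t ^ 4 + 6 * t ^ 2 * (c 0 ^ 2 + S) + 3 * (c 0 ^ 2 + S) ^ 2) := by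
      nlinarith [sq_nonneg (c 0 ^ 2)]
    have h2 := mul_le_mul_of_nonneg_left h (pow_nonneg (zero_le_two : (0 : ℝ) ≤ 2) n)
    rw [pow_succ (2 : ℝ)]
    linarith

/-- Khintchine's inequality between the first and the second moment. -/
theorem sqrt_sum_sq_le_sum_abs_boolSign {n : ℕ} (c : Fin n → ℝ) :
    2 ^ n * (1 / 2 * √(∑ i, c i ^ 2)) ≤ ∑ ε : Fin n → Bool, |∑ i, boolSign (ε i) * c i| := by
  have hN : 0 ≤ ∑ i, c i ^ 2 := Finset.sum_nonneg fun _ _ => sq_nonneg _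
  rcases hN.eq_or_lt with h | h
  · rw [← h]; simp; positivity
  set l := √(∑ i, c i ^ 2)
  have hl : 0 < l := Real.sqrt_pos.2 h
  have hl2 : ∑ i, c i ^ 2 = l ^ 2 := (Real.sq_sqrt hN).symm
  have h2 := sum_sq_boolSign c 0
  have h4 := sum_pow_four_boolSign_le c 0
  simp only [zero_add, hl2] at h2 h4
  -- A minorant of |x| by second and fourth powers, tangent at |x| = 3l/2. Averaging over signs
  -- leaves l⁴(1 - 12/27) = 5l⁴/9, more than l⁴/2.
  have hpt : ∀ x : ℝ, l ^ 2 * x ^ 2 - 4 / 27 * x ^ 4 ≤ l ^ 3 * |x| := fun x => by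
    rw [← sq_abs x, show x ^ 4 = |x| ^ 4 by rw [← abs_pow, abs_of_nonneg (by positivity)]]
    have hx := abs_nonneg x
    have : l ^ 3 * |x| - (l ^ 2 * |x| ^ 2 - 4 / 27 * |x| ^ 4) =
      4 / 27 * |x| * ((|x| - 3 / 2 * l) ^ 2 * (|x| + 3 * l)) := by ring
    have h0 : 0 ≤ 4 / 27 * |x| * ((|x| - 3 / 2 * l) ^ 2 * (|x| + 3 * l)) := by positivity
    linarith
  have hsum := Finset.sum_le_sum fun (ε : Fin n → Bool) (_ : ε ∈ Finset.univ) =>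
    hpt (∑ i, boolSign (ε i) * c i)
  rw [Finset.sum_sub_distrib, ← Finset.mul_sum, ← Finset.mul_sum, ← Finset.mul_sum, h2] at hsum
  refine le_of_mul_le_mul_left ?_ (pow_pos hl 3)
  refine le_trans ?_ hsum
  have h5 : (0 : ℝ) ≤ 2 ^ n * l ^ 4 := by positivity
  norm_num at h4
  nlinarith

/-- For integrable functions whose signs can be flipped independently, the `L¹` norm of the sum
dominates the Euclidean norm of the `L¹` norms. -/
theorem sqrt_sum_sq_integral_abs_le {E : Type*} [MeasurableSpace E] {ν : Measure E} {n : ℕ}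
    (y : Fin n → E → ℝ) (hy : ∀ i, Integrable (y i) ν) (T : (Fin n → Bool) → E → E)
    (hT : ∀ ε, MeasurePreserving (T ε) ν ν)
    (hyT : ∀ ε i x, y i (T ε x) = boolSign (ε i) * y i x) :
    1 / 2 * √(∑ i, (∫ x, |y i x| ∂ν) ^ 2) ≤ ∫ x, |∑ i, y i x| ∂ν := by
  set m : Fin n → ℝ := fun i => ∫ x, |y i x| ∂ν
  have hm : ∀ i, 0 ≤ m i := fun i => integral_nonneg fun _ => abs_nonneg _
  have hN : 0 ≤ ∑ i, m i ^ 2 := Finset.sum_nonneg fun _ _ => sq_nonneg _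
  set N := √(∑ i, m i ^ 2)
  rcases (Real.sqrt_nonneg (∑ i, m i ^ 2)).eq_or_lt with h | h
  · change 1 / 2 * N ≤ _
    rw [show N = 0 from h.symm, mul_zero]
    exact integral_nonneg fun _ => abs_nonneg _
  have hint : ∀ ε : Fin n → Bool, Integrable (fun x => |∑ i, boolSign (ε i) * y i x|) ν :=
    fun ε => (integrable_finsetSum _ fun i _ => (hy i).const_mul _).abs
  have hflip : ∀ ε : Fin n → Bool,
      ∫ x, |∑ i, boolSign (ε i) * y i x| ∂ν = ∫ x, |∑ i, y i x| ∂ν := fun ε => by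
    have h1 : AEStronglyMeasurable (fun x => |∑ i, y i x|) (ν.map (T ε)) := by
      rw [(hT ε).map_eq]
      exact (integrable_finsetSum _ fun i _ => hy i).abs.1
    have h2 := integral_map (hT ε).measurable.aemeasurable h1
    rw [(hT ε).map_eq] at h2
    rw [h2]
    simp only [hyT]
  -- Khintchine pointwise, followed by Cauchy-Schwarz against the unit vector m/N. This makes the
  -- bound linear in |y_i|, so that integration returns N.
  have hpt : ∀ x, 2 ^ n * (1 / 2 * ∑ i, m i / N * |y i x|) ≤
      ∑ ε : Fin n → Bool, |∑ i, boolSign (ε i) * y i x| := fun x => by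
    refine le_trans ?_ (sqrt_sum_sq_le_sum_abs_boolSign fun i => y i x)
    gcongr
    refine Real.le_sqrt_of_sq_le ?_
    refine (Finset.sum_mul_sq_le_sq_mul_sq _ _ _).trans (le_of_eq ?_)
    simp only [div_pow, ← Finset.sum_div, sq_abs]
    rw [show N ^ 2 = ∑ i, m i ^ 2 from Real.sq_sqrt hN, div_self, one_mul]
    exact fun h0 => h.ne' (by rw [h0, Real.sqrt_zero])
  have hI := integral_mono (μ := ν) (((integrable_finsetSum _ fun i _ =>
    (hy i).abs.const_mul (m i / N)).const_mul (1 / 2)).const_mul (2 ^ n))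
    (integrable_finsetSum _ fun ε _ => hint ε) hpt
  rw [integral_finsetSum _ fun ε _ => hint ε] at hI
  simp only [hflip] at hI
  rw [integral_const_mul, integral_const_mul,
    integral_finsetSum _ fun i _ => (hy i).abs.const_mul _] at hI
  simp only [integral_const_mul, Finset.sum_const, Finset.card_univ, Fintype.card_fun,
    Fintype.card_bool, Fintype.card_fin, nsmul_eq_mul, Nat.cast_pow, Nat.cast_ofNat] at hI
  have h3 := le_of_mul_le_mul_left hI (by positivity)
  have h4 : ∑ i, m i / N * m i = N := by
    simp only [div_mul_eq_mul_div, ← sq, ← Finset.sum_div]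
    rw [← show N ^ 2 = ∑ i, m i ^ 2 from Real.sq_sqrt hN, sq, mul_div_assoc, div_self h.ne',
      mul_one]
  calc 1 / 2 * N = 1 / 2 * ∑ i, m i / N * m i := by rw [h4]
    _ ≤ _ := h3

variable {p : ℕ}

/-- The quadratic form `βᵀ H β - β'ᵀ H β'` as a bilinear form in `β - β'` and `β + β'`, for a pair
of vectors given by its coordinates. -/
def pairForm (H : Matrix (Fin p) (Fin p) ℝ) (x : Fin p → ℝ × ℝ) : ℝ :=
  ∑ i, ((x i).1 - (x i).2) * ∑ j, H i j * ((x j).1 + (x j).2)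

theorem pairForm_swap (H : Matrix (Fin p) (Fin p) ℝ) (x : Fin p → ℝ × ℝ) :
    pairForm H (fun i => (x i).swap) = -pairForm H x := by
  simp only [pairForm, Prod.fst_swap, Prod.snd_swap, ← Finset.sum_neg_distrib]
  refine Finset.sum_congr rfl fun i _ => ?_
  simp only [add_comm]
  ring

theorem continuous_pairForm (x : Fin p → ℝ × ℝ) :
    Continuous fun H : Matrix (Fin p) (Fin p) ℝ => pairForm H x := by
  unfold pairForm
  fun_prop

@[fun_prop]
theorem measurable_pairForm (H : Matrix (Fin p) (Fin p) ℝ) : Measurable (pairForm H) := by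
  unfold pairForm
  fun_prop

theorem pairForm_smul (c : ℝ) (H : Matrix (Fin p) (Fin p) ℝ) (x : Fin p → ℝ × ℝ) :
    pairForm (c • H) x = c * pairForm H x := by
  simp only [pairForm, Matrix.smul_apply, smul_eq_mul, Finset.mul_sum]
  exact Finset.sum_congr rfl fun i _ => Finset.sum_congr rfl fun j _ => by ring

variable {P : Measure ℝ} [IsProbabilityMeasure P]

/-- If two independent copies had equal squares almost surely, w² would be almost surely constant,
contrary to its positive variance. -/
theorem not_sq_sub_sq_ae_zero (hvar_sq : 0 < Var[fun w => w ^ 2; P]) :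
    ¬ (fun q : ℝ × ℝ => (q.1 - q.2) * (q.1 + q.2)) =ᵐ[P.prod P] 0 := by
  intro h
  have h1 := Measure.ae_ae_of_ae_prod h
  obtain ⟨x, hx⟩ := h1.exists
  have h2 : (fun w : ℝ => w ^ 2) =ᵐ[P] fun _ => x ^ 2 := by
    filter_upwards [hx] with w hw
    simp only [Pi.zero_apply] at hw
    linarith
  rw [variance_congr h2] at hvar_sq
  simp [variance_eq_integral] at hvar_sq

theorem memLp_pi_sub_add {c : ℝ≥0} (hP : HasSubgaussianMGF id c P) (i : Fin p) :
    MemLp (fun x : Fin p → ℝ × ℝ => (x i).1 - (x i).2) 2 (Measure.pi fun _ => P.prod P) ∧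
    MemLp (fun x : Fin p → ℝ × ℝ => (x i).1 + (x i).2) 2 (Measure.pi fun _ => P.prod P) := by
  have h0 : MemLp id 2 P := hP.memLp 2
  have h1 := h0.comp_measurePreserving ((measurePreserving_fst (μ := P) (ν := P)).comp
    (measurePreserving_eval (fun _ : Fin p => P.prod P) i))
  have h2 := h0.comp_measurePreserving ((measurePreserving_snd (μ := P) (ν := P)).comp
    (measurePreserving_eval (fun _ : Fin p => P.prod P) i))
  exact ⟨h1.sub h2, h1.add h2⟩

theorem integrable_pi_sub_mul_add {c : ℝ≥0} (hP : HasSubgaussianMGF id c P) (i j : Fin p) :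
    Integrable (fun x : Fin p → ℝ × ℝ => ((x i).1 - (x i).2) * ((x j).1 + (x j).2))
      (Measure.pi fun _ => P.prod P) :=
  MemLp.integrable_mul (memLp_pi_sub_add hP i).1 (memLp_pi_sub_add hP j).2

/-- Only two values occur: E|q₁² - q₂²| for i = j, and E|q₁ - q₂| E|q₁ + q₂| by independence for i ≠
j. Both are positive, so c₀ does not depend on p. -/
theorem exists_le_integral_abs_sub_mul_add {c : ℝ≥0} (hP : HasSubgaussianMGF id c P)
    (hvar_sq : 0 < Var[fun w => w ^ 2; P]) :
    ∃ c₀ : ℝ, 0 < c₀ ∧ ∀ (p : ℕ) (i j : Fin p),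
      c₀ ≤ ∫ x, |((x i).1 - (x i).2) * ((x j).1 + (x j).2)|
        ∂(Measure.pi fun _ : Fin p => P.prod P) := by
  have hL : MemLp id 2 P := hP.memLp 2
  have h1 := hL.comp_measurePreserving (measurePreserving_fst (μ := P) (ν := P))
  have h2 := hL.comp_measurePreserving (measurePreserving_snd (μ := P) (ν := P))
  have hpos : ∀ f : ℝ × ℝ → ℝ, Integrable f (P.prod P) → ¬ f =ᵐ[P.prod P] 0 →
      0 < ∫ q, |f q| ∂(P.prod P) := fun f hf hf0 => by
    refine lt_of_le_of_ne (integral_nonneg fun _ => abs_nonneg _) fun h => hf0 ?_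
    have h3 := (integral_eq_zero_iff_of_nonneg (fun _ => abs_nonneg _) hf.abs).1 h.symm
    filter_upwards [h3] with q hq
    simpa using hq
  have hne := not_sq_sub_sq_ae_zero hvar_sq
  set a : ℝ × ℝ → ℝ := fun q => q.1 - q.2
  set b : ℝ × ℝ → ℝ := fun q => q.1 + q.2
  have ham : MemLp a 2 (P.prod P) := h1.sub h2
  have hbm : MemLp b 2 (P.prod P) := h1.add h2
  have ha := hpos a (ham.integrable one_le_two) fun h => hne (by
    filter_upwards [h] with q hq
    have : q.1 - q.2 = 0 := hq
    simp [this])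
  have hb := hpos b (hbm.integrable one_le_two) fun h => hne (by
    filter_upwards [h] with q hq
    have : q.1 + q.2 = 0 := hq
    simp [this])
  have hab := hpos (fun q => a q * b q) (ham.integrable_mul hbm) hne
  refine ⟨min ((∫ q, |a q| ∂(P.prod P)) * ∫ q, |b q| ∂(P.prod P))
    (∫ q, |a q * b q| ∂(P.prod P)), lt_min (mul_pos ha hb) hab, fun p i j => ?_⟩
  have hev : ∀ (i : Fin p) (f : ℝ × ℝ → ℝ), AEStronglyMeasurable f (P.prod P) →
      ∫ x, f (x i) ∂(Measure.pi fun _ : Fin p => P.prod P) = ∫ q, f q ∂(P.prod P) :=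
    fun i f hf => by
      have hmp := measurePreserving_eval (fun _ : Fin p => P.prod P) i
      rw [← hmp.map_eq] at hf
      have := integral_map hmp.measurable.aemeasurable hf
      rw [hmp.map_eq] at this
      exact this.symm
  by_cases hij : i = j
  · subst hij
    refine (min_le_right _ _).trans (le_of_eq ?_)
    exact (hev i (fun q => |a q * b q|) (ham.integrable_mul hbm).abs.1).symm
  · refine (min_le_left _ _).trans (le_of_eq ?_)
    have hind : iIndepFun (fun (i : Fin p) (x : Fin p → ℝ × ℝ) => x i)
        (Measure.pi fun _ : Fin p => P.prod P) :=
      iIndepFun_pi (μ := fun _ : Fin p => P.prod P) (X := fun _ y => y)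
        fun i => aemeasurable_id
    have hind2 := (hind.indepFun hij).comp (φ := fun q => |a q|) (ψ := fun q => |b q|)
      (by fun_prop) (by fun_prop)
    have h3 := hind2.integral_mul_eq_mul_integral
      ((show Measurable fun q => |a q| by fun_prop).comp
        (measurable_pi_apply i)).aestronglyMeasurable
      ((show Measurable fun q => |b q| by fun_prop).comp
        (measurable_pi_apply j)).aestronglyMeasurable
    rw [← hev i (fun q => |a q|) ham.1.norm, ← hev j (fun q => |b q|) hbm.1.norm]
    refine Eq.trans h3.symm ?_
    refine integral_congr_ae (Filter.Eventually.of_forall fun x => ?_)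
    simp [a, b, abs_mul]

theorem integrable_pairForm {c : ℝ≥0} (hP : HasSubgaussianMGF id c P)
    (H : Matrix (Fin p) (Fin p) ℝ) :
    Integrable (pairForm H) (Measure.pi fun _ => P.prod P) := by
  unfold pairForm
  simp only [Finset.mul_sum]
  refine integrable_finsetSum _ fun i _ => integrable_finsetSum _ fun j _ => ?_
  refine ((integrable_pi_sub_mul_add hP i j).const_mul (H i j)).congr
    (Filter.Eventually.of_forall fun x => ?_)
  simp only
  ring

/-- The `L¹` norm of the centred quadratic form dominates the Frobenius norm. -/
theorem exists_le_integral_abs_pairForm {c : ℝ≥0} (hP : HasSubgaussianMGF id c P)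
    (hsymm : P.map (fun x => -x) = P) (hvar_sq : 0 < Var[fun w => w ^ 2; P]) :
    ∃ c₁ : ℝ, 0 < c₁ ∧ ∀ (p : ℕ) (H : Matrix (Fin p) (Fin p) ℝ),
      c₁ * √(frobeniusSq H) ≤ ∫ x, |pairForm H x| ∂(Measure.pi fun _ : Fin p => P.prod P) := by
  obtain ⟨c₀, hc₀, hle⟩ := exists_le_integral_abs_sub_mul_add hP hvar_sq
  refine ⟨c₀ / 4, by positivity, fun p H => ?_⟩
  set ν := Measure.pi fun _ : Fin p => P.prod P
  have hneg : MeasurePreserving (fun x : ℝ => -x) P P := ⟨measurable_neg, hsymm⟩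
  -- This map fixes q₁ - q₂ and negates q₁ + q₂; the swap does the opposite. The first gives the
  -- bound along each row of H, the second combines the rows, and each costs a factor 1/2.
  have hflip : MeasurePreserving (fun q : ℝ × ℝ => (-q.2, -q.1)) (P.prod P) (P.prod P) :=
    (hneg.prod hneg).comp Measure.measurePreserving_swap
  have hflips : ∀ f : ℝ × ℝ → ℝ × ℝ, MeasurePreserving f (P.prod P) (P.prod P) →
      ∀ ε : Fin p → Bool, MeasurePreserving
        (fun (x : Fin p → ℝ × ℝ) i => if ε i then x i else f (x i)) ν ν := fun f hf ε => by
    refine measurePreserving_pi (fun _ : Fin p => P.prod P) (fun _ => P.prod P)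
      (f := fun i q => if ε i then q else f q) fun i => ?_
    cases ε i
    · simpa using hf
    · exact MeasurePreserving.id _
  have hintrow : ∀ i j, Integrable (fun x : Fin p → ℝ × ℝ => ((x i).1 - (x i).2) *
      (H i j * ((x j).1 + (x j).2))) ν := fun i j =>
    ((integrable_pi_sub_mul_add hP i j).const_mul (H i j)).congr
      (Filter.Eventually.of_forall fun x => by simp only; ring)
  have hrow : ∀ i, c₀ / 2 * √(∑ j, H i j ^ 2) ≤
      ∫ x, |((x i).1 - (x i).2) * ∑ j, H i j * ((x j).1 + (x j).2)| ∂ν := fun i => by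
    have h := sqrt_sum_sq_integral_abs_le (ν := ν)
      (fun j (x : Fin p → ℝ × ℝ) => ((x i).1 - (x i).2) * (H i j * ((x j).1 + (x j).2)))
      (hintrow i) _ (hflips _ hflip) (fun ε j x => by
        have h1 : (if ε i then x i else (-(x i).2, -(x i).1)).1 -
            (if ε i then x i else (-(x i).2, -(x i).1)).2 = (x i).1 - (x i).2 := by
          split_ifs
          · rfl
          · simp; ring
        simp only [h1, boolSign]
        split_ifs <;> simp
        ring)
    simp only [← Finset.mul_sum] at h
    refine le_trans ?_ h
    rw [div_eq_mul_one_div, mul_comm c₀, mul_assoc]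
    refine mul_le_mul_of_nonneg_left ?_ (by norm_num)
    refine Real.le_sqrt_of_sq_le ?_
    rw [mul_pow, Real.sq_sqrt (Finset.sum_nonneg fun _ _ => sq_nonneg _), Finset.mul_sum]
    refine Finset.sum_le_sum fun j _ => ?_
    have h2 : ∫ x, |((x i).1 - (x i).2) * (H i j * ((x j).1 + (x j).2))| ∂ν =
        |H i j| * ∫ x, |((x i).1 - (x i).2) * ((x j).1 + (x j).2)| ∂ν := by
      rw [← integral_const_mul]
      refine integral_congr_ae (Filter.Eventually.of_forall fun x => ?_)
      simp only [abs_mul]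
      ring
    rw [h2, mul_pow, sq_abs, mul_comm]
    gcongr
    exact hle p i j
  have hcol := sqrt_sum_sq_integral_abs_le (ν := ν)
    (fun i (x : Fin p → ℝ × ℝ) => ((x i).1 - (x i).2) * ∑ j, H i j * ((x j).1 + (x j).2))
    (fun i => by
      simp only [Finset.mul_sum]
      exact integrable_finsetSum _ fun j _ => hintrow i j)
    _ (hflips _ Measure.measurePreserving_swap) (fun ε i x => by
      have h1 : ∀ j, (if ε j then x j else (x j).swap).1 +
          (if ε j then x j else (x j).swap).2 = (x j).1 + (x j).2 := fun j => by
        split_ifs <;> simp [add_comm]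
      simp only [h1, boolSign, ← mul_assoc]
      congr 1
      split_ifs <;> simp)
  refine le_trans ?_ hcol
  rw [show c₀ / 4 = 1 / 2 * (c₀ / 2) by ring, mul_assoc]
  refine mul_le_mul_of_nonneg_left ?_ (by norm_num)
  refine Real.le_sqrt_of_sq_le ?_
  rw [mul_pow, Real.sq_sqrt (frobeniusSq_nonneg H), frobeniusSq, Finset.mul_sum]
  refine Finset.sum_le_sum fun i _ => ?_
  have h := pow_le_pow_left₀ (by positivity) (hrow i) 2
  rwa [mul_pow, Real.sq_sqrt (Finset.sum_nonneg fun _ _ => sq_nonneg _)] at h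

end SmallBall

/-! ### Symmetrization and contraction for exponential moments of suprema -/

section Symmetrization

open scoped ENNReal NNReal

variable {E : Type*} [MeasurableSpace E] {ν : Measure E} [IsProbabilityMeasure ν]

theorem integral_const_add_sub_const {φ : E → ℝ} (hφ : Integrable φ ν) (g a : ℝ) :
    ∫ x, (g + (φ x - a)) ∂ν = g + ((∫ x, φ x ∂ν) - a) := by
  have h1 : ∫ x, (g + (φ x - a)) ∂ν = (∫ _, g ∂ν) + ∫ x, (φ x - a) ∂ν :=
    integral_add (integrable_const g) (hφ.sub (integrable_const a))
  have h2 : ∫ x, (φ x - a) ∂ν = (∫ x, φ x ∂ν) - ∫ _, a ∂ν :=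
    integral_sub hφ (integrable_const a)
  rw [h1, h2]
  simp

/-- Jensen's inequality from the tangent line of exp at the mean. It also covers an infinite
exponential moment. -/
theorem eexp_integral_le_lintegral {φ : E → ℝ} (hφ : Integrable φ ν) :
    eexp (∫ x, φ x ∂ν) ≤ ∫⁻ x, eexp (φ x) ∂ν := by
  by_cases htop : ∫⁻ x, eexp (φ x) ∂ν = ∞
  · rw [htop]; exact le_top
  set a := ∫ x, φ x ∂ν
  have hm : AEStronglyMeasurable (fun x => Real.exp (φ x)) ν :=
    (Real.measurable_exp.comp_aemeasurable hφ.1.aemeasurable).aestronglyMeasurable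
  have hexp : Integrable (fun x => Real.exp (φ x)) ν :=
    (lintegral_ofReal_ne_top_iff_integrable hm
      (Filter.Eventually.of_forall fun _ => Real.exp_nonneg _)).1 htop
  have h1 : ∫ x, Real.exp a * (1 + (φ x - a)) ∂ν ≤ ∫ x, Real.exp (φ x) ∂ν := by
    refine integral_mono (((integrable_const 1).add (hφ.sub (integrable_const a))).const_mul _)
      hexp fun x => ?_
    have h2 := Real.add_one_le_exp (φ x - a)
    calc Real.exp a * (1 + (φ x - a)) ≤ Real.exp a * Real.exp (φ x - a) := by
          gcongr; linarith
      _ = Real.exp (φ x) := by rw [← Real.exp_add]; ring_nf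
  have h3 : ∫ x, (1 + (φ x - a)) ∂ν = 1 := by
    rw [integral_const_add_sub_const hφ]
    simp [a]
  rw [integral_const_mul, h3, mul_one] at h1
  refine (ENNReal.ofReal_le_ofReal h1).trans (le_of_eq ?_)
  exact ofReal_integral_eq_lintegral_ofReal hexp
    (Filter.Eventually.of_forall fun _ => Real.exp_nonneg _)

theorem eexp_add_le_half (g a b : ℝ) :
    eexp (g + (a - b)) ≤ 2⁻¹ * (eexp (g + 2 * a) + eexp (g - 2 * b)) := by
  have h4 := convexOn_exp.right (Set.mem_univ (g + 2 * a)) (Set.mem_univ (g - 2 * b))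
    (show (0 : ℝ) ≤ 2⁻¹ by norm_num) (show (0 : ℝ) ≤ 2⁻¹ by norm_num) (by norm_num)
  simp only [smul_eq_mul] at h4
  simp only [eexp]
  rw [← ENNReal.ofReal_add (Real.exp_nonneg _) (Real.exp_nonneg _),
    ← ENNReal.ofReal_ofNat 2, ← ENNReal.ofReal_inv_of_pos (by norm_num),
    ← ENNReal.ofReal_mul (by positivity)]
  refine ENNReal.ofReal_le_ofReal ?_
  rw [show g + (a - b) = 2⁻¹ * (g + 2 * a) + 2⁻¹ * (g - 2 * b) by ring]
  linarith

variable {ι : Type*} [Countable ι] {f : ι → E → ℝ} {σ : E → E}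

/-- The contraction step. For indices i and j, whichever sign gives |t_i| = ±t_i, the term with
-2|t_j| is dominated by the supremum of the opposite sign, so the two terms land in different
suprema. -/
theorem iSup_eexp_abs_add_iSup_eexp_neg_abs_le {ι : Type*} (g t : ι → ℝ) :
    (⨆ i, eexp (g i + 2 * |t i|)) + (⨆ i, eexp (g i - 2 * |t i|)) ≤
      (⨆ i, eexp (g i + 2 * t i)) + ⨆ i, eexp (g i - 2 * t i) := by
  cases isEmpty_or_nonempty ι
  · simp
  refine ENNReal.iSup_add_iSup_le fun i j => ?_
  have hp : ∀ i, eexp (g i + 2 * t i) ≤ ⨆ i, eexp (g i + 2 * t i) :=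
    le_iSup fun i => eexp (g i + 2 * t i)
  have hn : ∀ i, eexp (g i - 2 * t i) ≤ ⨆ i, eexp (g i - 2 * t i) :=
    le_iSup fun i => eexp (g i - 2 * t i)
  have h1 : eexp (g j - 2 * |t j|) ≤ eexp (g j + 2 * t j) :=
    eexp_mono (by linarith [neg_abs_le (t j)])
  have h2 : eexp (g j - 2 * |t j|) ≤ eexp (g j - 2 * t j) :=
    eexp_mono (by linarith [le_abs_self (t j)])
  rcases abs_choice (t i) with h | h
  · rw [h]
    exact add_le_add (hp i) (h2.trans (hn j))
  · rw [h, mul_neg, ← sub_eq_add_neg, add_comm]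
    exact add_le_add (h1.trans (hp j)) (hn i)

/-- Symmetrization and contraction for one random element with a symmetric law. -/
theorem lintegral_iSup_eexp_sub_abs_le (hf : ∀ i, Measurable (f i))
    (hint : ∀ i, Integrable (f i) ν) (hσ : MeasurePreserving σ ν ν)
    (hfσ : ∀ i x, f i (σ x) = -f i x) (g : ι → ℝ) :
    ∫⁻ x, ⨆ i, eexp (g i + ((∫ y, |f i y| ∂ν) - |f i x|)) ∂ν ≤
      ∫⁻ x, ⨆ i, eexp (g i + 2 * f i x) ∂ν := by
  set F : E → ℝ≥0∞ := fun x => ⨆ i, eexp (g i + 2 * |f i x|)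
  set F' : E → ℝ≥0∞ := fun x => ⨆ i, eexp (g i - 2 * |f i x|)
  set G : E → ℝ≥0∞ := fun x => ⨆ i, eexp (g i + 2 * f i x)
  set G' : E → ℝ≥0∞ := fun x => ⨆ i, eexp (g i - 2 * f i x)
  have hF : Measurable F := Measurable.iSup fun i => by have := hf i; fun_prop
  have hG : Measurable G := Measurable.iSup fun i => by have := hf i; fun_prop
  -- Jensen moves the mean out as an independent copy y, and convexity then separates y from x.
  have hpt : ∀ x, ⨆ i, eexp (g i + ((∫ y, |f i y| ∂ν) - |f i x|)) ≤
      2⁻¹ * (∫⁻ y, F y ∂ν + F' x) := fun x => by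
    refine iSup_le fun i => ?_
    rw [← integral_const_add_sub_const (hint i).abs]
    refine (eexp_integral_le_lintegral
      ((integrable_const _).add ((hint i).abs.sub (integrable_const _)))).trans ?_
    calc ∫⁻ y, eexp (g i + (|f i y| - |f i x|)) ∂ν ≤ ∫⁻ y, 2⁻¹ * (F y + F' x) ∂ν := by
          refine lintegral_mono fun y => (eexp_add_le_half _ _ _).trans ?_
          gcongr
          · exact le_iSup (fun i => eexp (g i + 2 * |f i y|)) i
          · exact le_iSup (fun i => eexp (g i - 2 * |f i x|)) i
      _ = 2⁻¹ * (∫⁻ y, F y ∂ν + F' x) := by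
          rw [lintegral_const_mul _ (by fun_prop), lintegral_add_left hF]
          simp
  have hG' : ∫⁻ x, G' x ∂ν = ∫⁻ x, G x ∂ν := by
    rw [← hσ.lintegral_comp hG]
    refine lintegral_congr fun x => ?_
    simp only [G, G', hfσ]
    simp only [mul_neg, sub_eq_add_neg]
  calc _ ≤ ∫⁻ x, 2⁻¹ * (∫⁻ y, F y ∂ν + F' x) ∂ν := lintegral_mono hpt
    _ = 2⁻¹ * (∫⁻ x, F x ∂ν + ∫⁻ x, F' x ∂ν) := by
        have hF' : Measurable F' := Measurable.iSup fun i => by have := hf i; fun_prop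
        rw [lintegral_const_mul _ (by fun_prop), lintegral_add_left (by fun_prop)]
        simp
    _ = 2⁻¹ * ∫⁻ x, F x + F' x ∂ν := by rw [lintegral_add_left hF]
    _ ≤ 2⁻¹ * ∫⁻ x, G x + G' x ∂ν := by
        refine mul_le_mul_right (lintegral_mono fun x => ?_) _
        exact iSup_eexp_abs_add_iSup_eexp_neg_abs_le g fun i => f i x
    _ = ∫⁻ x, G x ∂ν := by
        rw [lintegral_add_left hG, hG', ← two_mul, ← mul_assoc,
          ENNReal.inv_mul_cancel (by norm_num) (by norm_num), one_mul]

theorem lintegral_pi_succ {m : ℕ} {F : (Fin (m + 1) → E) → ℝ≥0∞} (hF : Measurable F) :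
    ∫⁻ x, F x ∂(Measure.pi fun _ : Fin (m + 1) => ν) =
      ∫⁻ y, ∫⁻ x, F (Fin.cons y x) ∂(Measure.pi fun _ : Fin m => ν) ∂ν := by
  have h := (measurePreserving_piFinSuccAbove (fun _ : Fin (m + 1) => ν) 0).symm
  rw [← h.lintegral_comp hF]
  refine (lintegral_prod (μ := ν) (ν := Measure.pi fun _ : Fin m => ν) _
    (hF.comp h.measurable).aemeasurable).trans ?_
  refine lintegral_congr fun y => lintegral_congr fun x => ?_
  simp [MeasurableEquiv.piFinSuccAbove, Fin.insertNthEquiv]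

/-- Symmetrization and contraction for the lower deviations of a sum of absolute values. -/
theorem lintegral_pi_iSup_eexp_sub_abs_le (hf : ∀ i, Measurable (f i))
    (hint : ∀ i, Integrable (f i) ν) (hσ : MeasurePreserving σ ν ν)
    (hfσ : ∀ i x, f i (σ x) = -f i x) (m : ℕ) (g : ι → ℝ) :
    ∫⁻ x, ⨆ i, eexp (g i + ∑ k, ((∫ y, |f i y| ∂ν) - |f i (x k)|))
        ∂(Measure.pi fun _ : Fin m => ν) ≤
      ∫⁻ x, ⨆ i, eexp (g i + 2 * ∑ k, f i (x k)) ∂(Measure.pi fun _ : Fin m => ν) := by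
  have hm : ∀ (i : ι) (m : ℕ) (k : Fin m), Measurable fun x : Fin m → E => f i (x k) :=
    fun i m k => (hf i).comp (measurable_pi_apply k)
  induction m generalizing g with
  | zero => simp
  | succ m ih =>
    rw [lintegral_pi_succ (Measurable.iSup fun i => by have := hm i; fun_prop),
      lintegral_pi_succ (Measurable.iSup fun i => by have := hm i; fun_prop)]
    simp only [Fin.sum_univ_succ, Fin.cons_zero, Fin.cons_succ]
    calc _ ≤ ∫⁻ y, ∫⁻ x, ⨆ i, eexp ((g i + 2 * ∑ k, f i (x k)) +
            ((∫ y, |f i y| ∂ν) - |f i y|)) ∂(Measure.pi fun _ : Fin m => ν) ∂ν := by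
          refine lintegral_mono fun y => ?_
          -- The arbitrary offset g carries the coordinates not being treated, so each coordinate
          -- can be symmetrized in turn.
          have h := ih fun i => g i + ((∫ y, |f i y| ∂ν) - |f i y|)
          simp only [add_assoc] at h
          simp only
          refine h.trans (le_of_eq (lintegral_congr fun x => iSup_congr fun i => ?_))
          ring_nf
      _ = ∫⁻ x, ∫⁻ y, ⨆ i, eexp ((g i + 2 * ∑ k, f i (x k)) +
            ((∫ y, |f i y| ∂ν) - |f i y|)) ∂ν ∂(Measure.pi fun _ : Fin m => ν) := by
          refine lintegral_lintegral_swap (Measurable.iSup fun i => ?_).aemeasurable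
          have h1 := hm i m
          have h2 := hf i
          fun_prop
      _ ≤ ∫⁻ x, ∫⁻ y, ⨆ i, eexp ((g i + 2 * ∑ k, f i (x k)) + 2 * f i y)
            ∂ν ∂(Measure.pi fun _ : Fin m => ν) :=
          lintegral_mono fun x => lintegral_iSup_eexp_sub_abs_le hf hint hσ hfσ _
      _ = ∫⁻ y, ∫⁻ x, ⨆ i, eexp ((g i + 2 * ∑ k, f i (x k)) + 2 * f i y)
            ∂(Measure.pi fun _ : Fin m => ν) ∂ν := by
          refine lintegral_lintegral_swap (Measurable.iSup fun i => ?_).aemeasurable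
          have h1 := hm i m
          have h2 := hf i
          fun_prop
      _ = _ := by
          refine lintegral_congr fun y => lintegral_congr fun x => iSup_congr fun i => ?_
          ring_nf

end Symmetrization

/-! ### Spectral norms of random matrix sums through a net on the sphere -/

section SpectralNorm

open scoped ENNReal NNReal InnerProductSpace

variable {p : ℕ}

/-- The unit sphere of `ℝᵖ` has a `1/2`-net with at most `5 ^ p` elements. -/
theorem exists_net_sphere (p : ℕ) : ∃ S : Finset (EuclideanSpace ℝ (Fin p)), S.card ≤ 5 ^ p ∧
    (∀ u ∈ S, ‖u‖ = 1) ∧ ∀ x : EuclideanSpace ℝ (Fin p), ‖x‖ = 1 → ∃ u ∈ S, ‖x - u‖ ≤ 1 / 2 := by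
  classical
  have hcard : ∀ S : Finset (EuclideanSpace ℝ (Fin p)), (∀ u ∈ S, ‖u‖ = 1) →
      (∀ u ∈ S, ∀ v ∈ S, u ≠ v → 1 / 2 ≤ ‖u - v‖) → S.card ≤ 5 ^ p := fun S h1 h2 => by
    have hinj : Function.Injective fun u : EuclideanSpace ℝ (Fin p) => (2 : ℝ) • u :=
      smul_right_injective _ two_ne_zero
    -- Doubling turns a 1/2-separated subset of the unit sphere into a 1-separated subset of the
    -- ball of radius 2, to which the volume bound 5ᵖ applies.
    have h := Besicovitch.card_le_of_separated (S.image fun u => (2 : ℝ) • u)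
      (fun c hc => by
        obtain ⟨u, hu, rfl⟩ := Finset.mem_image.1 hc
        simp [norm_smul, h1 u hu])
      (fun c hc d hd hcd => by
        obtain ⟨u, hu, rfl⟩ := Finset.mem_image.1 hc
        obtain ⟨v, hv, rfl⟩ := Finset.mem_image.1 hd
        have := h2 u hu v hv fun h => hcd (by rw [h])
        rw [← smul_sub, norm_smul, Real.norm_ofNat]
        linarith)
    rwa [Finset.card_image_of_injective _ hinj, finrank_euclideanSpace_fin] at h
  by_contra! hno
  have hbig : ∀ n : ℕ, ∃ S : Finset (EuclideanSpace ℝ (Fin p)), (∀ u ∈ S, ‖u‖ = 1) ∧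
      (∀ u ∈ S, ∀ v ∈ S, u ≠ v → 1 / 2 ≤ ‖u - v‖) ∧ S.card = n := fun n => by
    induction n with
    | zero => exact ⟨∅, by simp, by simp, rfl⟩
    | succ n ih =>
      obtain ⟨S, h1, h2, h3⟩ := ih
      obtain ⟨x, hx, hxS⟩ := hno S (hcard S h1 h2) h1
      have hxm : x ∉ S := fun h => by
        have := hxS x h
        rw [sub_self, norm_zero] at this
        norm_num at this
      refine ⟨insert x S, ?_, ?_, by rw [Finset.card_insert_of_notMem hxm, h3]⟩
      · intro u hu
        rcases Finset.mem_insert.1 hu with rfl | hu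
        exacts [hx, h1 u hu]
      · intro u hu v hv huv
        rcases Finset.mem_insert.1 hu with rfl | hu' <;>
          rcases Finset.mem_insert.1 hv with rfl | hv'
        · exact absurd rfl huv
        · exact (hxS v hv').le
        · rw [norm_sub_rev]; exact (hxS u hu').le
        · exact h2 u hu' v hv' huv
  obtain ⟨S, h1, h2, h3⟩ := hbig (5 ^ p + 1)
  have := hcard S h1 h2
  omega

theorem inner_toEuclideanCLM_comm {M : Matrix (Fin p) (Fin p) ℝ} (hM : M.IsSymm)
    (x y : EuclideanSpace ℝ (Fin p)) :
    ⟪x, toEuclideanCLM (𝕜 := ℝ) M y⟫_ℝ = ⟪y, toEuclideanCLM (𝕜 := ℝ) M x⟫_ℝ := by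
  rw [inner_toEuclideanCLM, inner_toEuclideanCLM, Matrix.dotProduct_mulVec, dotProduct_comm,
    ← Matrix.mulVec_transpose, hM]

/-- The spectral norm of a symmetric matrix is controlled by its quadratic form. -/
theorem matSpectralNorm_le_of_quadratic {M : Matrix (Fin p) (Fin p) ℝ} (hM : M.IsSymm) {k : ℝ}
    (h : ∀ x : EuclideanSpace ℝ (Fin p), |⟪x, toEuclideanCLM (𝕜 := ℝ) M x⟫_ℝ| ≤ k * ‖x‖ ^ 2)
    (hk : 0 ≤ k) : matSpectralNorm M ≤ k := by
  set L := toEuclideanCLM (𝕜 := ℝ) M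
  have hpol : ∀ x y, ⟪x, L y⟫_ℝ ≤ k * (‖x‖ ^ 2 + ‖y‖ ^ 2) / 2 := fun x y => by
    have h1 := (abs_le.1 (h (x + y))).2
    have h2 := (abs_le.1 (h (x - y))).1
    have h3 := parallelogram_law_with_norm ℝ x y
    have h4 := inner_toEuclideanCLM_comm hM x y
    simp only [map_add, map_sub, inner_add_left, inner_add_right, inner_sub_left,
      inner_sub_right] at h1 h2
    change ⟪x, L y⟫_ℝ = ⟪y, L x⟫_ℝ at h4
    have h5 : k * (‖x + y‖ ^ 2 + ‖x - y‖ ^ 2) = k * (2 * (‖x‖ ^ 2 + ‖y‖ ^ 2)) := by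
      congr 1
    linarith
  refine ContinuousLinearMap.opNorm_le_bound _ hk fun y => ?_
  rcases (norm_nonneg (L y)).eq_or_lt with h0 | h0
  · change ‖L y‖ ≤ _
    rw [← h0]; positivity
  -- The test vector is L y rescaled to the length of y, so that the bound k(‖x‖² + ‖y‖²)/2 becomes
  -- k‖y‖².
  · have h1 := hpol ((‖y‖ / ‖L y‖) • L y) y
    rw [inner_smul_left, real_inner_self_eq_norm_sq, norm_smul, norm_div, norm_norm, norm_norm,
      div_mul_cancel₀ _ h0.ne', conj_trivial] at h1
    have h2 : ‖y‖ / ‖L y‖ * ‖L y‖ ^ 2 = ‖y‖ * ‖L y‖ := by field_simp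
    rw [h2] at h1
    rcases (norm_nonneg y).eq_or_lt with hy | hy
    · rw [norm_eq_zero.1 hy.symm] at h0
      simp at h0
    · refine le_of_mul_le_mul_left ?_ hy
      change ‖y‖ * ‖L y‖ ≤ _
      linarith

/-- By symmetry, ⟨x, Mx⟩ - ⟨u, Mu⟩ = ⟨x - u, M(x + u)⟩, and for unit vectors ‖x - u‖ ‖x + u‖ ≤
√(15/16) ≤ 31/32 within the net distance. The error is thus a proper fraction of the norm and can be
absorbed. -/
theorem exists_mem_net_matSpectralNorm_le (hp : 0 < p) {S : Finset (EuclideanSpace ℝ (Fin p))}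
    (hS1 : ∀ u ∈ S, ‖u‖ = 1)
    (hS : ∀ x : EuclideanSpace ℝ (Fin p), ‖x‖ = 1 → ∃ u ∈ S, ‖x - u‖ ≤ 1 / 2)
    {M : Matrix (Fin p) (Fin p) ℝ} (hM : M.IsSymm) :
    ∃ u ∈ S, matSpectralNorm M ≤ 32 * |⟪u, toEuclideanCLM (𝕜 := ℝ) M u⟫_ℝ| := by
  set L := toEuclideanCLM (𝕜 := ℝ) M
  have hne : S.Nonempty := by
    obtain ⟨u, hu, _⟩ := hS (EuclideanSpace.single ⟨0, hp⟩ 1) (by simp)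
    exact ⟨u, hu⟩
  obtain ⟨w, hw, hmax⟩ := S.exists_max_image (fun u => |⟪u, L u⟫_ℝ|) hne
  refine ⟨w, hw, ?_⟩
  set t := |⟪w, L w⟫_ℝ|
  set N := matSpectralNorm M
  have hN : 0 ≤ N := matSpectralNorm_nonneg M
  have ht : 0 ≤ t := abs_nonneg _
  have hunit : ∀ x : EuclideanSpace ℝ (Fin p), ‖x‖ = 1 → |⟪x, L x⟫_ℝ| ≤ t + 31 / 32 * N := by
    intro x hx
    obtain ⟨u, hu, hxu⟩ := hS x hx
    have h1 : ⟪x, L x⟫_ℝ - ⟪u, L u⟫_ℝ = ⟪x - u, L (x + u)⟫_ℝ := by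
      have h4 : ⟪x, L u⟫_ℝ = ⟪u, L x⟫_ℝ := inner_toEuclideanCLM_comm hM x u
      simp only [map_add, inner_add_right, inner_sub_left]
      linarith
    have h2 : |⟪x - u, L (x + u)⟫_ℝ| ≤ ‖x - u‖ * (N * ‖x + u‖) :=
      (abs_real_inner_le_norm _ _).trans
        (mul_le_mul_of_nonneg_left (norm_toEuclideanCLM_le M _) (norm_nonneg _))
    have h3 : ‖x - u‖ * ‖x + u‖ ≤ 31 / 32 := by
      have h5 := parallelogram_law_with_norm ℝ x u
      rw [hx, hS1 u hu] at h5
      have h6 : ‖x - u‖ ^ 2 ≤ 1 / 4 := by nlinarith [norm_nonneg (x - u)]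
      refine abs_le_of_sq_le_sq' ?_ (by norm_num) |>.2
      rw [mul_pow, show ‖x + u‖ ^ 2 = 4 - ‖x - u‖ ^ 2 by linarith]
      nlinarith [sq_nonneg (‖x - u‖)]
    have h4 := abs_sub_abs_le_abs_sub ⟪x, L x⟫_ℝ ⟪u, L u⟫_ℝ
    rw [h1] at h4
    have h5 := mul_le_mul_of_nonneg_left h3 hN
    have h6 := hmax u hu
    linarith
  have hbd : N ≤ t + 31 / 32 * N := by
    refine matSpectralNorm_le_of_quadratic hM (fun x => ?_) (by positivity)
    rcases eq_or_ne x 0 with rfl | hx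
    · simp
    · have hx0 : 0 < ‖x‖ := norm_pos_iff.2 hx
      have h1 := hunit (‖x‖⁻¹ • x) (by rw [norm_smul, norm_inv, norm_norm, inv_mul_cancel₀ hx0.ne'])
      rw [map_smul, inner_smul_left, inner_smul_right, conj_trivial, ← mul_assoc, abs_mul,
        abs_of_pos (by positivity)] at h1
      have h2 : |⟪x, L x⟫_ℝ| = (‖x‖⁻¹ * ‖x‖⁻¹ * |⟪x, L x⟫_ℝ|) * ‖x‖ ^ 2 := by field_simp
      change |⟪x, L x⟫_ℝ| ≤ _
      rw [h2]
      exact mul_le_mul_of_nonneg_right h1 (by positivity)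
  linarith

/-- The matrix `β βᵀ - β' β'ᵀ` of a pair of vectors given by its coordinates. -/
def pairMatrix (x : Fin p → ℝ × ℝ) : Matrix (Fin p) (Fin p) ℝ :=
  vecMulVec (fun i => (x i).1) (fun i => (x i).1) - vecMulVec (fun i => (x i).2) (fun i => (x i).2)

theorem isSymm_sum_smul_pairMatrix {m : ℕ} (v : Fin m → ℝ) (x : Fin m → Fin p → ℝ × ℝ) :
    (∑ k, v k • pairMatrix (x k)).IsSymm := by
  simp [Matrix.IsSymm, pairMatrix, Matrix.transpose_sum, Matrix.transpose_vecMulVec]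

theorem dotProduct_pairMatrix_mulVec (x : Fin p → ℝ × ℝ) (u : Fin p → ℝ) :
    u ⬝ᵥ (pairMatrix x *ᵥ u) = (∑ i, u i * (x i).1) ^ 2 - (∑ i, u i * (x i).2) ^ 2 := by
  rw [pairMatrix, Matrix.sub_mulVec, vecMulVec_mulVec, vecMulVec_mulVec, dotProduct_sub]
  simp [dotProduct, sq, Finset.mul_sum, mul_comm, mul_left_comm]

theorem frobInner_pairMatrix {H : Matrix (Fin p) (Fin p) ℝ} (hH : H.IsSymm)
    (x : Fin p → ℝ × ℝ) : frobInner H (pairMatrix x) = pairForm H x := by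
  set a : Fin p → ℝ := fun i => (x i).1
  set b : Fin p → ℝ := fun i => (x i).2
  have h1 : frobInner H (pairMatrix x) = a ⬝ᵥ (H *ᵥ a) - b ⬝ᵥ (H *ᵥ b) := by
    rw [pairMatrix, sub_eq_add_neg, frobInner_add_right, frobInner_neg_right,
      frobInner_vecMulVec, frobInner_vecMulVec]
    ring
  have h2 : pairForm H x = (a - b) ⬝ᵥ (H *ᵥ (a + b)) := rfl
  have h3 : a ⬝ᵥ (H *ᵥ b) = b ⬝ᵥ (H *ᵥ a) := by
    rw [Matrix.dotProduct_mulVec, dotProduct_comm, ← Matrix.mulVec_transpose, hH]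
  rw [h1, h2, Matrix.mulVec_add, sub_dotProduct, dotProduct_add, dotProduct_add, h3]
  ring

variable {P : Measure ℝ} [IsProbabilityMeasure P] {c : ℝ≥0}

/-- The exponential moment factorizes over independent copies; each weight must stay within the
range s₀ of the one-copy bound. -/
theorem lintegral_pi_eexp_sum_le {E : Type*} [MeasurableSpace E] {ν : Measure E}
    [IsProbabilityMeasure ν] {q : E → ℝ} (hq : Measurable q) {K s₀ : ℝ}
    (hb : ∀ s, |s| ≤ s₀ → ∫⁻ x, eexp (s * q x) ∂ν ≤ eexp (K * s ^ 2)) {m : ℕ} (v : Fin m → ℝ)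
    (hv : ∀ k, |v k| ≤ s₀) :
    ∫⁻ x, eexp (∑ k, v k * q (x k)) ∂(Measure.pi fun _ : Fin m => ν) ≤
      eexp (K * ∑ k, v k ^ 2) := by
  induction m with
  | zero => simp
  | succ m ih =>
    rw [lintegral_pi_succ (by fun_prop)]
    simp only [Fin.sum_univ_succ, Fin.cons_zero, Fin.cons_succ, eexp_add, mul_add]
    have h1 := ih (fun k => v k.succ) fun k => hv k.succ
    calc _ = ∫⁻ y, eexp (v 0 * q y) * ∫⁻ x, eexp (∑ k : Fin m, v k.succ * q (x k))
          ∂(Measure.pi fun _ : Fin m => ν) ∂ν := by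
          refine lintegral_congr fun y => ?_
          rw [lintegral_const_mul _ (by fun_prop)]
      _ = (∫⁻ y, eexp (v 0 * q y) ∂ν) * ∫⁻ x, eexp (∑ k : Fin m, v k.succ * q (x k))
          ∂(Measure.pi fun _ : Fin m => ν) := lintegral_mul_const _ (by fun_prop)
      _ ≤ _ := mul_le_mul' (hb _ (hv 0)) h1

/-- Exponential moments of the spectral norm of a weighted sum of independent copies of
`β βᵀ - β' β'ᵀ`. -/
theorem lintegral_eexp_matSpectralNorm_le (hc : 0 < c) (hP : HasSubgaussianMGF id c P)
    (hp : 0 < p) {m : ℕ} (v : Fin m → ℝ) {s : ℝ} (hs : 0 ≤ s)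
    (hv : ∀ k, 32 * s * |v k| ≤ 1 / (16 * c)) :
    ∫⁻ x, eexp (s * matSpectralNorm (∑ k, v k • pairMatrix (x k)))
        ∂(Measure.pi fun _ : Fin m => Measure.pi fun _ : Fin p => P.prod P) ≤
      2 * 5 ^ p * eexp (1536 * c ^ 2 * (32 * s) ^ 2 * ∑ k, v k ^ 2) := by
  obtain ⟨S, hcard, hS1, hS⟩ := exists_net_sphere p
  set ν := Measure.pi fun _ : Fin p => P.prod P
  set q : EuclideanSpace ℝ (Fin p) → (Fin p → ℝ × ℝ) → ℝ := fun u x =>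
    (∑ i, u i * (x i).1) ^ 2 - (∑ i, u i * (x i).2) ^ 2 with hq
  have hqm : ∀ u, Measurable (q u) := fun u => by fun_prop
  have hquad : ∀ (u : EuclideanSpace ℝ (Fin p)) (x : Fin m → Fin p → ℝ × ℝ),
      ⟪u, toEuclideanCLM (𝕜 := ℝ) (∑ k, v k • pairMatrix (x k)) u⟫_ℝ = ∑ k, v k * q u (x k) := by
    intro u x
    rw [inner_toEuclideanCLM, Matrix.sum_mulVec, dotProduct_sum]
    simp only [Matrix.smul_mulVec, dotProduct_smul, dotProduct_pairMatrix_mulVec, smul_eq_mul, hq]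
  have hpt : ∀ x : Fin m → Fin p → ℝ × ℝ,
      eexp (s * matSpectralNorm (∑ k, v k • pairMatrix (x k))) ≤
        ∑ u ∈ S, (eexp (∑ k, (32 * s * v k) * q u (x k)) +
          eexp (∑ k, (-(32 * s * v k)) * q u (x k))) := fun x => by
    obtain ⟨u, hu, hle⟩ := exists_mem_net_matSpectralNorm_le hp hS1 hS
      (isSymm_sum_smul_pairMatrix v x)
    rw [hquad] at hle
    refine le_trans ?_ (Finset.single_le_sum (f := fun u =>
      eexp (∑ k, (32 * s * v k) * q u (x k)) + eexp (∑ k, (-(32 * s * v k)) * q u (x k)))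
      (fun _ _ => zero_le) hu)
    have h1 := mul_le_mul_of_nonneg_left hle hs
    have h2 : ∑ k, (32 * s * v k) * q u (x k) = 32 * s * ∑ k, v k * q u (x k) := by
      rw [Finset.mul_sum]; exact Finset.sum_congr rfl fun k _ => by ring
    have h3 : ∑ k, (-(32 * s * v k)) * q u (x k) = -(32 * s * ∑ k, v k * q u (x k)) := by
      rw [← h2, ← Finset.sum_neg_distrib]; exact Finset.sum_congr rfl fun k _ => by ring
    rw [h2, h3]
    rcases abs_choice (∑ k, v k * q u (x k)) with h | h
    · rw [h] at h1
      exact (eexp_mono (by linarith)).trans le_self_add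
    · rw [h] at h1
      exact (eexp_mono (by linarith)).trans le_add_self
  have hu2 : ∀ u ∈ S, ∑ i, u i ^ 2 = 1 := fun u hu => by
    have := EuclideanSpace.norm_sq_eq u
    rw [hS1 u hu] at this
    simpa using this.symm
  have hbound : ∀ u ∈ S, ∀ w : Fin m → ℝ, (∀ k, w k = 32 * s * v k ∨ w k = -(32 * s * v k)) →
      ∫⁻ x, eexp (∑ k, w k * q u (x k)) ∂(Measure.pi fun _ : Fin m => ν) ≤
        eexp (1536 * c ^ 2 * (32 * s) ^ 2 * ∑ k, v k ^ 2) := fun u hu w hw => by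
    have habs : ∀ k, |w k| = 32 * s * |v k| := fun k => by
      rcases hw k with h | h <;> rw [h] <;> simp [abs_mul, abs_of_nonneg hs]
    refine (lintegral_pi_eexp_sum_le (hqm u)
      (fun s hs => lintegral_eexp_sq_sub_sq_le hc hP u (hu2 u hu) hs) w
      fun k => (habs k).trans_le (hv k)).trans (le_of_eq ?_)
    rw [mul_assoc _ ((32 * s) ^ 2), Finset.mul_sum (a := (32 * s) ^ 2)]
    congr 2
    refine Finset.sum_congr rfl fun k _ => ?_
    rw [← sq_abs, habs, mul_pow, sq_abs]
  calc _ ≤ ∫⁻ x, ∑ u ∈ S, (eexp (∑ k, (32 * s * v k) * q u (x k)) +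
          eexp (∑ k, (-(32 * s * v k)) * q u (x k))) ∂(Measure.pi fun _ : Fin m => ν) :=
        lintegral_mono hpt
    _ = ∑ u ∈ S, ((∫⁻ x, eexp (∑ k, (32 * s * v k) * q u (x k))
            ∂(Measure.pi fun _ : Fin m => ν)) +
          ∫⁻ x, eexp (∑ k, (-(32 * s * v k)) * q u (x k)) ∂(Measure.pi fun _ : Fin m => ν)) := by
        rw [lintegral_finsetSum _ fun u _ => by have := hqm u; fun_prop]
        refine Finset.sum_congr rfl fun u _ => lintegral_add_left ?_ _
        have := hqm u
        fun_prop
    _ ≤ ∑ u ∈ S, (2 * eexp (1536 * c ^ 2 * (32 * s) ^ 2 * ∑ k, v k ^ 2)) := by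
        refine Finset.sum_le_sum fun u hu => ?_
        rw [two_mul]
        exact add_le_add (hbound u hu _ fun k => Or.inl rfl) (hbound u hu _ fun k => Or.inr rfl)
    _ ≤ _ := by
        rw [Finset.sum_const, nsmul_eq_mul, ← mul_assoc, mul_comm (2 : ℝ≥0∞) (5 ^ p)]
        rw [mul_comm (5 ^ p : ℝ≥0∞), mul_comm _ (2 : ℝ≥0∞)]
        gcongr
        exact_mod_cast hcard

end SpectralNorm

/-! ### Uniform lower bound over the low-nuclear-norm sphere -/

section UniformLowerBound

open scoped ENNReal NNReal

variable {p : ℕ} {P : Measure ℝ} [IsProbabilityMeasure P] {c : ℝ≥0}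

theorem two_mul_five_pow_le_eexp (hp : 0 < p) : (2 : ℝ≥0∞) * 5 ^ p ≤ eexp (3 * p) := by
  have h1 : (2 : ℝ) ≤ Real.exp 1 := by linarith [Real.add_one_le_exp (1 : ℝ)]
  have h2 : (5 : ℝ) ≤ Real.exp 2 := by
    have := Real.quadratic_le_exp_of_nonneg (x := 2) (by norm_num)
    linarith
  have h3 : (2 : ℝ) ≤ Real.exp p :=
    h1.trans (Real.exp_le_exp.2 (by exact_mod_cast hp))
  have h4 : (5 : ℝ) ^ p ≤ Real.exp (p * 2) := by
    rw [Real.exp_nat_mul]; gcongr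
  have h5 : (2 : ℝ) * 5 ^ p ≤ Real.exp (3 * p) := by
    rw [show (3 : ℝ) * p = p + p * 2 by ring, Real.exp_add]
    gcongr
  calc (2 : ℝ≥0∞) * 5 ^ p = ENNReal.ofReal (2 * 5 ^ p) := by
        rw [ENNReal.ofReal_mul (by norm_num), ENNReal.ofReal_pow (by norm_num)]
        norm_num
    _ ≤ eexp (3 * p) := ENNReal.ofReal_le_ofReal h5

/-- Markov's inequality in exponential form. The set A need not be measurable, which matters for
events quantified over all H. -/
theorem measure_le_eexp_of_lintegral_le {E : Type*} [MeasurableSpace E] {μ : Measure E}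
    {F : E → ℝ≥0∞} (hF : AEMeasurable F μ) {A : Set E} {a b : ℝ} (hA : ∀ x ∈ A, eexp a ≤ F x)
    (hle : ∫⁻ x, F x ∂μ ≤ eexp b) : μ A ≤ eexp (b - a) := by
  have h1 : eexp a * μ A ≤ eexp b :=
    (mul_le_mul_right (measure_mono fun x hx => hA x hx) _).trans
      ((mul_meas_ge_le_lintegral₀ hF _).trans hle)
  have h2 : eexp b = eexp a * eexp (b - a) := by rw [← eexp_add]; ring_nf
  rw [h2] at h1
  exact (ENNReal.mul_le_mul_iff_right (eexp_ne_zero a) (eexp_ne_top a)).1 h1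

/-- The symmetric matrices of Frobenius norm one and nuclear norm at most `5 √r`. -/
def nuclearSphere (p r : ℕ) : Set (Matrix (Fin p) (Fin p) ℝ) :=
  {H | H.IsSymm ∧ frobeniusSq H = 1 ∧ nuclearNorm H ≤ 5 * √r}

/-- Once the absolute values are gone the sum is linear in H, and trace duality bounds it uniformly
by one random spectral norm. -/
theorem sum_pairForm_le {r m : ℕ} {H : Matrix (Fin p) (Fin p) ℝ} (hH : H ∈ nuclearSphere p r)
    (x : Fin m → Fin p → ℝ × ℝ) :
    ∑ k, pairForm H (x k) ≤ 5 * √r * matSpectralNorm (∑ k, (1 : ℝ) • pairMatrix (x k)) := by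
  have h1 : ∑ k, pairForm H (x k) = frobInner H (∑ k, (1 : ℝ) • pairMatrix (x k)) := by
    rw [frobInner_sum_right]
    exact Finset.sum_congr rfl fun k _ => by rw [one_smul, frobInner_pairMatrix hH.1]
  rw [h1]
  exact (frobInner_le_nuclearNorm_mul _ _).trans
    (mul_le_mul_of_nonneg_right hH.2.2 (matSpectralNorm_nonneg _))

theorem continuous_matSpectralNorm :
    Continuous (matSpectralNorm : Matrix (Fin p) (Fin p) ℝ → ℝ) := by
  have h : Continuous fun M : Matrix (Fin p) (Fin p) ℝ =>
      toEuclideanCLM (n := Fin p) (𝕜 := ℝ) M :=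
    LinearMap.continuous_of_finiteDimensional
      (toEuclideanCLM (n := Fin p) (𝕜 := ℝ)).toAlgEquiv.toLinearMap
  exact continuous_norm.comp h

theorem continuous_pairMatrix :
    Continuous (pairMatrix : (Fin p → ℝ × ℝ) → Matrix (Fin p) (Fin p) ℝ) := by
  unfold pairMatrix
  exact ((show Continuous fun x : Fin p → ℝ × ℝ => fun i => (x i).1 by
    fun_prop).matrix_vecMulVec (by fun_prop)).sub
    ((show Continuous fun x : Fin p → ℝ × ℝ => fun i => (x i).2 by
    fun_prop).matrix_vecMulVec (by fun_prop))

theorem measurable_matSpectralNorm_sum {m : ℕ} (v : Fin m → ℝ) :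
    Measurable fun x : Fin m → Fin p → ℝ × ℝ =>
      matSpectralNorm (∑ k, v k • pairMatrix (x k)) :=
  (continuous_matSpectralNorm.comp (continuous_finsetSum _ fun k _ =>
    (continuous_pairMatrix.comp (continuous_apply k)).const_smul (v k))).measurable

/-- Uniform lower bound for the `ℓ¹` norm of the centred quadratic forms over matrices of small
nuclear norm. -/
theorem exists_measure_sum_abs_pairForm_lt_le (hc : 0 < c) (hP : HasSubgaussianMGF id c P)
    {c₁ : ℝ} (hc₁ : 0 < c₁)
    (hsmall : ∀ (p : ℕ) (H : Matrix (Fin p) (Fin p) ℝ),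
      c₁ * √(frobeniusSq H) ≤ ∫ x, |pairForm H x| ∂(Measure.pi fun _ : Fin p => P.prod P)) :
    ∃ C₁ : ℝ, 0 < C₁ ∧ ∀ p r m : ℕ, 0 < p → 1 ≤ r → C₁ * r * p ≤ m →
      (Measure.pi fun _ : Fin m => Measure.pi fun _ : Fin p => P.prod P)
        {x | ∃ H ∈ nuclearSphere p r, ∑ k, |pairForm H (x k)| < c₁ / 2 * m} ≤ eexp (-p) := by
  have hc0 : (0 : ℝ) < c := by exact_mod_cast hc
  set K : ℝ := 1536 * c ^ 2 with hK
  have hK0 : 0 < K := by positivity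
  -- The Chernoff parameter is θ = α/r. The second bound keeps 32 · 10θ√r in the admissible range;
  -- the first makes the quadratic term K · 320²θ²r m at most θc₁m/4, half of the gain θc₁m/2.
  set α : ℝ := min (c₁ / (409600 * K)) (1 / (16 * c) / 320) with hα
  have hα0 : 0 < α := lt_min (by positivity) (by positivity)
  have hα1 : α * (409600 * K) ≤ c₁ :=
    (le_div_iff₀ (by positivity)).1 (min_le_left _ _)
  have hα2 : 320 * α ≤ 1 / (16 * c) := by
    have := min_le_right (c₁ / (409600 * K)) (1 / (16 * c) / 320)
    rw [← hα, le_div_iff₀ (by norm_num)] at this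
    linarith
  refine ⟨16 / (α * c₁), by positivity, fun p r m hp hr hm => ?_⟩
  have hr1 : (1 : ℝ) ≤ r := by exact_mod_cast hr
  have hr0 : (0 : ℝ) < r := by linarith
  set ν := Measure.pi fun _ : Fin p => P.prod P
  set θ : ℝ := α / r with hθ
  have hθ0 : 0 < θ := by positivity
  have : SecondCountableTopology (Matrix (Fin p) (Fin p) ℝ) :=
    inferInstanceAs (SecondCountableTopology (Fin p → Fin p → ℝ))
  obtain ⟨D, hDc, hDd⟩ := TopologicalSpace.exists_countable_dense (nuclearSphere p r)
  have : Countable D := hDc.to_subtype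
  set f : D → (Fin p → ℝ × ℝ) → ℝ := fun H => pairForm (θ • (H.1 : Matrix (Fin p) (Fin p) ℝ))
  have hf : ∀ i, Measurable (f i) := fun i => measurable_pairForm _
  have hswap : MeasurePreserving (fun (x : Fin p → ℝ × ℝ) i => (x i).swap) ν ν :=
    measurePreserving_pi _ _ fun _ => Measure.measurePreserving_swap
  have hsym := lintegral_pi_iSup_eexp_sub_abs_le hf (fun i => integrable_pairForm hP _) hswap
    (fun i x => pairForm_swap _ x) m fun _ => 0
  have hθs : 32 * (10 * θ * √r) ≤ 1 / (16 * c) := by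
    have h1 : θ * √r ≤ α := by
      rw [hθ, div_mul_eq_mul_div, div_le_iff₀ hr0]
      gcongr
      rw [Real.sqrt_le_left (by linarith)]
      nlinarith
    linarith
  have hmgf := lintegral_eexp_matSpectralNorm_le hc hP hp (m := m) (fun _ => 1)
    (s := 10 * θ * √r) (by positivity) fun k => by rw [abs_one, mul_one]; exact hθs
  have hupper : ∫⁻ x, ⨆ i, eexp (0 + 2 * ∑ k, f i (x k)) ∂(Measure.pi fun _ : Fin m => ν) ≤
      eexp (3 * p + K * (32 * (10 * θ * √r)) ^ 2 * m) := by
    calc _ ≤ ∫⁻ x, eexp (10 * θ * √r * matSpectralNorm (∑ k, (1 : ℝ) • pairMatrix (x k)))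
          ∂(Measure.pi fun _ : Fin m => ν) := by
          refine lintegral_mono fun x => iSup_le fun i => eexp_mono ?_
          have h1 := sum_pairForm_le i.1.2 x
          simp only [f, pairForm_smul, ← Finset.mul_sum, zero_add]
          have h2 := mul_le_mul_of_nonneg_left h1 (show 0 ≤ 2 * θ by positivity)
          linarith
      _ ≤ _ := by
          refine hmgf.trans ?_
          rw [eexp_add]
          refine mul_le_mul' (two_mul_five_pow_le_eexp hp) (eexp_mono ?_)
          simp [hK]
  have hlower : ∀ x ∈ {x : Fin m → Fin p → ℝ × ℝ | ∃ H ∈ nuclearSphere p r,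
      ∑ k, |pairForm H (x k)| < c₁ / 2 * m}, eexp (θ * (c₁ / 2 * m)) ≤
      ⨆ i, eexp (0 + ∑ k, ((∫ y, |f i y| ∂ν) - |f i (x k)|)) := by
    rintro x ⟨H, hH, hlt⟩
    have hopen : IsOpen {H : nuclearSphere p r |
        ∑ k, |pairForm (H : Matrix (Fin p) (Fin p) ℝ) (x k)| < c₁ / 2 * m} := by
      refine isOpen_lt (continuous_finsetSum _ fun k _ => ?_) continuous_const
      exact ((continuous_pairForm (x k)).comp continuous_subtype_val).abs
    obtain ⟨H', hlt', hH'⟩ := hDd.inter_open_nonempty _ hopen ⟨⟨H, hH⟩, hlt⟩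
    refine le_trans (eexp_mono ?_) (le_iSup (fun i : D =>
      eexp (0 + ∑ k, ((∫ y, |f i y| ∂ν) - |f i (x k)|))) ⟨H', hH'⟩)
    have h1 : c₁ ≤ ∫ y, |pairForm (H' : Matrix (Fin p) (Fin p) ℝ) y| ∂ν := by
      have := hsmall p H'
      rwa [H'.2.2.1, Real.sqrt_one, mul_one] at this
    have h2 : ∑ k, |pairForm (H' : Matrix (Fin p) (Fin p) ℝ) (x k)| < c₁ / 2 * m := hlt'
    simp only [f, pairForm_smul, abs_mul, abs_of_pos hθ0, integral_const_mul, zero_add,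
      Finset.sum_sub_distrib, Finset.sum_const, Finset.card_univ, Fintype.card_fin, nsmul_eq_mul,
      ← Finset.mul_sum]
    have h3 := mul_le_mul_of_nonneg_left h1 (show 0 ≤ θ * m by positivity)
    have h4 := mul_lt_mul_of_pos_left h2 hθ0
    linarith
  have hFm : AEMeasurable (fun x : Fin m → Fin p → ℝ × ℝ =>
      ⨆ i, eexp (0 + ∑ k, ((∫ y, |f i y| ∂ν) - |f i (x k)|))) (Measure.pi fun _ => ν) := by
    refine (Measurable.iSup fun i => ?_).aemeasurable
    have h : ∀ k, Measurable fun x : Fin m → Fin p → ℝ × ℝ => f i (x k) :=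
      fun k => (hf i).comp (measurable_pi_apply k)
    fun_prop
  refine (measure_le_eexp_of_lintegral_le hFm hlower (hsym.trans hupper)).trans (eexp_mono ?_)
  have hmp : 16 * r * p ≤ α * c₁ * m := by
    have h1 : 16 / (α * c₁) * r * p = 16 * r * p / (α * c₁) := by ring
    rw [h1, div_le_iff₀ (by positivity)] at hm
    linarith
  have hsq : (32 * (10 * θ * √r)) ^ 2 * r = 102400 * α ^ 2 := by
    rw [mul_pow, mul_pow _ (√(r : ℝ)), Real.sq_sqrt hr0.le, hθ]
    field_simp
    ring
  have h2 : (3 * p + K * (32 * (10 * θ * √r)) ^ 2 * m - θ * (c₁ / 2 * m)) * r ≤ -p * r := by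
    have h3 : (3 * p + K * (32 * (10 * θ * √r)) ^ 2 * m - θ * (c₁ / 2 * m)) * r =
        3 * p * r + K * m * ((32 * (10 * θ * √r)) ^ 2 * r) - (θ * r) * (c₁ / 2 * m) := by ring
    rw [h3, hsq, hθ, div_mul_cancel₀ _ hr0.ne']
    have h4 := mul_le_mul_of_nonneg_right hα1 (show (0 : ℝ) ≤ α * m / 4 by positivity)
    nlinarith
  exact le_of_mul_le_mul_right h2 hr0

end UniformLowerBound

/-! ### Existence of the estimator and its deterministic error bound -/

section Deterministic

variable {n p : ℕ}

/-- The pairs of vectors `(β⁽²ᵏ⁻¹⁾, β⁽²ᵏ⁾)`, given by their coordinates. -/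
def pairing (b : Fin n → Fin p → ℝ) (k : Fin (n / 2)) (j : Fin p) : ℝ × ℝ :=
  (b (pairFst k) j, b (pairSnd k) j)

theorem sropDiffDual_eq (b : Fin n → Fin p → ℝ) (v : Fin (n / 2) → ℝ) :
    sropDiffDual b v = ∑ k, v k • pairMatrix (pairing b k) := rfl

theorem sropDiffDual_sub (b : Fin n → Fin p → ℝ) (v w : Fin (n / 2) → ℝ) :
    sropDiffDual b (v - w) = sropDiffDual b v - sropDiffDual b w := by
  simp [sropDiffDual_eq, sub_smul]

theorem srop_sub (b : Fin n → Fin p → ℝ) (M N : Matrix (Fin p) (Fin p) ℝ) (i : Fin n) :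
    srop b (M - N) i = srop b M i - srop b N i := by
  simp [srop, Matrix.sub_mulVec]

theorem sropDiff_sub (b : Fin n → Fin p → ℝ) (M N : Matrix (Fin p) (Fin p) ℝ) :
    sropDiff b (M - N) = sropDiff b M - sropDiff b N := by
  ext k
  simp only [sropDiff, pairDiff, srop_sub, Pi.sub_apply]
  ring

theorem sropDiff_apply_eq_pairForm (b : Fin n → Fin p → ℝ) {M : Matrix (Fin p) (Fin p) ℝ}
    (hM : M.IsSymm) (k : Fin (n / 2)) : sropDiff b M k = pairForm M (pairing b k) := by
  rw [← frobInner_pairMatrix hM, pairMatrix, frobInner_comm, frobInner_sub_left,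
    frobInner_comm, frobInner_comm _ M, frobInner_vecMulVec, frobInner_vecMulVec]
  rfl

theorem sum_sq_sropDiff (b : Fin n → Fin p → ℝ) {M : Matrix (Fin p) (Fin p) ℝ}
    (hM : M.IsSymm) : ∑ k, sropDiff b M k ^ 2 = frobInner M (sropDiffDual b (sropDiff b M)) := by
  rw [sropDiffDual_eq, frobInner_sum_right]
  refine Finset.sum_congr rfl fun k _ => ?_
  rw [frobInner_smul_right, frobInner_pairMatrix hM, ← sropDiff_apply_eq_pairForm b hM, sq]

/-- The pairs use distinct indices; for odd n the last index is left out, hence only an inequality.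
-/
theorem sum_pairFst_add_pairSnd_le {f : Fin n → ℝ} (hf : ∀ i, 0 ≤ f i) :
    ∑ k : Fin (n / 2), (f (pairFst k) + f (pairSnd k)) ≤ ∑ i, f i := by
  have hinj : Function.Injective
      (Sum.elim pairFst pairSnd : Fin (n / 2) ⊕ Fin (n / 2) → Fin n) := by
    rintro (i | i) (j | j) h <;> simp [pairFst, pairSnd, Fin.ext_iff] at h ⊢ <;> omega
  have h := Finset.sum_le_univ_sum_of_nonneg (s := Finset.univ.map ⟨_, hinj⟩) hf
  rw [Finset.sum_map, Fintype.sum_sum_type] at h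
  rw [Finset.sum_add_distrib]
  exact h

theorem sum_abs_sropDiff_le (b : Fin n → Fin p → ℝ) (M : Matrix (Fin p) (Fin p) ℝ) :
    ∑ k, |sropDiff b M k| ≤ ∑ i, |srop b M i| :=
  (Finset.sum_le_sum fun _ _ => abs_sub _ _).trans
    (sum_pairFst_add_pairSnd_le fun i => abs_nonneg (srop b M i))

theorem continuous_srop (b : Fin n → Fin p → ℝ) : Continuous (srop b) := by
  refine continuous_pi fun i => ?_
  unfold srop
  exact continuous_const.dotProduct (continuous_id.matrix_mulVec continuous_const)

theorem isClosed_sropFeasible (b : Fin n → Fin p → ℝ) (y : Fin n → ℝ) (τ η : ℝ) :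
    IsClosed (sropFeasible b y τ η) := by
  have hs : ∀ i, Continuous fun M => srop b M i := fun i =>
    (continuous_apply i).comp (continuous_srop b)
  have h1 : IsClosed {M : Matrix (Fin p) (Fin p) ℝ | M.IsSymm} :=
    isClosed_eq continuous_id.matrix_transpose continuous_id
  have h2 : IsClosed {M : Matrix (Fin p) (Fin p) ℝ | (∑ i, |y i - srop b M i|) / n ≤ 6 * τ} :=
    isClosed_le (by fun_prop) continuous_const
  have h3 : IsClosed {M : Matrix (Fin p) (Fin p) ℝ |
      matSpectralNorm (sropDiffDual b (pairDiff y - sropDiff b M)) ≤ η} := by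
    refine isClosed_le (continuous_matSpectralNorm.comp ?_) continuous_const
    simp only [sropDiffDual_eq]
    refine continuous_finsetSum _ fun k _ => ?_
    have hk : Continuous fun M => (pairDiff y - sropDiff b M) k := by
      simp only [sropDiff, pairDiff, Pi.sub_apply]
      fun_prop
    exact hk.smul continuous_const
  exact h1.inter (h2.inter h3)

/-- The nuclear norm attains its minimum on a nonempty feasible set. -/
theorem exists_isSropEstimator {b : Fin n → Fin p → ℝ} {y : Fin n → ℝ} {τ η : ℝ}
    {A : Matrix (Fin p) (Fin p) ℝ} (hA : A ∈ sropFeasible b y τ η) :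
    ∃ Ahat, IsSropEstimator b y τ η Ahat := by
  set R := nuclearNorm A
  -- Entries are bounded by the nuclear norm, so the sublevel set at A is a closed part of a compact
  -- box.
  have hbox : IsCompact {M : Matrix (Fin p) (Fin p) ℝ | ∀ i j, M i j ∈ Set.Icc (-R) R} := by
    have h : IsCompact (Set.univ.pi fun _ : Fin p => Set.univ.pi fun _ : Fin p => Set.Icc (-R) R) :=
      isCompact_univ_pi fun _ => isCompact_univ_pi fun _ => isCompact_Icc
    exact (Set.ext fun M => ⟨fun hM i j => hM i trivial j trivial, fun hM i _ j _ => hM i j⟩ :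
      (Set.univ.pi fun _ => Set.univ.pi fun _ => Set.Icc (-R) R : Set (Fin p → Fin p → ℝ)) =
        {M : Matrix (Fin p) (Fin p) ℝ | ∀ i j, M i j ∈ Set.Icc (-R) R}) ▸ h
  have hle : IsClosed {M : Matrix (Fin p) (Fin p) ℝ | nuclearNorm M ≤ R} :=
    isClosed_le continuous_nuclearNorm continuous_const
  have hK : IsCompact (sropFeasible b y τ η ∩ {M | nuclearNorm M ≤ R}) := by
    refine hbox.of_isClosed_subset ((isClosed_sropFeasible b y τ η).inter hle) ?_
    rintro M ⟨_, hM⟩ i j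
    refine abs_le.1 ?_
    exact (abs_apply_le_matSpectralNorm M i j).trans ((matSpectralNorm_le_sqrt_frobeniusSq M).trans
      ((sqrt_frobeniusSq_le_nuclearNorm M).trans hM))
  obtain ⟨M, hM, hmin⟩ := hK.exists_isMinOn ⟨A, hA, le_refl R⟩ continuous_nuclearNorm.continuousOn
  refine ⟨M, hM.1, fun N hN => ?_⟩
  rcases le_total (nuclearNorm N) R with h | h
  · exact hmin ⟨hN, h⟩
  · exact le_trans hM.2 h

theorem mem_sropFeasible_of_noise {b : Fin n → Fin p → ℝ} {z : Fin n → ℝ} {τ η : ℝ}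
    {A : Matrix (Fin p) (Fin p) ℝ} (hA : A.IsSymm) (hz : (∑ i, |z i|) / n ≤ 6 * τ)
    (hzd : matSpectralNorm (∑ k, pairDiff z k • pairMatrix (pairing b k)) ≤ η) :
    A ∈ sropFeasible b (fun i => srop b A i + z i) τ η := by
  refine ⟨hA, by simpa using hz, ?_⟩
  have h : pairDiff (fun i => srop b A i + z i) - sropDiff b A = pairDiff z := by
    ext k
    simp only [pairDiff, sropDiff, Pi.sub_apply]
    ring
  rw [h]
  exact hzd

theorem smul_mem_nuclearSphere {r : ℕ} {H : Matrix (Fin p) (Fin p) ℝ} (hH : H.IsSymm)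
    (hpos : 0 < √(frobeniusSq H)) (hN : nuclearNorm H ≤ 5 * √r * √(frobeniusSq H)) :
    (√(frobeniusSq H))⁻¹ • H ∈ nuclearSphere p r := by
  refine ⟨?_, ?_, ?_⟩
  · simp [Matrix.IsSymm, Matrix.transpose_smul, hH.eq]
  · rw [← frobInner_self, frobInner_smul_left, frobInner_smul_right, frobInner_self, ← mul_assoc,
      ← mul_inv, Real.mul_self_sqrt (frobeniusSq_nonneg H)]
    exact inv_mul_cancel₀ (Real.sqrt_pos.1 hpos).ne'
  · refine (nuclearNorm_smul_le (by positivity) H).trans ?_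
    rw [inv_mul_le_iff₀ hpos]
    linarith

/-- The deterministic part of the error bound. -/
theorem frobeniusSq_sub_le_of_isSropEstimator {r : ℕ} (hn : 2 ≤ n) (hr : 1 ≤ r)
    {b : Fin n → Fin p → ℝ} {y : Fin n → ℝ} {τ CP c₁ : ℝ} (hτ : 0 < τ) (hCP : 0 < CP)
    (hc₁ : 0 < c₁)
    (hlow : ∀ H ∈ nuclearSphere p r,
      c₁ / 2 * (n / 2 : ℕ) ≤ ∑ k, |pairForm H (pairing b k)|)
    {A Ahat T : Matrix (Fin p) (Fin p) ℝ}
    (hA : A ∈ sropFeasible b y τ (CP * τ * (√((n : ℝ) * p) + √(Real.log n) * p)))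
    (hAhat : IsSropEstimator b y τ (CP * τ * (√((n : ℝ) * p) + √(Real.log n) * p)) Ahat)
    (hT : IsMaxPart r A T) :
    frobeniusSq (Ahat - A) ≤
      max (5184 / c₁ ^ 2) (28800 * CP ^ 2 / c₁ ^ 4) * τ ^ 2 *
        min ((r : ℝ) * p ^ 2 * Real.log n / n ^ 2 + r * p / n) 1 +
      1 * nuclearNorm (A - T) ^ 2 / r := by
  set η := CP * τ * (√((n : ℝ) * p) + √(Real.log n) * p) with hη
  set H := Ahat - A with hH
  set h := √(frobeniusSq H) with hh
  set R := nuclearNorm (A - T)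
  have hn0 : (0 : ℝ) < n := by exact_mod_cast (by omega : 0 < n)
  have hr0 : (0 : ℝ) < r := by exact_mod_cast hr
  have hlog : 0 ≤ Real.log n := Real.log_nonneg (by exact_mod_cast (by omega : 1 ≤ n))
  have hR : 0 ≤ R := nuclearNorm_nonneg _
  have hhsq : frobeniusSq H = h ^ 2 := (Real.sq_sqrt (frobeniusSq_nonneg H)).symm
  have hh0 : 0 ≤ h := Real.sqrt_nonneg _
  set W := max (5184 / c₁ ^ 2) (28800 * CP ^ 2 / c₁ ^ 4)
  have hW : 0 ≤ W := le_max_of_le_left (by positivity)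
  set D := (r : ℝ) * p ^ 2 * Real.log n / n ^ 2 + r * p / n with hD
  have hD0 : 0 ≤ D := by positivity
  have hmin : 0 ≤ min D 1 := le_min hD0 zero_le_one
  have hcone := nuclearNorm_le_of_nuclearNorm_add_le (H := H) hT
    (by rw [hH, add_sub_cancel]; exact hAhat.2 A hA)
  rw [← hh] at hcone
  change nuclearNorm H ≤ 3 * √r * h + 2 * R at hcone
  have hsr : √(r : ℝ) ^ 2 = r := Real.sq_sqrt hr0.le
  have hsr0 : 0 < √(r : ℝ) := Real.sqrt_pos.2 hr0
  rw [hhsq]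
  -- If the tail dominates, the second term alone suffices, with constant 1. Otherwise 2R < 2√r h
  -- turns the cone bound into the factor 5√r that defines `nuclearSphere`.
  rcases le_or_gt (√r * h) R with hcase | hcase
  · have h1 : h ^ 2 ≤ R ^ 2 / r := by
      rw [le_div_iff₀ hr0, ← hsr, ← mul_pow, mul_comm]
      gcongr
    have h2 : 0 ≤ W * τ ^ 2 * min D 1 := by positivity
    rw [one_mul]
    linarith
  have hhpos : 0 < h := by
    by_contra hneg
    rw [le_antisymm (not_lt.1 hneg) hh0, mul_zero] at hcase
    exact absurd hcase (not_lt.2 hR)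
  have hN : nuclearNorm H ≤ 5 * √r * h := by linarith
  have hHs : H.IsSymm := by
    simp [Matrix.IsSymm, hH, Matrix.transpose_sub, hA.1.eq, hAhat.1.1.eq]
  set m : ℝ := ((n / 2 : ℕ) : ℝ) with hm
  -- The loss from rounding n/2 down is worst at n = 3; here n ≥ 2 is needed.
  have hmn : (n : ℝ) ≤ 3 * m := by
    rw [hm]; exact_mod_cast (by omega : n ≤ 3 * (n / 2))
  have hm0 : 0 < m := by linarith
  have hlb : c₁ / 2 * m * h ≤ ∑ k, |sropDiff b H k| := by
    have h1 := hlow _ (smul_mem_nuclearSphere hHs hhpos hN)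
    simp only [pairForm_smul, abs_mul, ← Finset.mul_sum, ← sropDiff_apply_eq_pairForm b hHs] at h1
    rw [← hh, abs_of_pos (inv_pos.2 hhpos), le_inv_mul_iff₀ hhpos] at h1
    linarith
  have hl1 : h ^ 2 ≤ 5184 / c₁ ^ 2 * τ ^ 2 := by
    have h1 : ∑ i, |srop b H i| ≤ 12 * τ * n := by
      have h2 := (div_le_iff₀ hn0).1 hA.2.1
      have h3 := (div_le_iff₀ hn0).1 hAhat.1.2.1
      have h4 : ∑ i, |srop b H i| ≤ ∑ i, (|y i - srop b A i| + |y i - srop b Ahat i|) := by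
        refine Finset.sum_le_sum fun i _ => ?_
        rw [hH, srop_sub]
        refine le_trans (le_of_eq ?_) (abs_sub (y i - srop b A i) (y i - srop b Ahat i))
        congr 1; ring
      rw [Finset.sum_add_distrib] at h4
      linarith
    have h2 := hlb.trans ((sum_abs_sropDiff_le b H).trans h1)
    have h3 : c₁ * h ≤ 72 * τ := by
      have h4 : c₁ * h * m ≤ 72 * τ * m := by nlinarith
      exact le_of_mul_le_mul_right h4 hm0
    rw [div_mul_eq_mul_div, le_div_iff₀ (by positivity)]
    nlinarith [pow_le_pow_left₀ (by positivity) h3 2]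
  have hds : h ^ 2 ≤ 28800 * CP ^ 2 / c₁ ^ 4 * τ ^ 2 * D := by
    have hspec : matSpectralNorm (sropDiffDual b (sropDiff b H)) ≤ 2 * η := by
      have h1 : sropDiff b H = (pairDiff y - sropDiff b A) - (pairDiff y - sropDiff b Ahat) := by
        rw [hH, sropDiff_sub]; abel
      rw [h1, sropDiffDual_sub]
      refine (matSpectralNorm_sub_le _ _).trans ?_
      linarith [hA.2.2, hAhat.1.2.2]
    -- Cauchy-Schwarz passes from ℓ¹ to ℓ², and the squared ℓ² norm is the pairing of H with the
    -- dual map applied to its own measurements, where the spectral constraint enters twice.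
    have h1 : (c₁ / 2 * m * h) ^ 2 ≤ m * (5 * √r * h * (2 * η)) := by
      calc (c₁ / 2 * m * h) ^ 2 ≤ (∑ k, |sropDiff b H k|) ^ 2 := by gcongr
        _ ≤ m * ∑ k, sropDiff b H k ^ 2 := by
            have := sq_sum_le_card_mul_sum_sq (s := Finset.univ)
              (f := fun k : Fin (n / 2) => |sropDiff b H k|)
            simpa [hm] using this
        _ ≤ m * (nuclearNorm H * matSpectralNorm (sropDiffDual b (sropDiff b H))) := by
            rw [sum_sq_sropDiff b hHs]
            gcongr
            exact frobInner_le_nuclearNorm_mul _ _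
        _ ≤ m * (5 * √r * h * (2 * η)) := by
            gcongr
            exact matSpectralNorm_nonneg _
    have h2 : c₁ ^ 2 * n * h ≤ 120 * (√r * η) := by
      have h3 : (m * h) * (c₁ ^ 2 * m * h) ≤ (m * h) * (40 * (√r * η)) := by linarith
      have h4 := le_of_mul_le_mul_left h3 (by positivity)
      have h5 := mul_le_mul_of_nonneg_left hmn (show 0 ≤ c₁ ^ 2 * h by positivity)
      linarith
    have hη2 : η ^ 2 ≤ 2 * CP ^ 2 * τ ^ 2 * (n * p + Real.log n * p ^ 2) := by
      have h3 : (√((n : ℝ) * p) + √(Real.log n) * p) ^ 2 ≤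
          2 * (√((n : ℝ) * p) ^ 2 + (√(Real.log n) * p) ^ 2) := add_sq_le
      rw [mul_pow √(Real.log n), Real.sq_sqrt (by positivity), Real.sq_sqrt hlog] at h3
      rw [hη, mul_pow, mul_pow]
      have := mul_le_mul_of_nonneg_left h3 (show 0 ≤ CP ^ 2 * τ ^ 2 by positivity)
      linarith
    have h6 := pow_le_pow_left₀ (by positivity) h2 2
    rw [mul_pow, mul_pow 120, mul_pow (√(r : ℝ)), hsr] at h6
    have h7 : D * n ^ 2 = r * (n * p + Real.log n * p ^ 2) := by
      rw [hD]; field_simp; ring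
    have h8 := mul_le_mul_of_nonneg_left hη2 (show (0 : ℝ) ≤ 14400 * r by positivity)
    have h9 : h ^ 2 * (c₁ ^ 4 * n ^ 2) ≤ 28800 * CP ^ 2 * τ ^ 2 * D * n ^ 2 := by
      rw [mul_assoc (28800 * CP ^ 2 * τ ^ 2), h7]
      linarith
    have h10 : h ^ 2 * c₁ ^ 4 ≤ 28800 * CP ^ 2 * τ ^ 2 * D := by
      refine le_of_mul_le_mul_right ?_ (show (0 : ℝ) < n ^ 2 by positivity)
      linarith
    rw [show 28800 * CP ^ 2 / c₁ ^ 4 * τ ^ 2 * D = 28800 * CP ^ 2 * τ ^ 2 * D / c₁ ^ 4 by ring,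
      le_div_iff₀ (by positivity)]
    exact h10
  have h1 : h ^ 2 ≤ W * τ ^ 2 * min D 1 := by
    rw [mul_min_of_nonneg _ _ (by positivity), mul_one]
    refine le_min (hds.trans ?_) (hl1.trans ?_)
    · gcongr; exact le_max_right _ _
    · gcongr; exact le_max_left _ _
  have h2 : 0 ≤ 1 * R ^ 2 / r := by positivity
  linarith

end Deterministic

/-! ### The joint law of the pairs and the noise as a product measure -/

section JointLaw

open scoped ENNReal NNReal

theorem measurePreserving_curry_pi {ι κ : Type*} [Fintype ι] [Fintype κ] {X : Type*}
    [MeasurableSpace X] (P : Measure X) [IsProbabilityMeasure P] :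
    MeasurePreserving (fun (w : ι × κ → X) i j => w (i, j)) (Measure.pi fun _ : ι × κ => P)
      (Measure.pi fun _ : ι => Measure.pi fun _ : κ => P) := by
  refine ⟨by fun_prop, ?_⟩
  have h := Measure.infinitePi_map_curry (ι := ι) (κ := κ) fun _ _ => P
  simp only [Measure.infinitePi_eq_pi] at h
  exact h

variable {Ω : Type*} [MeasurableSpace Ω] {μ : Measure Ω} [IsProbabilityMeasure μ] {n p : ℕ}
  {P : Measure ℝ} [IsProbabilityMeasure P]

/-- The index of the variable `β` that is used for the given pair, coordinate and member. -/
def pairIndex (n p : ℕ) :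
    (Fin (n / 2) × (Fin p × Fin 2)) ⊕ Fin n → (Fin n × Fin p) ⊕ Fin n
  | .inl (k, j, e) => .inl (if e = 0 then pairFst k else pairSnd k, j)
  | .inr i => .inr i

theorem pairIndex_injective : Function.Injective (pairIndex n p) := by
  rintro (⟨k, j, e⟩ | i) (⟨k', j', e'⟩ | i') h
  · simp only [pairIndex, Sum.inl.injEq, Prod.mk.injEq] at h
    obtain ⟨h1, rfl⟩ := h
    have h2 := congrArg Fin.val h1
    fin_cases e <;> fin_cases e' <;> simp [pairFst, pairSnd] at h2 <;>
      first
        | omega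
        | (have : k = k' := Fin.ext (by omega)
           rw [this])
  · simp [pairIndex] at h
  · simp [pairIndex] at h
  · simpa [pairIndex] using h

/-- The pairs of vectors are independent copies of a pair of independent vectors, and they are
independent of the noise. -/
theorem map_pairing_prodMk_eq {β : Fin n → Fin p → Ω → ℝ} {z : Fin n → Ω → ℝ}
    (hβ : ∀ i j, HasLaw (β i j) P μ) (hz : ∀ i, AEMeasurable (z i) μ)
    (hind : iIndepFun (Sum.elim (fun ij : Fin n × Fin p => β ij.1 ij.2) z) μ) :
    AEMeasurable (fun ω => (pairing (fun i j => β i j ω), fun i => z i ω)) μ ∧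
    μ.map (fun ω => (pairing (fun i j => β i j ω), fun i => z i ω)) =
      (Measure.pi fun _ : Fin (n / 2) => Measure.pi fun _ : Fin p => P.prod P).prod
        (Measure.pi fun i => μ.map (z i)) := by
  have hzp : ∀ i, IsProbabilityMeasure (μ.map (z i)) := fun i =>
    Measure.isProbabilityMeasure_map (hz i)
  set f : (Fin n × Fin p) ⊕ Fin n → Ω → ℝ := Sum.elim (fun ij => β ij.1 ij.2) z
  have hf : ∀ s, AEMeasurable (f s) μ := by
    rintro (⟨i, j⟩ | i)
    exacts [(hβ i j).aemeasurable, hz i]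
  have hlaw := (iIndepFun_iff_map_fun_eq_pi_map fun s => hf (pairIndex n p s)).1
    (hind.precomp pairIndex_injective)
  have hmeas : AEMeasurable (fun ω s => f (pairIndex n p s) ω) μ :=
    aemeasurable_pi_lambda _ fun s => hf _
  set Q : (Fin (n / 2) × (Fin p × Fin 2)) ⊕ Fin n → Measure ℝ :=
    Sum.elim (fun _ => P) fun i => μ.map (z i) with hQ
  have hQe : (fun s => μ.map (f (pairIndex n p s))) = Q := by
    funext s
    rcases s with ⟨k, j, e⟩ | i
    · exact (hβ _ _).map_eq
    · rfl
  rw [hQe] at hlaw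
  have hQp : ∀ s, IsProbabilityMeasure (Q s) := fun s =>
    hQe ▸ Measure.isProbabilityMeasure_map (hf _)
  have h1 := measurePreserving_sumPiEquivProdPi Q
  have h2 : MeasurePreserving (fun (w : Fin (n / 2) × (Fin p × Fin 2) → ℝ) k j e => w (k, j, e))
      (Measure.pi fun _ => P)
      (Measure.pi fun _ => Measure.pi fun _ : Fin p => Measure.pi fun _ : Fin 2 => P) := by
    have ha := measurePreserving_curry_pi (ι := Fin (n / 2)) (κ := Fin p × Fin 2) P
    have hb := measurePreserving_pi _ _ fun _ : Fin (n / 2) =>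
      measurePreserving_curry_pi (ι := Fin p) (κ := Fin 2) P
    exact hb.comp ha
  have h3 : MeasurePreserving (fun (w : Fin (n / 2) → Fin p → Fin 2 → ℝ) k j => (w k j 0, w k j 1))
      (Measure.pi fun _ => Measure.pi fun _ : Fin p => Measure.pi fun _ : Fin 2 => P)
      (Measure.pi fun _ => Measure.pi fun _ : Fin p => P.prod P) :=
    measurePreserving_pi _ _ fun _ => measurePreserving_pi _ _ fun _ => measurePreserving_finTwoArrow P
  have h4 := ((h3.comp h2).prod (MeasurePreserving.id (Measure.pi fun i => μ.map (z i)))).comp h1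
  have h5 : (fun ω => (pairing (fun i j => β i j ω), fun i => z i ω)) =
      (Prod.map ((fun (w : Fin (n / 2) → Fin p → Fin 2 → ℝ) k j => (w k j 0, w k j 1)) ∘
        fun (w : Fin (n / 2) × (Fin p × Fin 2) → ℝ) k j e => w (k, j, e)) id ∘
        MeasurableEquiv.sumPiEquivProdPi fun _ => ℝ) ∘
        fun ω s => f (pairIndex n p s) ω := by
    funext ω
    rfl
  rw [h5]
  refine ⟨h4.measurable.comp_aemeasurable hmeas, ?_⟩
  rw [← AEMeasurable.map_map_of_aemeasurable h4.measurable.aemeasurable hmeas, hlaw]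
  exact h4.map_eq

end JointLaw

/-! ### Noise events and feasibility of the true matrix -/

section Noise

open scoped ENNReal NNReal

variable {n p : ℕ}

theorem IsSubGaussianWith.map {Ω : Type*} [MeasurableSpace Ω] {μ : Measure Ω} {Z : Ω → ℝ} {τ : ℝ}
    (hZm : AEMeasurable Z μ) (hZ : IsSubGaussianWith Z τ μ) :
    IsSubGaussianWith (fun w => w) τ (μ.map Z) := fun t ht => by
  have hm : MeasurableSet {w : ℝ | t ≤ |w|} :=
    measurableSet_le measurable_const measurable_id.abs
  rw [map_measureReal_apply_of_aemeasurable hZm hm]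
  exact hZ t ht

variable {Q : Fin n → Measure ℝ} [∀ i, IsProbabilityMeasure (Q i)] {τ : ℝ}

/-- At height 2τ√(log n) each coordinate has tail 2/n², and a union bound over n coordinates gives
2/n. -/
theorem measure_pi_exists_lt_abs_le (hn : 2 ≤ n) (hτ : 0 < τ)
    (hQ : ∀ i, IsSubGaussianWith (fun w => w) τ (Q i)) :
    Measure.pi Q {w | ∃ i, 2 * τ * √(Real.log n) < |w i|} ≤ ENNReal.ofReal (2 / n) := by
  have hn0 : (0 : ℝ) < n := by exact_mod_cast (by omega : 0 < n)
  have hlog : 0 < Real.log n := Real.log_pos (by exact_mod_cast (by omega : 1 < n))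
  set t := 2 * τ * √(Real.log n) with ht
  have ht0 : 0 < t := by positivity
  have hm : MeasurableSet {w : ℝ | t ≤ |w|} :=
    measurableSet_le measurable_const measurable_id.abs
  have hsub : {w : Fin n → ℝ | ∃ i, t < |w i|} ⊆
      ⋃ i : Fin n, (Function.eval i) ⁻¹' {w : ℝ | t ≤ |w|} := by
    rintro w ⟨i, hi⟩
    exact Set.mem_iUnion.2 ⟨i, hi.le⟩
  have hone : ∀ i, Measure.pi Q ((Function.eval i) ⁻¹' {w : ℝ | t ≤ |w|}) ≤
      ENNReal.ofReal (2 / n ^ 2) := fun i => by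
    rw [(measurePreserving_eval Q i).measure_preimage hm.nullMeasurableSet,
      ← ofReal_measureReal]
    refine ENNReal.ofReal_le_ofReal ((hQ i t ht0).trans (le_of_eq ?_))
    have h1 : -t ^ 2 / (2 * τ ^ 2) = -Real.log n + -Real.log n := by
      rw [ht, mul_pow, Real.sq_sqrt hlog.le]
      field_simp
      ring
    rw [h1, Real.exp_add, Real.exp_neg, Real.exp_log hn0]
    field_simp
  refine (measure_mono hsub).trans ((measure_iUnion_fintype_le _ _).trans
    ((Finset.sum_le_sum fun i _ => hone i).trans (le_of_eq ?_)))
  rw [Finset.sum_const, Finset.card_univ, Fintype.card_fin, nsmul_eq_mul,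
    ← ENNReal.ofReal_natCast, ← ENNReal.ofReal_mul hn0.le]
  congr 1
  field_simp

/-- The exponential moment of ∑ w_i²/(4τ²) is at most 3ⁿ ≤ e²ⁿ, against the threshold 9n; e⁻⁷ⁿ is
more than enough. -/
theorem measure_pi_lt_sum_sq_le (hτ : 0 < τ)
    (hQ : ∀ i, IsSubGaussianWith (fun w => w) τ (Q i)) :
    Measure.pi Q {w | 36 * n * τ ^ 2 < ∑ i, w i ^ 2} ≤ eexp (-n) := by
  have h3 : (3 : ℝ≥0∞) ≤ eexp 2 := by
    have h := one_add_le_eexp (show (0 : ℝ) ≤ 2 by norm_num)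
    rw [ENNReal.ofReal_ofNat] at h
    exact le_trans (by norm_num) h
  have hmeas : ∀ i : Fin n, Measurable fun w : Fin n → ℝ => eexp (w i ^ 2 / (4 * τ ^ 2)) :=
    fun i => by fun_prop
  have hind : iIndepFun (fun (i : Fin n) (w : Fin n → ℝ) => eexp (w i ^ 2 / (4 * τ ^ 2)))
      (Measure.pi Q) :=
    iIndepFun_pi (μ := Q) (X := fun _ y => eexp (y ^ 2 / (4 * τ ^ 2))) fun i => by fun_prop
  have hone : ∀ i : Fin n, ∫⁻ w, eexp (w i ^ 2 / (4 * τ ^ 2)) ∂(Measure.pi Q) ≤ 3 := fun i => by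
    have hm : Measurable fun y : ℝ => eexp (y ^ 2 / (4 * τ ^ 2)) := by fun_prop
    exact ((measurePreserving_eval Q i).lintegral_comp hm).le.trans
      ((hQ i).lintegral_eexp_sq_le hτ measurable_id.aemeasurable)
  have hint : ∫⁻ w, ∏ i, eexp (w i ^ 2 / (4 * τ ^ 2)) ∂(Measure.pi Q) ≤ eexp (n * 2) := by
    rw [lintegral_prod_eq_prod_lintegral_of_indepFun _ _ hind hmeas, eexp_nsmul]
    calc ∏ i : Fin n, ∫⁻ w, eexp (w i ^ 2 / (4 * τ ^ 2)) ∂(Measure.pi Q)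
        ≤ ∏ _i : Fin n, eexp 2 := Finset.prod_le_prod' fun i _ => (hone i).trans h3
      _ = eexp 2 ^ n := by simp
  refine (measure_le_eexp_of_lintegral_le (a := 9 * n)
    (Finset.univ.measurable_prod fun i _ => hmeas i).aemeasurable ?_ hint).trans
    (eexp_mono ?_)
  · intro w hw
    rw [← eexp_sum]
    refine eexp_mono ?_
    rw [← Finset.sum_div, le_div_iff₀ (by positivity)]
    linarith [show 36 * n * τ ^ 2 < ∑ i, w i ^ 2 from hw]
  · have : (0 : ℝ) ≤ n := Nat.cast_nonneg n
    linarith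

variable {P : Measure ℝ} [IsProbabilityMeasure P] {c : ℝ≥0}

theorem sum_sq_pairDiff_le (w : Fin n → ℝ) : ∑ k, pairDiff w k ^ 2 ≤ 2 * ∑ i, w i ^ 2 := by
  have h := sum_pairFst_add_pairSnd_le (f := fun i => w i ^ 2) fun i => sq_nonneg _
  calc ∑ k, pairDiff w k ^ 2 ≤ ∑ k, 2 * (w (pairFst k) ^ 2 + w (pairSnd k) ^ 2) :=
        Finset.sum_le_sum fun k _ => by
          rw [pairDiff]; nlinarith [sq_nonneg (w (pairFst k) + w (pairSnd k))]
    _ ≤ 2 * ∑ i, w i ^ 2 := by rw [← Finset.mul_sum]; gcongr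

/-- Tail bound for the spectral norm of the dual map at a fixed noise vector. -/
theorem measure_lt_matSpectralNorm_pairDiff_le (hc : 0 < c) (hP : HasSubgaussianMGF id c P)
    (hp : 0 < p) (hn : 0 < n) (hτ : 0 < τ) {w : Fin n → ℝ}
    (hw : ∀ i, |w i| ≤ 2 * τ * √(Real.log n)) (hw2 : ∑ i, w i ^ 2 ≤ 36 * n * τ ^ 2) :
    (Measure.pi fun _ : Fin (n / 2) => Measure.pi fun _ : Fin p => P.prod P)
      {x | 63488 * c * τ * (√((n : ℝ) * p) + √(Real.log n) * p) <
        matSpectralNorm (∑ k, pairDiff w k • pairMatrix (x k))} ≤ eexp (-p) := by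
  have hc0 : (0 : ℝ) < c := by exact_mod_cast hc
  have hp0 : (0 : ℝ) < p := by exact_mod_cast hp
  have hn0 : (0 : ℝ) < n := by exact_mod_cast hn
  set D := √((n : ℝ) * p) + √(Real.log n) * p with hD
  have hD1 : √((n : ℝ) * p) ≤ D := le_add_of_nonneg_right (by positivity)
  have hD2 : √(Real.log n) * p ≤ D := le_add_of_nonneg_left (by positivity)
  have hD0 : 0 < D := (Real.sqrt_pos.2 (by positivity)).trans_le hD1
  have hDsq : n * p ≤ D ^ 2 := by
    rw [← Real.sq_sqrt (show (0 : ℝ) ≤ n * p by positivity)]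
    gcongr
  -- The term √(log n) p of D keeps s times each weight in the sub-exponential range; the term √(np)
  -- makes the quadratic exponent at most 27p. With 3p from the net the moment is e³⁰ᵖ, and the
  -- threshold constant 63488 = 31 · 2048 corresponds to e³¹ᵖ.
  set s := p / (2048 * c * τ * D) with hs
  have hs0 : 0 ≤ s := by positivity
  have hsD : s * (2048 * c * τ * D) = p := by rw [hs]; field_simp
  have hv : ∀ k, 32 * s * |pairDiff w k| ≤ 1 / (16 * c) := fun k => by
    have h1 : |pairDiff w k| ≤ 4 * τ * √(Real.log n) :=
      (abs_sub _ _).trans (by linarith [hw (pairFst k), hw (pairSnd k)])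
    rw [le_div_iff₀ (by positivity)]
    have h2 : 32 * s * |pairDiff w k| * (16 * c) ≤
        s * (2048 * c * τ) * √(Real.log n) := by
      nlinarith [mul_le_mul_of_nonneg_left h1 (show 0 ≤ 32 * s * (16 * c) by positivity)]
    refine h2.trans (le_of_mul_le_mul_right ?_ hp0)
    rw [one_mul, mul_assoc]
    calc s * (2048 * c * τ) * (√(Real.log n) * p) ≤ s * (2048 * c * τ) * D := by gcongr
      _ = p := by rw [← hsD]; ring
  have hint := lintegral_eexp_matSpectralNorm_le hc hP hp (pairDiff w) hs0 hv
  have hexp : 1536 * (c : ℝ) ^ 2 * (32 * s) ^ 2 * ∑ k, pairDiff w k ^ 2 ≤ 27 * p := by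
    have h1 : ∑ k, pairDiff w k ^ 2 ≤ 72 * n * τ ^ 2 :=
      (sum_sq_pairDiff_le w).trans (by linarith)
    have h2 : (s * (2048 * c * τ)) ^ 2 * ((n : ℝ) * p) ≤ (p : ℝ) ^ 2 := by
      calc (s * (2048 * c * τ)) ^ 2 * ((n : ℝ) * p) ≤ (s * (2048 * c * τ)) ^ 2 * D ^ 2 := by gcongr
        _ = (p : ℝ) ^ 2 := by rw [← hsD]; ring
    have h3 : (s * (2048 * c * τ)) ^ 2 * n ≤ p :=
      le_of_mul_le_mul_right (by linarith) hp0
    have h4 := mul_le_mul_of_nonneg_left h1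
      (show 0 ≤ 1536 * (c : ℝ) ^ 2 * (32 * s) ^ 2 by positivity)
    linarith
  have hle : (2 : ℝ≥0∞) * 5 ^ p * eexp (1536 * c ^ 2 * (32 * s) ^ 2 * ∑ k, pairDiff w k ^ 2) ≤
      eexp (30 * p) := by
    calc _ ≤ eexp (3 * p) * eexp (27 * p) := by
          gcongr
          · exact two_mul_five_pow_le_eexp hp
          · exact eexp_mono hexp
      _ = eexp (30 * p) := by rw [← eexp_add]; ring_nf
  refine (measure_le_eexp_of_lintegral_le (a := 31 * p) ?_ ?_ (hint.trans hle)).trans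
    (eexp_mono (by linarith))
  · exact (measurable_eexp.comp ((measurable_matSpectralNorm_sum _).const_mul s)).aemeasurable
  · intro x hx
    refine eexp_mono ?_
    have h1 := mul_le_mul_of_nonneg_left (le_of_lt hx) hs0
    linarith

theorem measurable_matSpectralNorm_sum_pairDiff :
    Measurable fun q : (Fin (n / 2) → Fin p → ℝ × ℝ) × (Fin n → ℝ) =>
      matSpectralNorm (∑ k, pairDiff q.2 k • pairMatrix (q.1 k)) := by
  refine (continuous_matSpectralNorm.comp (continuous_finsetSum _ fun k _ => ?_)).measurable
  have h1 : Continuous fun q : (Fin (n / 2) → Fin p → ℝ × ℝ) × (Fin n → ℝ) => pairDiff q.2 k := by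
    unfold pairDiff; fun_prop
  exact h1.smul (continuous_pairMatrix.comp ((continuous_apply k).comp continuous_fst))

/-- Fubini with the noise fixed: on slices with good noise the fixed-weight tail bound applies, and
the other slices are empty. -/
theorem prod_measure_lt_matSpectralNorm_pairDiff_le (hc : 0 < c) (hP : HasSubgaussianMGF id c P)
    (hp : 0 < p) (hn : 0 < n) (hτ : 0 < τ) :
    ((Measure.pi fun _ : Fin (n / 2) => Measure.pi fun _ : Fin p => P.prod P).prod (Measure.pi Q))
      {q | ((∀ i, |q.2 i| ≤ 2 * τ * √(Real.log n)) ∧ ∑ i, q.2 i ^ 2 ≤ 36 * n * τ ^ 2) ∧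
        63488 * c * τ * (√((n : ℝ) * p) + √(Real.log n) * p) <
          matSpectralNorm (∑ k, pairDiff q.2 k • pairMatrix (q.1 k))} ≤ eexp (-p) := by
  have hm1 : MeasurableSet {q : (Fin (n / 2) → Fin p → ℝ × ℝ) × (Fin n → ℝ) |
      ∀ i, |q.2 i| ≤ 2 * τ * √(Real.log n)} := by
    rw [Set.ofPred_forall]
    exact MeasurableSet.iInter fun i => measurableSet_le (by fun_prop) measurable_const
  have hm2 : MeasurableSet {q : (Fin (n / 2) → Fin p → ℝ × ℝ) × (Fin n → ℝ) |
      ∑ i, q.2 i ^ 2 ≤ 36 * n * τ ^ 2} := measurableSet_le (by fun_prop) measurable_const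
  refine (Measure.prod_apply_symm ((hm1.inter hm2).inter
    (measurableSet_lt measurable_const measurable_matSpectralNorm_sum_pairDiff))).le.trans ?_
  refine (lintegral_mono (g := fun _ => eexp (-p)) fun w => ?_).trans (by simp)
  by_cases hw : (∀ i, |w i| ≤ 2 * τ * √(Real.log n)) ∧ ∑ i, w i ^ 2 ≤ 36 * n * τ ^ 2
  · exact (measure_mono fun x hx => hx.2).trans
      (measure_lt_matSpectralNorm_pairDiff_le hc hP hp hn hτ hw.1 hw.2)
  · refine (measure_mono (t := ∅) fun x hx => hw hx.1).trans (by simp)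

theorem sum_abs_div_le_of_sum_sq_le (hn : 0 < n) (hτ : 0 < τ) {w : Fin n → ℝ}
    (hw : ∑ i, w i ^ 2 ≤ 36 * n * τ ^ 2) : (∑ i, |w i|) / n ≤ 6 * τ := by
  have hn0 : (0 : ℝ) < n := by exact_mod_cast hn
  have h := sq_sum_le_card_mul_sum_sq (s := Finset.univ) (f := fun i => |w i|)
  simp only [Finset.card_univ, Fintype.card_fin, sq_abs] at h
  rw [div_le_iff₀ hn0]
  refine abs_le_of_sq_le_sq' ?_ (by positivity) |>.2
  nlinarith

/-- The conditions under which the error bound holds are met with high probability. -/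
theorem prod_measure_not_regular_le (hc : 0 < c) (hP : HasSubgaussianMGF id c P)
    (hp : 0 < p) (hn : 2 ≤ n) (hpn : p ≤ n) (hτ : 0 < τ)
    (hQ : ∀ i, IsSubGaussianWith (fun w => w) τ (Q i)) {r : ℕ} {c₁ : ℝ}
    (hlow : (Measure.pi fun _ : Fin (n / 2) => Measure.pi fun _ : Fin p => P.prod P)
      {x | ∃ H ∈ nuclearSphere p r, ∑ k, |pairForm H (x k)| < c₁ / 2 * (n / 2 : ℕ)} ≤ eexp (-p)) :
    ((Measure.pi fun _ : Fin (n / 2) => Measure.pi fun _ : Fin p => P.prod P).prod (Measure.pi Q))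
      {q | (∀ H ∈ nuclearSphere p r, c₁ / 2 * (n / 2 : ℕ) ≤ ∑ k, |pairForm H (q.1 k)|) ∧
        (∑ i, |q.2 i|) / n ≤ 6 * τ ∧
        matSpectralNorm (∑ k, pairDiff q.2 k • pairMatrix (q.1 k)) ≤
          63488 * c * τ * (√((n : ℝ) * p) + √(Real.log n) * p)}ᶜ ≤
      ENNReal.ofReal (2 / n) + 3 * eexp (-p) := by
  set ρ := Measure.pi fun _ : Fin (n / 2) => Measure.pi fun _ : Fin p => P.prod P
  set B₁ := {x : Fin (n / 2) → Fin p → ℝ × ℝ |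
    ∃ H ∈ nuclearSphere p r, ∑ k, |pairForm H (x k)| < c₁ / 2 * (n / 2 : ℕ)}
  set B₂ := {w : Fin n → ℝ | ∃ i, 2 * τ * √(Real.log n) < |w i|} with hB₂
  set B₃ := {w : Fin n → ℝ | 36 * n * τ ^ 2 < ∑ i, w i ^ 2} with hB₃
  set B₄ := {q : (Fin (n / 2) → Fin p → ℝ × ℝ) × (Fin n → ℝ) |
    ((∀ i, |q.2 i| ≤ 2 * τ * √(Real.log n)) ∧ ∑ i, q.2 i ^ 2 ≤ 36 * n * τ ^ 2) ∧
      63488 * c * τ * (√((n : ℝ) * p) + √(Real.log n) * p) <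
        matSpectralNorm (∑ k, pairDiff q.2 k • pairMatrix (q.1 k))}
  have hn0 : 0 < n := by omega
  calc _ ≤ (ρ.prod (Measure.pi Q))
        (Set.univ ×ˢ B₂ ∪ (B₁ ×ˢ Set.univ ∪ (Set.univ ×ˢ B₃ ∪ B₄))) := by
        refine measure_mono fun q hq => ?_
        by_contra hcon
        simp only [Set.mem_union, Set.mem_prod, Set.mem_univ, true_and, and_true, not_or] at hcon
        obtain ⟨h2, h1, h3, h4⟩ := hcon
        have h2' : ∀ i, |q.2 i| ≤ 2 * τ * √(Real.log n) := fun i =>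
          not_lt.1 fun h => h2 ⟨i, h⟩
        have h3' : ∑ i, q.2 i ^ 2 ≤ 36 * n * τ ^ 2 := not_lt.1 h3
        exact hq ⟨fun H hH => not_lt.1 fun h => h1 ⟨H, hH, h⟩,
          sum_abs_div_le_of_sum_sq_le hn0 hτ h3', not_lt.1 fun h => h4 ⟨⟨h2', h3'⟩, h⟩⟩
    _ ≤ (ρ.prod (Measure.pi Q)) (Set.univ ×ˢ B₂) + ((ρ.prod (Measure.pi Q)) (B₁ ×ˢ Set.univ) +
        ((ρ.prod (Measure.pi Q)) (Set.univ ×ˢ B₃) + (ρ.prod (Measure.pi Q)) B₄)) :=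
      (measure_union_le _ _).trans (add_le_add_right ((measure_union_le _ _).trans
        (add_le_add_right (measure_union_le _ _) _)) _)
    _ ≤ ENNReal.ofReal (2 / n) + (eexp (-p) + (eexp (-p) + eexp (-p))) := by
        simp only [Measure.prod_prod, measure_univ, one_mul, mul_one]
        gcongr
        · exact measure_pi_exists_lt_abs_le hn hτ hQ
        · exact (measure_pi_lt_sum_sq_le hτ hQ).trans
            (eexp_mono (neg_le_neg (by exact_mod_cast hpn)))
        · exact prod_measure_lt_matSpectralNorm_pairDiff_le hc hP hp hn0 hτ
    _ = ENNReal.ofReal (2 / n) + 3 * eexp (-p) := by ring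

/-- The good set G involves uncountably many H and is not shown to be measurable, so the event is
the complement of a measurable hull of the bad preimage. -/
theorem exists_measurableSet_forall_mem_of_map_compl_le {Ω F : Type*} [MeasurableSpace Ω]
    [MeasurableSpace F] {μ : Measure Ω} [IsProbabilityMeasure μ] {f : Ω → F}
    (hf : AEMeasurable f μ) {G : Set F} {a : ℝ} (ha : 0 ≤ a)
    (h : μ.map f Gᶜ ≤ ENNReal.ofReal a) :
    ∃ E, MeasurableSet E ∧ 1 - a ≤ μ.real E ∧ ∀ ω ∈ E, f ω ∈ G := by
  refine ⟨(toMeasurable μ (f ⁻¹' Gᶜ))ᶜ, (measurableSet_toMeasurable μ _).compl, ?_, fun ω hω =>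
    not_not.1 fun hG => hω (subset_toMeasurable μ _ hG)⟩
  rw [probReal_compl_eq_one_sub (measurableSet_toMeasurable μ _), measureReal_def,
    measure_toMeasurable]
  exact sub_le_sub_left
    (ENNReal.toReal_le_of_le_ofReal ha ((Measure.le_map_apply hf _).trans h)) 1

end Noise

theorem proposition3p1 (P : Measure ℝ) [IsProbabilityMeasure P]
    (hsymm : P.map (fun x => -x) = P)
    (hsub : ∃ τ₀ : ℝ, 0 < τ₀ ∧ IsSubGaussianWith (fun w => w) τ₀ P)
    (hvar : Var[fun w => w; P] = 1)
    (hvar_sq : 0 < Var[fun w => w ^ 2; P]) :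
    ∃ C CP W₁ W₂ δ : ℝ, 0 < C ∧ 0 < CP ∧ 0 < W₁ ∧ 0 < W₂ ∧ 0 < δ ∧
      ∀ (n p r : ℕ), 1 ≤ r → C * r * p ≤ n →
      ∀ (τ : ℝ), 0 < τ →
      ∀ (Ω : Type*) [MeasurableSpace Ω] (μ : Measure Ω) [IsProbabilityMeasure μ]
        (β : Fin n → Fin p → Ω → ℝ) (z : Fin n → Ω → ℝ),
        (∀ i j, HasLaw (β i j) P μ) →
        (∀ i, AEMeasurable (z i) μ) →
        (∀ i, IsSubGaussianWith (z i) τ μ) →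
        iIndepFun (Sum.elim (fun ij : Fin n × Fin p => β ij.1 ij.2) z) μ →
        ∃ E : Set Ω, MeasurableSet E ∧
          1 - 2 / (n : ℝ) - 5 * Real.exp (-δ * p) ≤ μ.real E ∧
          ∀ ω ∈ E, ∀ A : Matrix (Fin p) (Fin p) ℝ, A.IsSymm →
            let b : Fin n → Fin p → ℝ := fun i j => β i j ω
            let y : Fin n → ℝ := fun i => srop b A i + z i ω
            let η : ℝ := CP * τ * (√((n : ℝ) * p) + √(Real.log n) * p)
            (∃ Ahat, IsSropEstimator b y τ η Ahat) ∧
            ∀ Ahat, IsSropEstimator b y τ η Ahat → ∀ T, IsMaxPart r A T →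
              frobeniusSq (Ahat - A) ≤
                W₁ * τ ^ 2 * min ((r : ℝ) * p ^ 2 * Real.log n / n ^ 2 + r * p / n) 1 +
                W₂ * nuclearNorm (A - T) ^ 2 / r := by
  obtain ⟨τ₀, hτ₀, hsub⟩ := hsub
  have hP := hasSubgaussianMGF_of_symmetric hsymm hτ₀ hsub
  have hc : 0 < Real.toNNReal (12 * τ₀ ^ 2) := Real.toNNReal_pos.2 (by positivity)
  generalize Real.toNNReal (12 * τ₀ ^ 2) = c at hP hc
  have hc0 : (0 : ℝ) < c := by exact_mod_cast hc
  obtain ⟨c₁, hc₁, hsmall⟩ := exists_le_integral_abs_pairForm hP hsymm hvar_sq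
  obtain ⟨C₁, hC₁, hlow⟩ := exists_measure_sum_abs_pairForm_lt_le hc hP hc₁ hsmall
  -- The factor 3 pays for n ≤ 3⌊n/2⌋, and the lower bound 1 gives p ≤ n, which lets the noise tail
  -- e⁻ⁿ be counted as e⁻ᵖ.
  refine ⟨max (3 * C₁) 1, 63488 * c,
    max (5184 / c₁ ^ 2) (28800 * (63488 * c) ^ 2 / c₁ ^ 4), 1, 1, by positivity, by positivity,
    by positivity, one_pos, one_pos, ?_⟩
  intro n p r hr hn τ hτ Ω _ μ _ β z hβ hz hzs hind
  have hrp : (p : ℝ) ≤ r * p :=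
    le_mul_of_one_le_left (Nat.cast_nonneg p) (by exact_mod_cast hr)
  have hn1 : (r : ℝ) * p ≤ n := le_trans (by
    rw [mul_assoc]; exact le_mul_of_one_le_left (by positivity) (le_max_right _ _)) hn
  have hpn : p ≤ n := by exact_mod_cast hrp.trans hn1
  -- In the excluded cases the claimed probability is not positive: p = 0 gives 5e⁰ = 5, and n = 1
  -- gives 2/n = 2. The empty event then suffices.
  by_cases hcase : 2 ≤ n ∧ 0 < p
  swap
  · refine ⟨∅, .empty, ?_, by simp⟩
    rw [measureReal_empty]
    rcases Nat.eq_zero_or_pos p with rfl | hp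
    · have : (0 : ℝ) ≤ 2 / n := by positivity
      simp only [CharP.cast_eq_zero, mul_zero, Real.exp_zero]
      linarith
    · have hn2 : n = 1 := by omega
      rw [hn2]
      have := Real.exp_pos (-1 * (p : ℝ))
      norm_num
      exact (Left.neg_nonpos_iff.2 zero_le_one).trans (by positivity)
  obtain ⟨hn2, hp⟩ := hcase
  have hm : C₁ * r * p ≤ (n / 2 : ℕ) := by
    have h1 : 3 * C₁ * r * p ≤ n := le_trans (by gcongr; exact le_max_left _ _) hn
    have h2 : (n : ℝ) ≤ 3 * (n / 2 : ℕ) := by exact_mod_cast (by omega : n ≤ 3 * (n / 2))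
    linarith
  obtain ⟨hΨ, hlaw⟩ := map_pairing_prodMk_eq hβ hz hind
  have hQ : ∀ i, IsProbabilityMeasure (μ.map (z i)) := fun i =>
    Measure.isProbabilityMeasure_map (hz i)
  have hbad := prod_measure_not_regular_le hc hP hp hn2 hpn hτ (fun i => (hzs i).map (hz i))
    (hlow p r (n / 2) hp hr hm)
  have hle : ENNReal.ofReal (2 / n) + 3 * eexp (-p) =
      ENNReal.ofReal (2 / n + 3 * Real.exp (-p)) := by
    rw [ENNReal.ofReal_add (by positivity) (by positivity), ENNReal.ofReal_mul (by norm_num),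
      ENNReal.ofReal_ofNat, eexp]
  rw [← hlaw, hle] at hbad
  obtain ⟨E, hE, hμE, hgood⟩ :=
    exists_measurableSet_forall_mem_of_map_compl_le hΨ (by positivity) hbad
  refine ⟨E, hE, le_trans ?_ hμE, fun ω hω A hA => ?_⟩
  · have := Real.exp_pos (-(p : ℝ))
    rw [neg_one_mul]
    linarith
  · obtain ⟨h1, h2, h3⟩ := hgood ω hω
    have hfeas := mem_sropFeasible_of_noise (b := fun i j => β i j ω) hA h2 h3
    exact ⟨exists_isSropEstimator hfeas, fun Ahat hAhat T hT =>
      frobeniusSq_sub_le_of_isSropEstimator hn2 hr hτ (by positivity) hc₁ h1 hfeas hAhat hT⟩
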